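/- Let $\tau:E\to M$ be a Lie algebroid over a smooth (Hausdorff, finite-dimensional) manifold, of finite rank, with anchor $\rho$ and bracket $[\ ,\ ]$. For a curve $c$ in a manifold $N$, defined near $0\in\mathbb R$, let $[c]^r=j^r_0c\in T^rN$ be its $r$-jet at $0$ (so $T^1N=TN$), and let $c^{(r)}(t)=[h\mapsto c(t+h)]^r$ be its prolongation. Let $\chi_r:T^rTN\to TT^rN$ be the canonical flip, $\chi_r\bigl([t\mapsto[s\mapsto\gamma(s,t)]^1]^r\bigr)=[s\mapsto[t\mapsto\gamma(s,t)]^r]^1$. A smooth curve $a$ in $E$ is admissible if $\rho\circ a=\dot\gamma$, where $\gamma=\tau\circ a$. For $k\ge 1$, $E^k\subset T^{k-1}E$ is the submanifold of $(k-1)$-jets $[a]^{k-1}$ of admissible curves, and $a^k=a^{(k-1)}$. Let $a$ be an admissible curve defined on an open set $J\subseteq\mathbb R$ and let $\sigma$ be a smooth section of $E$ along $\gamma=\tau\circ a$ on $J$. The first-order variational vector field $\Xi_a\sigma:J\to TE$ is the vector field along $a$ given in local coordinates $(x^i,y^\alpha)$ of $E$, with $\rho(e_\alpha)=\rho^i_\alpha\,\partial/\partial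 x^i$ and $[e_\beta,e_\mu]=C^\alpha_{\beta\mu}e_\alpha$, by $$\Xi_a\sigma(t)=\rho^i_\alpha(\gamma(t))\,\sigma^\alpha(t)\,\frac{\partial}{\partial x^i}\Big|_{a(t)}+\bigl(\dot\sigma^\alpha(t)+C^\alpha_{\beta\mu}(\gamma(t))\,a^\beta(t)\,\sigma^\mu(t)\bigr)\frac{\partial}{\partial y^\alpha}\Big|_{a(t)} .$$ The $k$-th order variational vector field $\Xi^k_a\sigma$ is the vector field along $a^k$ defined by $$\Xi^k_a\sigma(t)=\frac{d}{ds}\Big|_{s=0}(\alpha_s)^k(t),\qquad \alpha_s=\alpha(s,\cdot),$$ where $\alpha\,dt+\beta\,ds$ is any smooth morphism of Lie algebroids from the tangent bundle of a neighbourhood of $(0,t)$ in $\mathbb R^2$ to $E$ with $\alpha(0,\cdot)=a$ and $\beta(0,\cdot)=\sigma$ near $t$. Then $\Xi_a\sigma$ is smooth on $J$ and, for every $k\ge1$ and every $t\in J$, the vector $\chi_{k-1}\bigl((\Xi_a\sigma)^{(k-1)}(t)\bigr)$ is tangent to $E^k$ at $a^k(t)$ and equals $\Xi^k_a\sigma(t)$.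 That is, morphisms $\alpha\,dt+\beta\,ds$ as above exist, and every one of them satisfies $\frac{d}{ds}\big|_{s=0}(\alpha_s)^k(t)=\chi_{k-1}\bigl((\Xi_a\sigma)^{(k-1)}(t)\bigr)$. -/

import Mathlib

set_option linter.unusedSectionVars false
open Set Filter Bundle
open scoped Manifold ContDiff Topology

namespace JetCalc

variable {V W : Type*} [NormedAddCommGroup V] [NormedSpace ℝ V]
  [NormedAddCommGroup W] [NormedSpace ℝ W]

theorem iteratedDeriv_comp_congr {f : V → W} {c₁ c₂ : ℝ → V} {k : ℕ}
    (hf : ContDiffAt ℝ ∞ f (c₁ 0)) (h₁ : ContDiffAt ℝ ∞ c₁ 0) (h₂ : ContDiffAt ℝ ∞ c₂ 0)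
    (h : ∀ m ≤ k, iteratedDeriv m c₁ 0 = iteratedDeriv m c₂ 0) {m : ℕ} (hm : m ≤ k) :
    iteratedDeriv m (f ∘ c₁) 0 = iteratedDeriv m (f ∘ c₂) 0 := by
  have h0 : c₁ 0 = c₂ 0 := by simpa using h 0 (Nat.zero_le _)
  have hf2 : ContDiffAt ℝ ∞ f (c₂ 0) := h0 ▸ hf
  have hmi : ((m : ℕ) : ℕ∞ω) ≤ ∞ := by exact_mod_cast le_top
  simp only [iteratedDeriv, iteratedFDeriv_comp hf h₁ hmi, iteratedFDeriv_comp hf2 h₂ hmi]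
  simp only [FormalMultilinearSeries.taylorComp, sum_apply,
    FormalMultilinearSeries.compAlongOrderedFinpartition_apply, ftaylorSeries, h0]
  refine Finset.sum_congr rfl fun c _ => ?_
  congr 1
  funext i
  simp only [OrderedFinpartition.applyOrderedFinpartition]
  have := h (c.partSize i) ((c.partSize_le i).trans hm)
  simpa [iteratedDeriv, Function.comp_def] using this

/-- The polynomial curve `x + ∑_{j=1}^k (t^j / j!) v_j`. -/
noncomputable def poly (k : ℕ) (x : V) (v : Fin k → V) (t : ℝ) : V :=
  x + ∑ m : Fin k, (t ^ (m.val + 1) / (Nat.factorial (m.val + 1) : ℝ)) • v m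

@[simp] theorem poly_zero (k : ℕ) (x : V) (v : Fin k → V) : poly k x v 0 = x := by
  simp [poly]

theorem contDiff_poly_uncurry (k : ℕ) :
    ContDiff ℝ ∞ (fun p : (V × (Fin k → V)) × ℝ => poly k p.1.1 p.1.2 p.2) := by
  unfold poly
  fun_prop

theorem contDiff_poly (k : ℕ) (x : V) (v : Fin k → V) : ContDiff ℝ ∞ (poly k x v) := by
  unfold poly
  fun_prop

theorem iteratedDeriv_poly (k : ℕ) (x : V) (v : Fin k → V) (m : Fin k) :
    iteratedDeriv (m.val + 1) (poly k x v) 0 = v m := by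
  unfold poly
  rw [iteratedDeriv_fun_add (by fun_prop) (by fun_prop),
    iteratedDeriv_fun_sum (fun i _ => by fun_prop)]
  have key : ∀ j : Fin k, iteratedDeriv (m.val + 1)
      (fun t : ℝ => (t ^ (j.val + 1) / (Nat.factorial (j.val + 1) : ℝ)) • v j) 0
      = if j = m then v j else 0 := by
    intro j
    rw [iteratedDeriv_smul_const (by fun_prop), iteratedDeriv_div_const,
      iteratedDeriv_fun_pow_zero]
    by_cases hj : j = m
    · subst hj
      simp [Nat.factorial_ne_zero]
    · have : ¬ (m.val + 1 = j.val + 1) := fun h => hj (Fin.ext (by omega))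
      rw [if_neg this, if_neg hj]
      simp
  simp [key, iteratedDeriv_const]

/-- The action of a map `f` on the Taylor coefficients of order `1, …, k` of a curve through `x`:
`v ↦ ((d/dt)^j f (x + ∑ t^i / i! v_i) at t = 0)_j`. -/
noncomputable def jetMap (k : ℕ) (f : V → W) (x : V) (v : Fin k → V) : Fin k → W :=
  fun m => iteratedDeriv (m.val + 1) (f ∘ poly k x v) 0

/-- The Taylor coefficients of order `1, …, k` of a curve at `0`. -/
noncomputable def derivs (k : ℕ) (c : ℝ → V) : Fin k → V :=
  fun m => iteratedDeriv (m.val + 1) c 0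

theorem jetMap_derivs {k : ℕ} {f : V → W} {c : ℝ → V} (hf : ContDiffAt ℝ ∞ f (c 0))
    (hc : ContDiffAt ℝ ∞ c 0) : jetMap k f (c 0) (derivs k c) = derivs k (f ∘ c) := by
  funext m
  refine iteratedDeriv_comp_congr (k := k) (by rw [poly_zero]; exact hf) (contDiff_poly _ _ _).contDiffAt hc
    ?_ m.2
  intro j hj
  cases j with
  | zero => simp
  | succ j => exact iteratedDeriv_poly k (c 0) (derivs k c) ⟨j, hj⟩

theorem derivs_congr {k : ℕ} {c c' : ℝ → V} (h : c =ᶠ[𝓝 0] c') : derivs k c = derivs k c' := by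
  funext m
  exact h.iteratedDeriv_eq _

theorem derivs_poly (k : ℕ) (x : V) (v : Fin k → V) : derivs k (poly k x v) = v :=
  funext fun m => iteratedDeriv_poly k x v m

/-- Partial derivatives in a real parameter of a smooth map are smooth. -/
theorem contDiffOn_iteratedDeriv_snd {P : Type*} [NormedAddCommGroup P] [NormedSpace ℝ P]
    (G : P × ℝ → W) {U : Set (P × ℝ)} (hU : IsOpen U) (hG : ContDiffOn ℝ ∞ G U) (m : ℕ) :
    ContDiffOn ℝ ∞ (fun p : P × ℝ => iteratedDeriv m (fun t => G (p.1, t)) p.2) U := by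
  induction m with
  | zero => simpa using hG
  | succ m ih =>
    have h1 : ContDiffOn ℝ ∞ (fun p => fderiv ℝ
        (fun p : P × ℝ => iteratedDeriv m (fun t => G (p.1, t)) p.2) p ((0 : P), (1 : ℝ))) U :=
      (ih.fderiv_of_isOpen hU (m := ∞) (by simp)).clm_apply contDiffOn_const
    refine h1.congr fun p hp => ?_
    rw [iteratedDeriv_succ]
    have hd : HasFDerivAt (fun p : P × ℝ => iteratedDeriv m (fun t => G (p.1, t)) p.2) _ p :=
      ((ih.contDiffAt (hU.mem_nhds hp)).differentiableAt (by simp)).hasFDerivAt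
    have hl : HasDerivAt (fun t : ℝ => (p.1, t)) ((0 : P), (1 : ℝ)) p.2 :=
      (hasDerivAt_const _ _).prodMk (hasDerivAt_id _)
    exact (HasFDerivAt.comp_hasDerivAt p.2 (by exact hd) hl).deriv

theorem contDiffOn_jetMap {k : ℕ} {f : V → W} {U : Set V} (hU : IsOpen U)
    (hf : ContDiffOn ℝ ∞ f U) :
    ContDiffOn ℝ ∞ (fun p : V × (Fin k → V) => jetMap k f p.1 p.2) (U ×ˢ univ) := by
  rw [contDiffOn_pi]
  intro m
  have hc := contDiff_poly_uncurry (V := V) k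
  have h := contDiffOn_iteratedDeriv_snd
    (fun p : (V × (Fin k → V)) × ℝ => f (poly k p.1.1 p.1.2 p.2))
    (U := (fun p : (V × (Fin k → V)) × ℝ => poly k p.1.1 p.1.2 p.2) ⁻¹' U)
    (hU.preimage hc.continuous)
    (hf.comp hc.contDiffOn fun _ h => h) (m.val + 1)
  have hl : ContDiffOn ℝ ∞ (fun p : V × (Fin k → V) => (p, (0 : ℝ))) (U ×ˢ univ) :=
    contDiffOn_id.prodMk contDiffOn_const
  have hm : MapsTo (fun p : V × (Fin k → V) => (p, (0 : ℝ))) (U ×ˢ univ)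
      ((fun p : (V × (Fin k → V)) × ℝ => poly k p.1.1 p.1.2 p.2) ⁻¹' U) := by
    intro p hp
    simpa using hp.1
  have h' := h.comp hl hm
  exact h'

theorem iteratedDeriv_clm_comp (L : V →L[ℝ] W) {c : ℝ → V} {t : ℝ} (hc : ContDiffAt ℝ ∞ c t)
    (m : ℕ) : iteratedDeriv m (fun t => L (c t)) t = L (iteratedDeriv m c t) := by
  have h := L.iteratedFDeriv_comp_left (hc.of_le (m := (m : ℕ∞ω)) (by exact_mod_cast le_top))
    (i := m) le_rfl
  simp only [iteratedDeriv]
  exact congrArg (fun f => f fun _ => (1 : ℝ)) h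

theorem deriv_deriv_comm {G : ℝ × ℝ → V} {U : Set (ℝ × ℝ)} (hU : IsOpen U)
    (hG : ContDiffOn ℝ ∞ G U) {s t : ℝ} (hp : (s, t) ∈ U) :
    deriv (fun t' => deriv (fun s' => G (s', t')) s) t =
      deriv (fun s' => deriv (fun t' => G (s', t')) t) s := by
  have hl1 : ∀ s t : ℝ, HasDerivAt (fun s' : ℝ => (s', t)) ((1 : ℝ), (0 : ℝ)) s := fun s t =>
    (hasDerivAt_id _).prodMk (hasDerivAt_const _ _)
  have hl2 : ∀ s t : ℝ, HasDerivAt (fun t' : ℝ => (s, t')) ((0 : ℝ), (1 : ℝ)) t := fun s t =>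
    (hasDerivAt_const _ _).prodMk (hasDerivAt_id _)
  have hd : ∀ p ∈ U, HasFDerivAt G (fderiv ℝ G p) p := fun p hp =>
    ((hG.contDiffAt (hU.mem_nhds hp)).differentiableAt (by simp)).hasFDerivAt
  have hG' : ContDiffOn ℝ ∞ (fderiv ℝ G) U := hG.fderiv_of_isOpen hU (m := ∞) (by simp)
  have hd2 : HasFDerivAt (fderiv ℝ G) (fderiv ℝ (fderiv ℝ G) (s, t)) (s, t) :=
    ((hG'.contDiffAt (hU.mem_nhds hp)).differentiableAt (by simp)).hasFDerivAt
  have e1 : (fun t' => deriv (fun s' => G (s', t')) s) =ᶠ[𝓝 t]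
      fun t' => fderiv ℝ G (s, t') ((1 : ℝ), (0 : ℝ)) := by
    have : ∀ᶠ t' in 𝓝 t, (s, t') ∈ U :=
      (hl2 s t).continuousAt.eventually (hU.mem_nhds hp)
    filter_upwards [this] with t' ht'
    exact ((hd _ ht').comp_hasDerivAt s (hl1 s t')).deriv
  have e2 : (fun s' => deriv (fun t' => G (s', t')) t) =ᶠ[𝓝 s]
      fun s' => fderiv ℝ G (s', t) ((0 : ℝ), (1 : ℝ)) := by
    have : ∀ᶠ s' in 𝓝 s, (s', t) ∈ U :=
      (hl1 s t).continuousAt.eventually (hU.mem_nhds hp)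
    filter_upwards [this] with s' hs'
    exact ((hd _ hs').comp_hasDerivAt t (hl2 s' t)).deriv
  have q1 : HasDerivAt (fun t' => fderiv ℝ G (s, t'))
      (fderiv ℝ (fderiv ℝ G) (s, t) ((0 : ℝ), (1 : ℝ))) t := hd2.comp_hasDerivAt t (hl2 s t)
  have q2 : HasDerivAt (fun s' => fderiv ℝ G (s', t))
      (fderiv ℝ (fderiv ℝ G) (s, t) ((1 : ℝ), (0 : ℝ))) s := hd2.comp_hasDerivAt s (hl1 s t)
  have d1 : deriv (fun t' => fderiv ℝ G (s, t') ((1 : ℝ), (0 : ℝ))) t =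
      fderiv ℝ (fderiv ℝ G) (s, t) ((0 : ℝ), (1 : ℝ)) ((1 : ℝ), (0 : ℝ)) :=
    ((ContinuousLinearMap.apply ℝ V ((1 : ℝ), (0 : ℝ))).hasFDerivAt.comp_hasDerivAt t q1).deriv
  have d2 : deriv (fun s' => fderiv ℝ G (s', t) ((0 : ℝ), (1 : ℝ))) s =
      fderiv ℝ (fderiv ℝ G) (s, t) ((1 : ℝ), (0 : ℝ)) ((0 : ℝ), (1 : ℝ)) :=
    ((ContinuousLinearMap.apply ℝ V ((0 : ℝ), (1 : ℝ))).hasFDerivAt.comp_hasDerivAt s q2).deriv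
  have hsymm : IsSymmSndFDerivAt ℝ G (s, t) :=
    (hG.contDiffAt (hU.mem_nhds hp)).isSymmSndFDerivAt
      (by rw [minSmoothness_of_isRCLikeNormedField]; exact ENat.LEInfty.out)
  rw [e1.deriv_eq, e2.deriv_eq, d1, d2]
  exact hsymm _ _

theorem deriv_iteratedDeriv_comm {G : ℝ × ℝ → V} {U : Set (ℝ × ℝ)} (hU : IsOpen U)
    (hG : ContDiffOn ℝ ∞ G U) (m : ℕ) {s t : ℝ} (hp : (s, t) ∈ U) :
    iteratedDeriv m (fun t' => deriv (fun s' => G (s', t')) s) t =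
      deriv (fun s' => iteratedDeriv m (fun t' => G (s', t')) t) s := by
  induction m generalizing t with
  | zero => simp
  | succ m ih =>
    have hK := contDiffOn_iteratedDeriv_snd G hU hG m
    have e : iteratedDeriv m (fun t' => deriv (fun s' => G (s', t')) s) =ᶠ[𝓝 t]
        fun t' => deriv (fun s' => iteratedDeriv m (fun t'' => G (s', t'')) t') s := by
      have : ∀ᶠ t' in 𝓝 t, (s, t') ∈ U :=
        ((by fun_prop : Continuous fun t' : ℝ => (s, t')).continuousAt).eventually (hU.mem_nhds hp)
      filter_upwards [this] with t' ht'
      exact ih ht'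
    simp only [iteratedDeriv_succ]
    rw [e.deriv_eq]
    exact deriv_deriv_comm hU hK hp

end JetCalc

section Jets

variable {V H : Type*} [NormedAddCommGroup V] [NormedSpace ℝ V] [TopologicalSpace H]
  (I : ModelWithCorners ℝ V H) [I.Boundaryless]
  (N : Type*) [TopologicalSpace N] [ChartedSpace H N]

namespace JetCalc
variable {I N} in
theorem change_contDiffOn [IsManifold I ∞ N] (i j : atlas H N) :
    ContDiffOn ℝ ∞ (j.1.extend I ∘ (i.1.extend I).symm) (I.extendCoordChange i.1 j.1).source :=
  I.contDiffOn_extendCoordChange (IsManifold.subset_maximalAtlas i.2)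
    (IsManifold.subset_maximalAtlas j.2)

variable {N} in
theorem change_isOpen (i j : atlas H N) : IsOpen (I.extendCoordChange i.1 j.1).source := by
  rw [I.extendCoordChange_source]
  exact I.toHomeomorph.isOpenMap _ (OpenPartialHomeomorph.open_source _)

variable {I N} in
theorem change_mem (i j : atlas H N) {x : N} (hi : x ∈ i.1.source) (hj : x ∈ j.1.source) :
    i.1.extend I x ∈ (I.extendCoordChange i.1 j.1).source := by
  rw [← i.1.extend_image_source_inter]
  exact mem_image_of_mem _ ⟨hi, hj⟩

variable {W : Type*} [NormedAddCommGroup W] [NormedSpace ℝ W] in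
theorem contDiffOn_chartChange {k : ℕ} {f g : V → V} {φ : V → W} {A B U : Set V} (hU : IsOpen U)
    (hf : ContDiffOn ℝ ∞ f A) (hg : ContDiffOn ℝ ∞ g B) (hφ : ContDiffOn ℝ ∞ φ U) :
    ContDiffOn ℝ ∞ (fun p : V × (Fin k → V) => (f p.1, jetMap k φ (g p.1) p.2))
      {p | p.1 ∈ A ∧ p.1 ∈ B ∧ g p.1 ∈ U} := by
  have h1 : ContDiffOn ℝ ∞ (fun p : V × (Fin k → V) => f p.1)
      {p | p.1 ∈ A ∧ p.1 ∈ B ∧ g p.1 ∈ U} :=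
    hf.comp contDiffOn_fst fun p hp => hp.1
  have h2 : ContDiffOn ℝ ∞ (fun p : V × (Fin k → V) => (g p.1, p.2))
      {p | p.1 ∈ A ∧ p.1 ∈ B ∧ g p.1 ∈ U} :=
    (hg.comp contDiffOn_fst fun p hp => hp.2.1).prodMk contDiffOn_snd
  have h3 := (contDiffOn_jetMap (k := k) hU hφ).comp h2 fun p hp => ⟨hp.2.2, mem_univ _⟩
  exact h1.prodMk h3

end JetCalc

open JetCalc

variable [IsManifold I ∞ N]

/-- `T^k N → N` as a fibre bundle: over a chart, a `k`-velocity is described by the Taylor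
coefficients of order `1, …, k` of a representing curve. -/
noncomputable def jetBundleCore (k : ℕ) : FiberBundleCore (atlas H N) N (Fin k → V) where
  baseSet i := i.1.source
  isOpen_baseSet i := i.1.open_source
  indexAt := achart H
  mem_baseSet_at := mem_chart_source H
  coordChange i j x v := jetMap k (j.1.extend I ∘ (i.1.extend I).symm) (i.1.extend I x) v
  coordChange_self i x hx v := by
    have hmem := change_mem (I := I) i i hx hx
    have hf := (change_contDiffOn (I := I) i i).contDiffAt ((change_isOpen I i i).mem_nhds hmem)
    have h := jetMap_derivs (k := k) (c := poly k (i.1.extend I x) v) (by rw [poly_zero]; exact hf)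
      (contDiff_poly _ _ _).contDiffAt
    rw [derivs_poly, poly_zero] at h
    rw [h]
    conv_rhs => rw [← derivs_poly k (i.1.extend I x) v]
    apply derivs_congr
    have hc : Tendsto (poly k (i.1.extend I x) v) (𝓝 0) (𝓝 (i.1.extend I x)) := by
      simpa using (contDiff_poly k (i.1.extend I x) v).continuous.tendsto 0
    filter_upwards [hc.eventually ((change_isOpen I i i).mem_nhds hmem)] with t ht
    exact (i.1.extend I).right_inv (by simpa using ht.1)
  continuousOn_coordChange i j := by
    refine (contDiffOn_jetMap (k := k) (change_isOpen I i j) (change_contDiffOn i j)).continuousOn.comp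
      (f := fun p : N × (Fin k → V) => (i.1.extend I p.1, p.2)) ?_ ?_
    · exact ((i.1.continuousOn_extend (I := I)).comp continuousOn_fst
        (fun p hp => by simpa using hp.1.1)).prodMk continuousOn_snd
    · intro p hp
      exact ⟨change_mem i j hp.1.1 hp.1.2, mem_univ _⟩
  coordChange_comp := by
    rintro i j l x ⟨⟨hi, hj⟩, hl⟩ v
    have hij := change_mem (I := I) i j hi hj
    have hjl := change_mem (I := I) j l hj hl
    have hil := change_mem (I := I) i l hi hl
    have fij := (change_contDiffOn (I := I) i j).contDiffAt ((change_isOpen I i j).mem_nhds hij)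
    have fjl := (change_contDiffOn (I := I) j l).contDiffAt ((change_isOpen I j l).mem_nhds hjl)
    have fil := (change_contDiffOn (I := I) i l).contDiffAt ((change_isOpen I i l).mem_nhds hil)
    have hp := (contDiff_poly k (i.1.extend I x) v).contDiffAt (x := (0 : ℝ))
    have e1 := jetMap_derivs (k := k) (c := poly k (i.1.extend I x) v) (by rw [poly_zero]; exact fij) hp
    have e3 := jetMap_derivs (k := k) (c := poly k (i.1.extend I x) v) (by rw [poly_zero]; exact fil) hp
    have h0 : ((j.1.extend I ∘ (i.1.extend I).symm) ∘ poly k (i.1.extend I x) v) 0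
        = j.1.extend I x := by
      simp only [Function.comp_apply, poly_zero]
      rw [i.1.extend_left_inv hi]
    have e2 := jetMap_derivs (k := k) (c := (j.1.extend I ∘ (i.1.extend I).symm) ∘
      poly k (i.1.extend I x) v) (f := l.1.extend I ∘ (j.1.extend I).symm) (by rw [h0]; exact fjl)
      (ContDiffAt.comp 0 (by rw [poly_zero]; exact fij) hp)
    rw [derivs_poly, poly_zero] at e1 e3
    rw [h0] at e2
    rw [e1, e2, e3]
    apply derivs_congr
    have hc : Tendsto (poly k (i.1.extend I x) v) (𝓝 0) (𝓝 (i.1.extend I x)) := by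
      simpa using (contDiff_poly k (i.1.extend I x) v).continuous.tendsto 0
    filter_upwards [hc.eventually ((change_isOpen I i j).mem_nhds hij)] with t ht
    simp only [Function.comp_apply]
    rw [(j.1.extend I).left_inv (by simpa using ht.2)]

/-- The `k`-th order tangent bundle `T^k N` of `k`-velocities of curves in `N`. -/
abbrev JetBundle (k : ℕ) : Type _ :=
  Bundle.TotalSpace (Fin k → V) (jetBundleCore I N k).Fiber

variable {N} in
/-- The `k`-velocity `[c]^k` at `0` of a curve `c` in `N`, described in the preferred chart
at `c 0`. -/
noncomputable def velocity (k : ℕ) (c : ℝ → N) : JetBundle I N k :=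
  ⟨c 0, derivs k (extChartAt I (c 0) ∘ c)⟩

instance jetBundle_isManifold (k : ℕ) : IsManifold (I.prod 𝓘(ℝ, Fin k → V)) ∞ (JetBundle I N k) := by
  refine isManifold_of_contDiffOn _ _ _ ?_
  intro e e' he he'
  obtain ⟨_, ⟨t, ⟨i, rfl⟩, rfl⟩, b, hb, rfl⟩ := he
  obtain ⟨_, ⟨t', ⟨j, rfl⟩, rfl⟩, b', hb', rfl⟩ := he'
  obtain ⟨c, hc, d, hd, rfl⟩ := hb
  obtain ⟨c', hc', d', hd', rfl⟩ := hb'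
  rw [chartedSpaceSelf_atlas] at hd hd'
  subst hd hd'
  let ci : atlas H N := ⟨c, hc⟩
  let ci' : atlas H N := ⟨c', hc'⟩
  have key := contDiffOn_chartChange (k := k) (change_isOpen I i j)
    (change_contDiffOn (I := I) ci ci') (change_contDiffOn (I := I) ci i)
    (change_contDiffOn (I := I) i j)
  have hmem : ∀ p ∈ (I.prod 𝓘(ℝ, Fin k → V)).symm ⁻¹'
      ((((jetBundleCore I N k).localTriv i).toOpenPartialHomeomorph ≫ₕ
        c.prod (OpenPartialHomeomorph.refl (Fin k → V))).symm ≫ₕ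
        ((jetBundleCore I N k).localTriv j).toOpenPartialHomeomorph ≫ₕ
        c'.prod (OpenPartialHomeomorph.refl (Fin k → V))).source ∩
        range (I.prod 𝓘(ℝ, Fin k → V)),
      I.symm p.1 ∈ c.target ∧ c.symm (I.symm p.1) ∈ i.1.source ∧
        c.symm (I.symm p.1) ∈ j.1.source ∧ c.symm (I.symm p.1) ∈ c'.source := by
    intro p hp
    have hp1 := hp.1
    simp only [mfld_simps] at hp1
    exact ⟨hp1.1.1.1, hp1.1.2, hp1.2.1, hp1.2.2⟩
  refine (key.congr_mono (fun p hp => ?_) fun p hp => ?_)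
  · obtain ⟨h1, h2, h3, h4⟩ := hmem p hp
    refine Prod.ext rfl ?_
    exact (jetBundleCore I N k).coordChange_comp i
      ((jetBundleCore I N k).indexAt (c.symm (I.symm p.1))) j (c.symm (I.symm p.1))
      ⟨⟨h2, (jetBundleCore I N k).mem_baseSet_at _⟩, h3⟩ p.2
  · obtain ⟨h1, h2, h3, h4⟩ := hmem p hp
    have hr : p.1 ∈ range I := by rw [I.range_eq_univ]; exact mem_univ _
    simp only [mfld_simps]
    refine ⟨⟨⟨hr, h1⟩, h4⟩, ⟨⟨hr, h1⟩, h2⟩, i.1.map_source h2, ?_⟩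
    have e : i.1.symm (i.1 (c.symm (I.symm p.1))) = c.symm (I.symm p.1) := i.1.left_inv h2
    have : i.1.symm (i.1 (ci.1.symm (I.symm p.1))) = c.symm (I.symm p.1) := e
    rw [this]
    exact h3


variable {N}

/-- The 1-velocity `[c]^1` at `0` of a curve, as an element of the tangent bundle. -/
noncomputable def tangentVec (c : ℝ → N) : TangentBundle I N :=
  ⟨c 0, mfderiv 𝓘(ℝ, ℝ) I c 0 (1 : ℝ)⟩

/-- The canonical flip `χ_k : T^k TN → T T^k N`. In the coordinates induced by a chart of `N`, a
point of `T^k TN` is the `k`-jet `(x_j, w_j)_{0 ≤ j ≤ k}` of a curve of tangent vectors, and `χ_k`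
sends it to the tangent vector `(w_j)_j` at the point `(x_j)_j` of `T^k N`. The characterization
`χ_k [t ↦ [s ↦ γ(s,t)]^1]^k = [s ↦ [t ↦ γ(s,t)]^k]^1` is `canonicalFlip_velocity`. -/
noncomputable def canonicalFlip (k : ℕ) (ξ : JetBundle I.tangent (TangentBundle I N) k) :
    TangentBundle (I.prod 𝓘(ℝ, Fin k → V)) (JetBundle I N k) :=
  let u : Fin k → V × V := ξ.snd
  ⟨⟨ξ.proj.proj, fun m => (u m).1⟩, (ξ.proj.snd, fun m => (u m).2)⟩

namespace JetCalc

variable {I} in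
theorem velocity_coord {k : ℕ} {c : ℝ → N} (hc : ContMDiffAt 𝓘(ℝ, ℝ) I ∞ c 0) {x : N}
    (hx : c 0 ∈ (chartAt H x).source) :
    (trivializationAt (Fin k → V) (jetBundleCore I N k).Fiber x (velocity I k c)).2 =
      derivs k (extChartAt I x ∘ c) := by
  change jetMap k ((chartAt H x).extend I ∘ ((chartAt H (c 0)).extend I).symm)
    ((chartAt H (c 0)).extend I (c 0)) (derivs k (extChartAt I (c 0) ∘ c)) = _
  have hmem := change_mem (I := I) (achart H (c 0)) (achart H x) (mem_chart_source H (c 0)) hx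
  have hf := (change_contDiffOn (I := I) (achart H (c 0)) (achart H x)).contDiffAt
    ((change_isOpen I _ _).mem_nhds hmem)
  have hcc : ContDiffAt ℝ ∞ (extChartAt I (c 0) ∘ c) 0 := by
    rw [← contMDiffAt_iff_contDiffAt]
    exact (contMDiffAt_extChartAt (n := ∞) (x := c 0)).comp 0 hc
  have h := jetMap_derivs (k := k) (c := extChartAt I (c 0) ∘ c) hf hcc
  refine h.trans (derivs_congr ?_)
  filter_upwards [hc.continuousAt.eventually (extChartAt_source_mem_nhds (I := I) (c 0))] with t ht
  exact congrArg (extChartAt I x) ((extChartAt I (c 0)).left_inv ht)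

variable {I} in
theorem tangentVec_coord {c : ℝ → N} (hc : ContMDiffAt 𝓘(ℝ, ℝ) I ∞ c 0) {x : N}
    (hx : c 0 ∈ (chartAt H x).source) :
    (trivializationAt V (TangentSpace I) x (tangentVec I c)).2 =
      deriv (extChartAt I x ∘ c) 0 := by
  have h1 := TangentBundle.continuousLinearMapAt_trivializationAt (I := I) hx
  have h2 : (trivializationAt V (TangentSpace I) x (tangentVec I c)).2 =
      (trivializationAt V (TangentSpace I) x).continuousLinearMapAt ℝ (c 0)
        (mfderiv 𝓘(ℝ, ℝ) I c 0 (1 : ℝ)) := by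
    rw [Trivialization.continuousLinearMapAt_apply, Trivialization.linearMapAt_apply,
      if_pos (by simpa using hx)]
    rfl
  rw [h2, h1]
  have h3 := mfderiv_comp (I := 𝓘(ℝ, ℝ)) (I' := I) (I'' := 𝓘(ℝ, V)) (0 : ℝ) (g := extChartAt I x) (f := c)
    (mdifferentiableAt_extChartAt hx) (hc.mdifferentiableAt (by simp))
  rw [mfderiv_eq_fderiv] at h3
  exact (congrArg (fun L : ℝ →L[ℝ] V => L 1) h3).symm

theorem tangentVec_eq_of_coord {I : ModelWithCorners ℝ V H} {f : ℝ → N} {D : V}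
    (hf : ContMDiffAt 𝓘(ℝ, ℝ) I ∞ f 0)
    (hD : deriv (extChartAt I (f 0) ∘ f) 0 = D) :
    mfderiv 𝓘(ℝ, ℝ) I f 0 (1 : ℝ) = D := by
  have h := (hf.mdifferentiableAt (by simp))
  rw [h.mfderiv]
  simp only [writtenInExtChartAt, Function.comp_def, mfld_simps, fderivWithin_univ]
  simpa [Function.comp_def] using! hD

end JetCalc

/-- The flip exchanges the order of the two velocities of a two-parameter family. -/
theorem canonicalFlip_velocity (k : ℕ) {γ : ℝ × ℝ → N} {W : Set (ℝ × ℝ)} (hW : IsOpen W)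
    (h0 : ((0 : ℝ), (0 : ℝ)) ∈ W) (hγ : ContMDiffOn 𝓘(ℝ, ℝ × ℝ) I ∞ γ W) :
    canonicalFlip I k (velocity I.tangent k fun t => tangentVec I fun s => γ (s, t)) =
      tangentVec (I.prod 𝓘(ℝ, Fin k → V)) fun s => velocity I k fun t => γ (s, t) := by
  set x : N := γ (0, 0) with hx
  set g : ℝ × ℝ → V := fun p => extChartAt I x (γ p) with hg
  -- an open neighbourhood on which `γ` takes values in the preferred chart at `x`
  set U : Set (ℝ × ℝ) := W ∩ γ ⁻¹' (chartAt H x).source with hUdef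
  have hU : IsOpen U := hγ.continuousOn.isOpen_inter_preimage hW (chartAt H x).open_source
  have h0U : ((0 : ℝ), (0 : ℝ)) ∈ U := ⟨h0, mem_chart_source H x⟩
  have hgs : ContDiffOn ℝ ∞ g U := by
    rw [← contMDiffOn_iff_contDiffOn]
    exact (contMDiffOn_extChartAt (n := ∞) (x := x)).comp (hγ.mono inter_subset_left)
      fun p hp => hp.2
  have hγU : ∀ p ∈ U, ContMDiffAt 𝓘(ℝ, ℝ × ℝ) I ∞ γ p := fun p hp =>
    hγ.contMDiffAt (hW.mem_nhds hp.1)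
  have hs : ∀ t : ℝ, ((0 : ℝ), t) ∈ U → ContMDiffAt 𝓘(ℝ, ℝ) I ∞ (fun s => γ (s, t)) 0 :=
    fun t ht => (hγU _ ht).comp 0
      ((by fun_prop : ContDiff ℝ ∞ fun s : ℝ => (s, t)).contMDiff.contMDiffAt)
  have ht : ∀ s : ℝ, (s, (0 : ℝ)) ∈ U → ContMDiffAt 𝓘(ℝ, ℝ) I ∞ (fun t => γ (s, t)) 0 :=
    fun s hs' => (hγU _ hs').comp 0
      ((by fun_prop : ContDiff ℝ ∞ fun t : ℝ => (s, t)).contMDiff.contMDiffAt)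
  have ev1 : ∀ᶠ t : ℝ in 𝓝 0, ((0 : ℝ), t) ∈ U :=
    ((by fun_prop : Continuous fun t : ℝ => ((0 : ℝ), t)).continuousAt).eventually
      (hU.mem_nhds h0U)
  have ev2 : ∀ᶠ s : ℝ in 𝓝 0, (s, (0 : ℝ)) ∈ U :=
    ((by fun_prop : Continuous fun s : ℝ => (s, (0 : ℝ))).continuousAt).eventually
      (hU.mem_nhds h0U)
  -- the left-hand side in coordinates
  have hL : derivs k (extChartAt I.tangent (tangentVec I fun s => γ (s, 0)) ∘
      fun t => tangentVec I fun s => γ (s, t)) =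
      derivs k (fun t => (g (0, t), deriv (fun s => g (s, t)) 0)) := by
    apply derivs_congr
    filter_upwards [ev1] with t ht'
    have := tangentVec_coord (hs t ht') (x := x) ht'.2
    exact Prod.ext rfl this
  have hL' : ∀ m : Fin k, derivs k (fun t => (g (0, t), deriv (fun s => g (s, t)) 0)) m =
      (iteratedDeriv (m.val + 1) (fun t => g (0, t)) 0,
        deriv (fun s => iteratedDeriv (m.val + 1) (fun t => g (s, t)) 0) 0) := by
    intro m
    have hmem : ContDiffAt ℝ ∞ (fun t => (g (0, t), deriv (fun s => g (s, t)) 0)) 0 := by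
      have hsw : ContDiff ℝ ∞ (fun q : ℝ × ℝ => (q.2, q.1)) := by fun_prop
      have h1 := contDiffOn_iteratedDeriv_snd (fun q : ℝ × ℝ => g (q.2, q.1))
        (U := (fun q : ℝ × ℝ => (q.2, q.1)) ⁻¹' U) (hU.preimage hsw.continuous)
        (hgs.comp hsw.contDiffOn fun _ h => h) 1
      have h2 := h1.contDiffAt (x := ((0 : ℝ), (0 : ℝ)))
        ((hU.preimage hsw.continuous).mem_nhds h0U)
      have h3 : ContDiffAt ℝ ∞ (fun t : ℝ => (t, (0 : ℝ))) 0 := by fun_prop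
      have h4 : ContDiffAt ℝ ∞ (fun t : ℝ => ((0 : ℝ), t)) 0 := by fun_prop
      have h5 := ContDiffAt.comp (f := fun t : ℝ => (t, (0 : ℝ))) (0 : ℝ) h2 h3
      simp only [iteratedDeriv_one] at h5
      exact (ContDiffAt.comp (f := fun t : ℝ => ((0 : ℝ), t)) (0 : ℝ)
        (hgs.contDiffAt (hU.mem_nhds h0U)) h4).prodMk h5
    rw [← deriv_iteratedDeriv_comm hU hgs (m.val + 1) h0U]
    exact Prod.ext (iteratedDeriv_clm_comp (ContinuousLinearMap.fst ℝ V V) hmem (m.val + 1)).symm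
      (iteratedDeriv_clm_comp (ContinuousLinearMap.snd ℝ V V) hmem (m.val + 1)).symm
  -- the right-hand side in coordinates
  have hR : ∀ᶠ s : ℝ in 𝓝 0, (trivializationAt (Fin k → V) (jetBundleCore I N k).Fiber x
      (velocity I k fun t => γ (s, t))).2 = derivs k (fun t => g (s, t)) := by
    filter_upwards [ev2] with s hs'
    exact velocity_coord (ht s hs') hs'.2
  have hRs : ContDiffAt ℝ ∞ (fun s => derivs k (fun t => g (s, t))) 0 := by
    rw [contDiffAt_pi]
    intro m
    have h2 := (contDiffOn_iteratedDeriv_snd g hU hgs (m.val + 1)).contDiffAt (hU.mem_nhds h0U)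
    have h3 : ContDiffAt ℝ ∞ (fun s : ℝ => (s, (0 : ℝ))) 0 := by fun_prop
    exact ContDiffAt.comp (f := fun s : ℝ => (s, (0 : ℝ))) (0 : ℝ) h2 h3
  have hf : ContMDiffAt 𝓘(ℝ, ℝ) (I.prod 𝓘(ℝ, Fin k → V)) ∞
      (fun s => velocity I k fun t => γ (s, t)) 0 := by
    rw [Bundle.contMDiffAt_totalSpace]
    refine ⟨hs 0 h0U, ?_⟩
    exact (hRs.contMDiffAt).congr_of_eventuallyEq hR
  have hgd : DifferentiableAt ℝ (fun s => g (s, 0)) 0 := by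
    have h3 : ContDiffAt ℝ ∞ (fun s : ℝ => (s, (0 : ℝ))) 0 := by fun_prop
    exact (ContDiffAt.comp (f := fun s : ℝ => (s, (0 : ℝ))) (0 : ℝ)
      (hgs.contDiffAt (hU.mem_nhds h0U)) h3).differentiableAt (by simp)
  have hD := tangentVec_eq_of_coord hf (D := (deriv (fun s => g (s, 0)) 0,
    fun m : Fin k => deriv (fun s => iteratedDeriv (m.val + 1) (fun t => g (s, t)) 0) 0)) (by
      have e : extChartAt (I.prod 𝓘(ℝ, Fin k → V)) (velocity I k fun t => γ (0, t)) ∘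
          (fun s => velocity I k fun t => γ (s, t)) =ᶠ[𝓝 0]
          fun s => (g (s, 0), derivs k (fun t => g (s, t))) := by
        filter_upwards [hR] with s hs'
        exact Prod.ext rfl hs'
      rw [e.deriv_eq]
      refine (hgd.hasDerivAt.prodMk (hasDerivAt_pi.2 fun m => ?_)).deriv
      exact ((contDiffAt_pi.1 hRs m).differentiableAt (by simp)).hasDerivAt)
  have hT := tangentVec_eq_of_coord (hs 0 h0U) (D := deriv (fun s => g (s, 0)) 0) rfl
  have glue : ∀ (p q : JetBundle I N k) (v w : V × (Fin k → V)), p = q → v = w →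
      (⟨p, v⟩ : TangentBundle (I.prod 𝓘(ℝ, Fin k → V)) (JetBundle I N k)) = ⟨q, w⟩ := by
    rintro p _ v _ rfl rfl
    rfl
  have hu : ∀ m : Fin k, derivs k (extChartAt I.tangent (tangentVec I fun s => γ (s, 0)) ∘
      fun t => tangentVec I fun s => γ (s, t)) m = _ := fun m => (congrFun hL m).trans (hL' m)
  refine glue _ _ _ _ ?_ ?_
  · exact congrArg (TotalSpace.mk x) (funext fun m => congrArg Prod.fst (hu m))
  · have e : ∀ (a b : V) (c d : Fin k → V), a = b → c = d → (a, c) = (b, d) := by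
      rintro a _ c _ rfl rfl
      rfl
    exact (e _ _ _ _ hT (funext fun m => congrArg Prod.snd (hu m))).trans hD.symm

/-- The prolongation `c^{(k)} : t ↦ [s ↦ c (t + s)]^k` of a curve `c` to `T^k N`. -/
noncomputable def prolong (k : ℕ) (c : ℝ → N) (t : ℝ) : JetBundle I N k :=
  velocity I k fun s => c (t + s)

/-- A vector is tangent to a subset `S` of a manifold if it is the velocity of a smooth curve
that lies in `S`; for an embedded submanifold these are the vectors of `TS`. -/
def IsTangentTo (S : Set N) (w : TangentBundle I N) : Prop :=
  ∃ (U : Set ℝ) (c : ℝ → N), IsOpen U ∧ (0 : ℝ) ∈ U ∧ ContMDiffOn 𝓘(ℝ, ℝ) I ∞ c U ∧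
    (∀ s ∈ U, c s ∈ S) ∧ tangentVec I c = w

end Jets

section Algebroid

variable {V H M : Type*} [NormedAddCommGroup V] [NormedSpace ℝ V] [TopologicalSpace H]
  (I : ModelWithCorners ℝ V H) [TopologicalSpace M] [ChartedSpace H M] [IsManifold I ∞ M]
  (F : Type*) [NormedAddCommGroup F] [NormedSpace ℝ F] (E : M → Type*)
  [∀ x, AddCommGroup (E x)] [∀ x, Module ℝ (E x)] [∀ x, TopologicalSpace (E x)]
  [TopologicalSpace (TotalSpace F E)] [FiberBundle F E] [VectorBundle ℝ F E]

variable {I} in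
/-- The derivative `v f` of a function `f` in the direction of the tangent vector `v` at `x`. -/
noncomputable def dirDeriv {x : M} (v : TangentSpace I x) (f : M → ℝ) : ℝ :=
  mfderiv I 𝓘(ℝ, ℝ) f x v

variable {I F E} in
/-- The product of a smooth function and a smooth section. -/
noncomputable def mulSection (f : C^∞⟮I, M; ℝ⟯) (η : Cₛ^∞⟮I; F, E⟯) : Cₛ^∞⟮I; F, E⟯ :=
  ⟨fun x => f x • η x, f.contMDiff.smul_section η.contMDiff⟩

/-- A Lie algebroid structure on the smooth vector bundle `E → M`: an anchor `ρ : E → TM`, a smooth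
vector bundle map over the identity, and a Lie bracket on the space of smooth sections with
`[σ, f η] = (ρ(σ) f) η + f [σ, η]`. -/
structure LieAlgebroid where
  anchor : ∀ x, E x →ₗ[ℝ] TangentSpace I x
  contMDiff_anchor : ContMDiff (I.prod 𝓘(ℝ, F)) I.tangent ∞
    fun p : TotalSpace F E => (⟨p.proj, anchor p.proj p.snd⟩ : TangentBundle I M)
  bracket : Cₛ^∞⟮I; F, E⟯ →ₗ[ℝ] Cₛ^∞⟮I; F, E⟯ →ₗ[ℝ] Cₛ^∞⟮I; F, E⟯
  bracket_self : ∀ σ, bracket σ σ = 0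
  jacobi : ∀ σ η ζ, bracket σ (bracket η ζ) + bracket η (bracket ζ σ) + bracket ζ (bracket σ η) = 0
  leibniz : ∀ (f : C^∞⟮I, M; ℝ⟯) (σ η : Cₛ^∞⟮I; F, E⟯) (x : M),
    bracket σ (mulSection f η) x =
      dirDeriv (anchor x (σ x)) f • η x + f x • bracket σ η x

/-- A smooth section of `E*`, given as a smooth function on `E` that is linear on the fibres. -/
structure DualSection where
  toFun : ∀ x, E x →ₗ[ℝ] ℝ
  contMDiff_toFun : ContMDiff (I.prod 𝓘(ℝ, F)) 𝓘(ℝ, ℝ) ∞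
    fun p : TotalSpace F E => toFun p.proj p.snd

namespace LieAlgebroid

variable {I F E} (A : LieAlgebroid I F E)

/-- The exterior differential of a section `θ` of `E*`:
`dθ(η, ζ) = ρ(η)⟨θ, ζ⟩ - ρ(ζ)⟨θ, η⟩ - ⟨θ, [η, ζ]⟩`. -/
noncomputable def d (θ : DualSection I F E) (η ζ : Cₛ^∞⟮I; F, E⟯) (x : M) : ℝ :=
  dirDeriv (A.anchor x (η x)) (fun y => θ.toFun y (ζ y))
    - dirDeriv (A.anchor x (ζ x)) (fun y => θ.toFun y (η y))
    - θ.toFun x (A.bracket η ζ x)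

/-- `a` is an admissible curve on `J`: a smooth curve in `E` over `γ = τ ∘ a` with `γ' = ρ ∘ a`. -/
def IsAdmissibleOn (a : ℝ → TotalSpace F E) (J : Set ℝ) : Prop :=
  ContMDiffOn 𝓘(ℝ, ℝ) (I.prod 𝓘(ℝ, F)) ∞ a J ∧
    ∀ t ∈ J, mfderiv 𝓘(ℝ, ℝ) I (fun t => (a t).proj) t (1 : ℝ) = A.anchor (a t).proj (a t).snd

/-- `Φ = α dt + β ds : TW → E` is a morphism of Lie algebroids, for `W ⊆ ℝ²` open with coordinates
`(s, t)`: `α` and `β` are smooth over a common base map `φ : W → M`, and `Φ^* ∘ d = d ∘ Φ^*`. On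
functions this says `∂φ/∂t = ρ(α)` and `∂φ/∂s = ρ(β)`; on a section `θ` of `E*`, evaluating
`d(Φ^*θ) = Φ^*(dθ)` on `(∂/∂s, ∂/∂t)`, it says
`∂⟨θ, α⟩/∂s - ∂⟨θ, β⟩/∂t = dθ(β, α)`; in higher degrees both sides are forms of degree
at least 3 on `W` and vanish. -/
structure IsMorphismOn (α β : ℝ × ℝ → TotalSpace F E) (W : Set (ℝ × ℝ)) : Prop where
  contMDiffOn_left : ContMDiffOn 𝓘(ℝ, ℝ × ℝ) (I.prod 𝓘(ℝ, F)) ∞ α W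
  contMDiffOn_right : ContMDiffOn 𝓘(ℝ, ℝ × ℝ) (I.prod 𝓘(ℝ, F)) ∞ β W
  proj_eq : ∀ p ∈ W, (β p).proj = (α p).proj
  anchor_left : ∀ p ∈ W, mfderiv 𝓘(ℝ, ℝ × ℝ) I (fun q => (α q).proj) p ((0 : ℝ), (1 : ℝ)) =
    A.anchor (α p).proj (α p).snd
  anchor_right : ∀ p ∈ W, mfderiv 𝓘(ℝ, ℝ × ℝ) I (fun q => (β q).proj) p ((1 : ℝ), (0 : ℝ)) =
    A.anchor (β p).proj (β p).snd
  exterior : ∀ p ∈ W, ∀ (θ : DualSection I F E) (η ζ : Cₛ^∞⟮I; F, E⟯),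
    η (β p).proj = (β p).snd → ζ (α p).proj = (α p).snd →
    fderiv ℝ (fun q => θ.toFun (α q).proj (α q).snd) p ((1 : ℝ), (0 : ℝ))
      - fderiv ℝ (fun q => θ.toFun (β q).proj (β q).snd) p ((0 : ℝ), (1 : ℝ)) =
      A.d θ η ζ (α p).proj

section Jets

variable [I.Boundaryless] [ContMDiffVectorBundle ∞ F E I]

/-- The set `E^k ⊆ T^{k-1}E` of `(k-1)`-jets at `0` of admissible curves (`k ≥ 1`). -/
def admissibleJets (k : ℕ) : Set (JetBundle (I.prod 𝓘(ℝ, F)) (TotalSpace F E) (k - 1)) :=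
  {p | ∃ (J : Set ℝ) (a : ℝ → TotalSpace F E), IsOpen J ∧ (0 : ℝ) ∈ J ∧ A.IsAdmissibleOn a J ∧
    velocity (I.prod 𝓘(ℝ, F)) (k - 1) a = p}

/-- `w` is a value at `t` of the `k`-th order variational vector field `Ξ^k_a σ`: there is a
morphism `α dt + β ds`, defined near `(0, t)`, with `α(0, ·) = a` and `β(0, ·) = σ`, such that `w` is
the derivative at `s = 0` of the curve `s ↦ (α_s)^k(t) = [h ↦ α(s, t + h)]^{k-1}` in `E^k`. -/
def IsVariationalVector (k : ℕ) (a σ : ℝ → TotalSpace F E) (t : ℝ)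
    (w : TangentBundle ((I.prod 𝓘(ℝ, F)).prod 𝓘(ℝ, Fin (k - 1) → V × F))
      (JetBundle (I.prod 𝓘(ℝ, F)) (TotalSpace F E) (k - 1))) : Prop :=
  ∃ (W : Set (ℝ × ℝ)) (α β : ℝ × ℝ → TotalSpace F E), IsOpen W ∧ ((0 : ℝ), t) ∈ W ∧
    A.IsMorphismOn α β W ∧ (∀ t', ((0 : ℝ), t') ∈ W → α (0, t') = a t' ∧ β (0, t') = σ t') ∧
    tangentVec _ (fun s => prolong (I.prod 𝓘(ℝ, F)) (k - 1) (fun t' => α (s, t')) t) = w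

end Jets

section FirstOrder

variable [FiniteDimensional ℝ V] [T2Space M] [ContMDiffVectorBundle ∞ F E I]

theorem exists_constSection (x : M) (u : F) : ∃ η : Cₛ^∞⟮I; F, E⟯,
    ∀ᶠ y in 𝓝 x, (trivializationAt F E x ⟨y, η y⟩).2 = u := by
  set e := trivializationAt F E x with he
  have hx : e.baseSet ∈ 𝓝 x := e.open_baseSet.mem_nhds (mem_baseSet_trivializationAt F E x)
  obtain ⟨f, -, hf⟩ := (SmoothBumpFunction.nhds_basis_tsupport (I := I) x).mem_iff.1 hx
  have hs : ContMDiffOn I (I.prod 𝓘(ℝ, F)) ∞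
      (fun y => TotalSpace.mk' F y (e.symm y u)) e.baseSet := by
    intro y hy
    rw [e.contMDiffWithinAt_section _ hy]
    refine (contMDiffOn_const (c := u)).congr (fun z hz => ?_) y hy
    simp [e.apply_mk_symm hz]
  refine ⟨⟨fun y => f y • e.symm y u,
    f.contMDiff.contMDiffOn.smul_section_of_tsupport e.open_baseSet hf hs⟩, ?_⟩
  filter_upwards [f.eventuallyEq_one, hx] with y hy hy'
  have hy1 : f y = 1 := hy
  change (e ⟨y, f y • e.symm y u⟩).2 = u
  rw [hy1, one_smul, e.apply_mk_symm hy']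

/-- A smooth section of `E` that is constant, equal to `u`, near `x` in the preferred local
trivialization of `E` at `x`. -/
noncomputable def constSection (x : M) (u : F) : Cₛ^∞⟮I; F, E⟯ :=
  Classical.choose (exists_constSection (I := I) (E := E) x u)

/-- The structure functions of the bracket at `x`, in the preferred local trivialization of `E` at
`x`: if `(e_α)` is the associated local frame and `[e_β, e_μ] = C^α_{βμ} e_α`, this is the bilinear
map `(u, v) ↦ C^α_{βμ}(x) u^β v^μ`. -/
noncomputable def structureMap (x : M) (u v : F) : F :=
  (trivializationAt F E x ⟨x, A.bracket (constSection x u) (constSection x v) x⟩).2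

/-- The first-order variational vector field
`Ξ_a σ = ρ^i_α σ^α ∂/∂x^i + (dσ^α/dt + C^α_{βμ} a^β σ^μ) ∂/∂y^α` along `a`. At each `t` it is written
in the coordinates of `E` given by the preferred chart of `M` and the preferred local trivialization
of `E` at `τ(a(t))`; in these coordinates Mathlib identifies `T_{a(t)}E` with `V × F`. -/
noncomputable def firstVariation (a σ : ℝ → TotalSpace F E) (t : ℝ) :
    TangentBundle (I.prod 𝓘(ℝ, F)) (TotalSpace F E) :=
  let e := trivializationAt F E (a t).proj
  ⟨a t, ((A.anchor (σ t).proj (σ t).snd : V),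
    deriv (fun t' => (e (σ t')).2) t + A.structureMap (a t).proj (e (a t)).2 (e (σ t)).2)⟩

end FirstOrder

end LieAlgebroid

end Algebroid

/-! For every morphism `α dt + β ds` through `a` and `σ`, the morphism equations determine `∂α/∂s`
at `s = 0`. Its base component is `ρ(β) = ρ(σ)`. Its fibre component, obtained by testing the
exterior equation on sections that are constant in a local trivialization, is `σ' + C(a, σ)`. So
`∂α/∂s = Ξ_a σ` at `s = 0`, whichever morphism is used (`tangentVec_eq_firstVariation`). Higher
orders need nothing more from the algebroid: the flip exchanges `d/ds` with taking jets in `t`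
(`canonicalFlip_prolong`), so every morphism gives the vector `χ((Ξ_a σ)^{(k-1)}(t))`. Each `α_s` is
admissible, so the curve `s ↦ (α_s)^k(t)` lies in `E^k` and its velocity is tangent to `E^k`.

The larger task is to show that a morphism exists (`exists_isMorphismOn`). In coordinates, with
anchor `R` and structure functions `C`, take `β = σ(t)` independent of `s` and solve, for each fixed
`t`, the equations `∂φ/∂s = R(φ)σ` and `∂α/∂s = σ' + C(φ)(α, σ)` from the initial value `(γ, a)`.
What remains is `∂φ/∂t = R(φ)α`. The defect `∂φ/∂t - R(φ)α` solves a homogeneous linear equation in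
`s` because the anchor preserves brackets, and it vanishes at `s = 0` because `a` is admissible;
hence it vanishes (`exists_coordinate_morphism`). Preservation of brackets is not an axiom of
`LieAlgebroid`: it is derived from the Jacobi and Leibniz identities (`dirDeriv_anchor_bracket`).

Joint smoothness of the solution in `(s, t)` comes from a smooth local flow, built by the implicit
function theorem in a Banach space of continuous curves (`exists_smooth_flow`). Since the exterior
equation of a morphism allows arbitrary extensions of the values of `α` and `β` to sections, it also
has to be known that `d θ` is tensorial (`d_congr`). -/

/-! ### Smoothness of composition operators on spaces of continuous functions. -/

section Nemytskii

set_option synthInstance.maxHeartbeats 200000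

universe u

variable {K : Type*} [TopologicalSpace K] [CompactSpace K]

/-- A continuous family of continuous linear maps acts on continuous functions. -/
noncomputable def ContinuousMap.pointwiseCLM {X Y : Type*} [NormedAddCommGroup X]
    [NormedSpace ℝ X] [NormedAddCommGroup Y] [NormedSpace ℝ Y] :
    C(K, X →L[ℝ] Y) →L[ℝ] C(K, X) →L[ℝ] C(K, Y) :=
  LinearMap.mkContinuous₂
    (LinearMap.mk₂ ℝ (fun (A : C(K, X →L[ℝ] Y)) (v : C(K, X)) => (⟨fun u => A u (v u), by fun_prop⟩ : C(K, Y)))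
      (fun _ _ _ => by ext; simp) (fun _ _ _ => by ext; simp)
      (fun _ _ _ => by ext; simp) (fun _ _ _ => by ext; simp)) 1
    (fun A v => by
      rw [ContinuousMap.norm_le _ (by positivity)]
      intro u
      simpa using (A u).le_of_opNorm_le_of_le (A.norm_coe_le_norm u) (v.norm_coe_le_norm u))

@[simp] theorem ContinuousMap.pointwiseCLM_apply {X Y : Type*} [NormedAddCommGroup X]
    [NormedSpace ℝ X] [NormedAddCommGroup Y] [NormedSpace ℝ Y] (A : C(K, X →L[ℝ] Y))
    (v : C(K, X)) (u : K) : ContinuousMap.pointwiseCLM A v u = A u (v u) := rfl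

/-- The mean value inequality on each segment from `c u` to `c u + h u` bounds the remainder at `u`.
The bound is uniform in `u` because `c ↦ g' ∘ c` is continuous for the sup norm, `K` being compact.
-/
theorem ContinuousMap.hasFDerivAt_postcomp {X Y : Type*} [NormedAddCommGroup X]
    [NormedSpace ℝ X] [NormedAddCommGroup Y] [NormedSpace ℝ Y] (g : C(X, Y))
    (g' : C(X, X →L[ℝ] Y)) (hg : ∀ x, HasFDerivAt g (g' x) x) (c : C(K, X)) :
    HasFDerivAt (fun c : C(K, X) => g.comp c) (ContinuousMap.pointwiseCLM (g'.comp c)) c := by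
  rw [hasFDerivAt_iff_isLittleO_nhds_zero, Asymptotics.isLittleO_iff]
  intro ε hε
  have hcont : ContinuousAt (fun h : C(K, X) => g'.comp (c + h)) 0 :=
    ((ContinuousMap.continuous_postcomp g').comp (continuous_const.add continuous_id)).continuousAt
  obtain ⟨δ, hδ, hball⟩ := (Metric.continuousAt_iff (f := fun h : C(K, X) => g'.comp (c + h)) (a := 0)).1 hcont ε hε
  filter_upwards [Metric.ball_mem_nhds (0 : C(K, X)) hδ] with h hh
  rw [ContinuousMap.norm_le _ (by positivity)]
  intro u
  have key := (convex_segment (c u) (c u + h u)).norm_image_sub_le_of_norm_hasFDerivWithin_le'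
    (f := g) (f' := g') (φ := g' (c u)) (C := ε) (x := c u) (y := c u + h u)
    (fun x _ => (hg x).hasFDerivWithinAt) ?_ (left_mem_segment _ _ _) (right_mem_segment _ _ _)
  · simp only [add_sub_cancel_left] at key
    simpa using key.trans (mul_le_mul_of_nonneg_left (h.norm_coe_le_norm u) hε.le)
  · intro y hy
    rw [segment_eq_image'] at hy
    obtain ⟨τ, hτ, rfl⟩ := hy
    -- The point of the segment is the value at `u` of the curve `c + τ • h`, which is as close to
    -- `c` as `c + h` is.
    have hτh : dist (τ • h) 0 < δ := by
      rw [dist_zero_right, norm_smul, Real.norm_of_nonneg hτ.1]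
      have h1 := mem_ball_zero_iff.1 hh
      have h2 := norm_nonneg h
      nlinarith [hτ.2]
    have h3 := hball hτh
    have h4 := (ContinuousMap.dist_apply_le_dist (f := g'.comp (c + τ • h)) (g := g'.comp (c + 0))
      u).trans h3.le
    rw [dist_eq_norm] at h4
    simpa using h4

/-- Induction on `n`: the derivative is a continuous linear map applied to composition with `g'`,
which is an operator of the same kind. The target changes from `Y` to `X →L[ℝ] Y`, so the induction
runs over all targets, in a universe closed under this passage. -/
theorem ContinuousMap.contDiff_postcomp_nat {X : Type u} [NormedAddCommGroup X] [NormedSpace ℝ X]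
    (n : ℕ) : ∀ {Y : Type u} [NormedAddCommGroup Y] [NormedSpace ℝ Y] (g : C(X, Y)),
    ContDiff ℝ ∞ g → ContDiff ℝ n (fun c : C(K, X) => g.comp c) := by
  induction n with
  | zero =>
    intro Y _ _ g _
    exact contDiff_zero.2 (ContinuousMap.continuous_postcomp g)
  | succ n ih =>
    intro Y _ _ g hg
    have hg' : ContDiff ℝ ∞ (fderiv ℝ g) := hg.fderiv_right (by simp)
    let g' : C(X, X →L[ℝ] Y) := ⟨fderiv ℝ g, hg'.continuous⟩
    refine contDiff_succ_iff_hasFDerivAt.2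
      ⟨fun c => ContinuousMap.pointwiseCLM (g'.comp c), ?_, fun c => ?_⟩
    · exact ContinuousMap.pointwiseCLM.contDiff.comp (ih g' hg')
    · exact ContinuousMap.hasFDerivAt_postcomp g g'
        (fun x => (hg.differentiable (by simp) x).hasFDerivAt) c

theorem ContinuousMap.contDiff_postcomp {X : Type*} [NormedAddCommGroup X] [NormedSpace ℝ X]
    (g : C(X, X)) (hg : ContDiff ℝ ∞ g) : ContDiff ℝ ∞ (fun c : C(K, X) => g.comp c) :=
  contDiff_infty.2 fun n => ContinuousMap.contDiff_postcomp_nat n g hg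

end Nemytskii

/-! ### Smooth local flows from the implicit function theorem. -/

/-- The implicit function of a smooth equation is smooth on a neighbourhood. -/
theorem exists_smooth_implicitFunction {E₁ E₂ G : Type*} [NormedAddCommGroup E₁] [NormedSpace ℝ E₁]
    [CompleteSpace E₁] [NormedAddCommGroup E₂] [NormedSpace ℝ E₂] [CompleteSpace E₂]
    [NormedAddCommGroup G] [NormedSpace ℝ G] [CompleteSpace G] {f : E₁ × E₂ → G} {u : E₁ × E₂}
    (hf : ContDiff ℝ ∞ f) (hu : (fderiv ℝ f u ∘L .inr ℝ E₁ E₂).IsInvertible) :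
    ∃ ψ : E₁ → E₂, ψ u.1 = u.2 ∧
      (∀ᶠ x in 𝓝 u.1, ContDiffAt ℝ ∞ ψ x ∧ f (x, ψ x) = f u) ∧
      ∀ᶠ v in 𝓝 u, f v = f u → ψ v.1 = v.2 := by
  have hne : (∞ : ℕ∞ω) ≠ 0 := by simp
  set ψ := hf.contDiffAt.implicitFunction hne hu with hψ
  have h0 : ψ u.1 = u.2 := hf.contDiffAt.implicitFunction_apply_self hne hu
  have hc : ContinuousAt ψ u.1 :=
    (hf.contDiffAt.contDiffAt_implicitFunction hne hu).continuousAt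
  have hpair : Tendsto (fun x => (x, ψ x)) (𝓝 u.1) (𝓝 u) := by
    have : ContinuousAt (fun x => (x, ψ x)) u.1 := continuousAt_id.prodMk hc
    simpa [ContinuousAt, h0] using this
  have heq := hf.contDiffAt.eventually_apply_implicitFunction hne hu
  have huniq := hf.contDiffAt.eventually_apply_eq_iff_implicitFunction hne hu
  have hinv : ∀ᶠ v in 𝓝 u, (fderiv ℝ f v ∘L .inr ℝ E₁ E₂).IsInvertible := by
    obtain ⟨e, he⟩ := hu
    have hcont : Continuous fun v => fderiv ℝ f v ∘L .inr ℝ E₁ E₂ :=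
      (hf.continuous_fderiv (by simp)).clm_comp continuous_const
    exact (hcont.tendsto u).eventually (he ▸ e.nhds)
  -- continuity of `ψ` near the base point
  have hcn : ∀ᶠ x in 𝓝 u.1, ContinuousAt ψ x :=
    ((hf.contDiffAt.contDiffAt_implicitFunction hne hu).of_le (m := 1) (by simp)).eventually
      (by simp) |>.mono fun x hx => hx.continuousAt
  refine ⟨ψ, h0, ?_, huniq.mono fun v hv => hv.1⟩
  filter_upwards [hcn, heq, hpair.eventually hinv, hpair.eventually huniq.eventually_nhds,
    heq.eventually_nhds] with x hx hfx hix hux hfx'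
  refine ⟨?_, hfx⟩
  -- Being `C^∞` at one point does not by itself give a single neighbourhood on which the function
  -- is `C^∞`. The theorem is therefore applied again at each nearby point `(x, ψ x)`, and local
  -- uniqueness identifies the new implicit function with `ψ`.
  have h1 := hf.contDiffAt.contDiffAt_implicitFunction (u := (x, ψ x)) hne hix
  refine h1.congr_of_eventuallyEq ?_
  have h2 := hf.contDiffAt.eventually_apply_eq_iff_implicitFunction (u := (x, ψ x)) hne hix
  have hp : Tendsto (fun y => (y, ψ y)) (𝓝 x) (𝓝 (x, ψ x)) := continuousAt_id.prodMk hx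
  filter_upwards [hp.eventually h2, hfx'] with y hy hy'
  exact (hy.1 (hy'.trans hfx.symm)).symm

section Flow

theorem neg_one_le_one : (-1 : ℝ) ≤ 1 := by norm_num

variable {X : Type*} [NormedAddCommGroup X] [NormedSpace ℝ X] [CompleteSpace X]

/-- The primitive `u ↦ ∫ r in 0..u, f r` of a continuous function on `[-1, 1]`. -/
noncomputable def primitiveCLM : C(Icc (-1 : ℝ) 1, X) →L[ℝ] C(Icc (-1 : ℝ) 1, X) :=
  LinearMap.mkContinuous
    { toFun := fun f => ⟨fun u => ∫ r in (0 : ℝ)..u, f (projIcc (-1) 1 neg_one_le_one r),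
        (intervalIntegral.continuous_primitive (fun a b =>
          (f.continuous.comp continuous_projIcc).intervalIntegrable a b) 0).comp
          continuous_subtype_val⟩
      map_add' := fun f g => by
        ext u
        exact intervalIntegral.integral_add
          ((f.continuous.comp continuous_projIcc).intervalIntegrable _ _)
          ((g.continuous.comp continuous_projIcc).intervalIntegrable _ _)
      map_smul' := fun c f => by
        ext u
        exact intervalIntegral.integral_smul c _ } 1
    (fun f => by
      rw [ContinuousMap.norm_le _ (by positivity)]
      intro u
      have h := intervalIntegral.norm_integral_le_of_norm_le_const (a := 0) (b := u.1) (C := ‖f‖)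
        (f := fun r => f (projIcc (-1) 1 neg_one_le_one r)) (fun r _ => f.norm_coe_le_norm _)
      refine h.trans ?_
      rw [one_mul, sub_zero]
      exact mul_le_of_le_one_right (norm_nonneg _) (abs_le.2 u.2))

/-- A smooth vector field has a smooth local flow. -/
theorem exists_smooth_flow {g : X → X} (hg : ContDiff ℝ ∞ g) (x₀ : X) :
    ∃ (δ : ℝ) (Z : ℝ × X → X), 0 < δ ∧ ∀ p ∈ Metric.ball ((0 : ℝ), x₀) δ,
      ContDiffAt ℝ ∞ Z p ∧ Z (0, p.2) = p.2 ∧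
      HasDerivAt (fun s => Z (s, p.2)) (g (Z p)) p.1 := by
  let gc : C(X, X) := ⟨g, hg.continuous⟩
  let I1 := Icc (-1 : ℝ) 1
  let κ : X →L[ℝ] C(I1, X) := ContinuousLinearMap.const ℝ I1
  -- Time is rescaled: a zero `c` of `f ((s, x), ·)` is the curve `u ↦ Z(s u, x)` on `[-1, 1]`, so
  -- that `s` becomes a parameter of an integral equation on a fixed interval.
  let f : (ℝ × X) × C(I1, X) → C(I1, X) :=
    fun q => q.2 - κ q.1.2 - q.1.1 • primitiveCLM (gc.comp q.2)
  have hN : ContDiff ℝ ∞ (fun c : C(I1, X) => gc.comp c) := ContinuousMap.contDiff_postcomp gc hg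
  have hf : ContDiff ℝ ∞ f := by
    have h1 : ContDiff ℝ ∞ fun q : (ℝ × X) × C(I1, X) => primitiveCLM (gc.comp q.2) :=
      primitiveCLM.contDiff.comp (hN.comp contDiff_snd)
    have h2 : ContDiff ℝ ∞ fun q : (ℝ × X) × C(I1, X) => κ q.1.2 :=
      κ.contDiff.comp (contDiff_snd.comp contDiff_fst)
    exact (contDiff_snd.sub h2).sub ((contDiff_fst.comp contDiff_fst).smul h1)
  set p₀ : ℝ × X := (0, x₀) with hp₀
  set u : (ℝ × X) × C(I1, X) := (p₀, κ x₀) with hu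
  have hfu : f u = 0 := by simp [f, hu, hp₀]
  have hinv : (fderiv ℝ f u ∘L .inr ℝ (ℝ × X) C(I1, X)).IsInvertible := by
    refine ⟨ContinuousLinearEquiv.refl ℝ _, ?_⟩
    have h1 : HasFDerivAt (fun c => f (p₀, c)) (fderiv ℝ f u ∘L .inr ℝ (ℝ × X) C(I1, X)) (κ x₀) :=
      HasFDerivAt.comp (κ x₀) (hf.differentiable (by simp) u).hasFDerivAt
        (hasFDerivAt_prodMk_right p₀ (κ x₀))
    -- At `s = 0` the integral term disappears and the equation is `c = κ x₀`, so its derivative in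
    -- `c` is the identity.
    have h2 : HasFDerivAt (fun c => f (p₀, c)) (ContinuousLinearMap.id ℝ C(I1, X)) (κ x₀) := by
      have : (fun c => f (p₀, c)) = fun c => c - κ x₀ := by
        ext c
        simp [f, hp₀]
      rw [this]
      exact (hasFDerivAt_id _).sub_const _
    exact h2.unique h1
  obtain ⟨ψ, hψ0, hψ, hψu⟩ := exists_smooth_implicitFunction hf hinv
  rw [hfu] at hψ hψu
  obtain ⟨r, hr, hru⟩ := Metric.eventually_nhds_iff_ball.1 hψu
  have hψc : ∀ᶠ p in 𝓝 p₀, ψ p ∈ Metric.ball (κ x₀) r :=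
    hψ.self_of_nhds.1.continuousAt.eventually (by
      rw [hψ0]; exact Metric.ball_mem_nhds _ hr)
  obtain ⟨δ, hδ, hδb⟩ := Metric.eventually_nhds_iff_ball.1 (hψ.and hψc)
  -- Radius `δ` keeps the solution smooth and within `r` of the constant curve; radius `r` is where
  -- local uniqueness holds.
  set δ' := min δ r with hδ'
  have hball : ∀ s x, |s| < δ' → dist x x₀ < δ' → (s, x) ∈ Metric.ball p₀ δ ∧
      (s, x) ∈ Metric.ball p₀ r := by
    intro s x hs hx
    simp only [Metric.mem_ball, Prod.dist_eq, hp₀, Real.dist_eq, sub_zero]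
    exact ⟨max_lt (hs.trans_le (min_le_left _ _)) (hx.trans_le (min_le_left _ _)),
      max_lt (hs.trans_le (min_le_right _ _)) (hx.trans_le (min_le_right _ _))⟩
  have hone : (1 : ℝ) ∈ I1 := by constructor <;> norm_num
  let ev : C(I1, X) →L[ℝ] X := ContinuousMap.evalCLM ℝ ⟨1, hone⟩
  have hform : ∀ s x, |s| < δ' → dist x x₀ < δ' → ∀ v : I1,
      ψ (s, x) v = x + s • ∫ r in (0 : ℝ)..v, g (ψ (s, x) (projIcc (-1) 1 neg_one_le_one r)) := by
    intro s x hs hx v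
    have h := (hδb _ (hball s x hs hx).1).1.2
    have h' := congrArg (fun c : C(I1, X) => c v) h
    simp only [f, ContinuousMap.sub_apply, ContinuousMap.smul_apply,
      ContinuousMap.zero_apply] at h'
    rw [sub_sub, sub_eq_zero] at h'
    exact h'
  -- rescaling of time
  have hscale : ∀ s x, |s| < δ' → dist x x₀ < δ' → ∀ v : I1, ev (ψ (s * v, x)) = ψ (s, x) v := by
    intro s x hs hx v
    have hv : |(v : ℝ)| ≤ 1 := abs_le.2 v.2
    have hmem : ∀ w : I1, (v : ℝ) * w ∈ I1 := fun w => abs_le.1 (by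
      rw [abs_mul]; exact mul_le_one₀ hv (abs_nonneg _) (abs_le.2 w.2))
    -- This curve solves the equation with time parameter `s * v`. It stays in the uniqueness ball,
    -- since its distance from the constant curve is a supremum over fewer points. Hence it equals
    -- `ψ (s * v, x)`.
    let c : C(I1, X) := ⟨fun w => ψ (s, x) ⟨v * w, hmem w⟩, by fun_prop⟩
    have hsv : |s * v| < δ' := by
      rw [abs_mul]; exact (mul_le_of_le_one_right (abs_nonneg _) hv).trans_lt hs
    have hcb : c ∈ Metric.ball (κ x₀) r := by
      have h1 := (hδb _ (hball s x hs hx).1).2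
      rw [Metric.mem_ball, dist_eq_norm] at h1 ⊢
      refine lt_of_le_of_lt ?_ h1
      rw [ContinuousMap.norm_le _ (norm_nonneg _)]
      intro w
      exact ContinuousMap.norm_coe_le_norm (ψ (s, x) - κ x₀) ⟨v * w, hmem w⟩
    have hfc : f ((s * v, x), c) = 0 := by
      ext w
      have h1 := hform s x hs hx ⟨v * w, hmem w⟩
      simp only [f, ContinuousMap.sub_apply, ContinuousMap.smul_apply,
        ContinuousMap.zero_apply]
      rw [sub_sub, sub_eq_zero]
      refine h1.trans ?_
      have h2 : (v : ℝ) • ∫ r in (0 : ℝ)..w,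
          g (ψ (s, x) (projIcc (-1) 1 neg_one_le_one ((v : ℝ) * r))) =
          ∫ r in (0 : ℝ)..(v * w : ℝ), g (ψ (s, x) (projIcc (-1) 1 neg_one_le_one r)) := by
        have := intervalIntegral.smul_integral_comp_mul_left (a := 0) (b := (w : ℝ))
          (fun r => g (ψ (s, x) (projIcc (-1) 1 neg_one_le_one r))) (v : ℝ)
        simpa using this
      change x + s • (∫ r in (0 : ℝ)..(v * w : ℝ), _) = x + _
      rw [← h2, mul_smul]
      congr 3
      refine intervalIntegral.integral_congr (μ := MeasureTheory.volume) (a := 0) (b := (w : ℝ)) fun r hr => ?_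
      have hr1 : r ∈ I1 := (convex_Icc (-1 : ℝ) 1).ordConnected.uIcc_subset
        (by constructor <;> norm_num) w.2 hr
      change g (ψ (s, x) _) = g (ψ (s, x) ⟨v * (projIcc (-1) 1 _ r : ℝ), _⟩)
      congr 2
      rw [projIcc_of_mem _ (hmem ⟨r, hr1⟩)]
      simp [projIcc_of_mem _ hr1]
    have hres := hru ((s * v, x), c) (by
      have h1 := (hball _ x hsv hx).2
      rw [Metric.mem_ball, Prod.dist_eq] at *
      exact max_lt h1 hcb) hfc
    rw [hres]
    change ψ (s, x) ⟨v * 1, _⟩ = _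
    congr 2
    simp
  refine ⟨δ', fun p => ev (ψ p), lt_min hδ hr, ?_⟩
  rintro ⟨s, x⟩ hp
  obtain ⟨hs, hx⟩ : |s| < δ' ∧ dist x x₀ < δ' := by
    simp only [Metric.mem_ball, Prod.dist_eq, hp₀, Real.dist_eq, sub_zero, max_lt_iff] at hp
    exact hp
  refine ⟨ev.contDiff.contDiffAt.comp _ (hδb _ (hball s x hs hx).1).1.1, ?_, ?_⟩
  · have h1 := hform 0 x (by rw [abs_zero]; exact lt_min hδ hr) hx ⟨1, hone⟩
    rw [zero_smul, add_zero] at h1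
    exact h1
  -- With `s₁` fixed strictly between `|s|` and `δ'`, the rescaling identity gives `Z(s', x) = ψ
  -- (s₁, x) (s' / s₁)` for `s'` near `s`. The time derivative is then that of a primitive, at a
  -- point inside `[-1, 1]`.
  · obtain ⟨s₁, hs₁, hs₁'⟩ := exists_between hs
    have hs0 : 0 < s₁ := (abs_nonneg s).trans_lt hs₁
    have habs : |s₁| < δ' := by rwa [abs_of_pos hs0]
    have hmem : ∀ s', |s'| < s₁ → s' / s₁ ∈ I1 := by
      intro s' hs'
      apply abs_le.1
      rw [abs_div, abs_of_pos hs0]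
      exact (div_le_one hs0).2 hs'.le
    have hval : ∀ s', |s'| < s₁ → ∀ hm : s' / s₁ ∈ I1, ev (ψ (s', x)) = ψ (s₁, x) ⟨s' / s₁, hm⟩ := by
      intro s' _ hm
      have := hscale s₁ x habs hx ⟨s' / s₁, hm⟩
      rwa [mul_div_cancel₀ _ hs0.ne'] at this
    set h : ℝ → X := fun r => g (ψ (s₁, x) (projIcc (-1) 1 neg_one_le_one r)) with hh
    have hcont : Continuous h :=
      hg.continuous.comp ((ψ (s₁, x)).continuous.comp continuous_projIcc)
    have hd1 : HasDerivAt (fun v => ∫ r in (0 : ℝ)..v, h r) (h (s / s₁)) (s / s₁) :=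
      intervalIntegral.integral_hasDerivAt_right (hcont.intervalIntegrable _ _)
        (hcont.stronglyMeasurableAtFilter _ _) hcont.continuousAt
    have hd2 : HasDerivAt (fun s' : ℝ => s' / s₁) (1 / s₁) s := (hasDerivAt_id s).div_const s₁
    have hd3 := ((HasDerivAt.scomp s hd1 hd2).const_smul s₁).const_add x
    have he : (fun s' => ev (ψ (s', x))) =ᶠ[𝓝 s]
        fun s' => x + s₁ • ∫ r in (0 : ℝ)..(s' / s₁), h r := by
      filter_upwards [(isOpen_lt continuous_abs continuous_const).mem_nhds hs₁] with s' hs'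
      rw [hval s' hs' (hmem s' hs')]
      exact hform s₁ x habs hx _
    have hv : s₁ • (1 / s₁) • h (s / s₁) = g (ev (ψ (s, x))) := by
      rw [hval s hs₁ (hmem s hs₁), smul_smul, mul_one_div_cancel hs0.ne', one_smul, hh]
      simp only [projIcc_of_mem _ (hmem s hs₁)]
    exact (hv ▸ hd3).congr_of_eventuallyEq he

end Flow

/-! ### Cut-offs, uniqueness for linear estimates, and differential equations with a parameter. -/

section LocalFlow

/-- A smooth map on an open set agrees near a point of it with a globally smooth map. -/
theorem exists_contDiff_eventuallyEq {X Y : Type*} [NormedAddCommGroup X] [NormedSpace ℝ X]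
    [FiniteDimensional ℝ X] [NormedAddCommGroup Y] [NormedSpace ℝ Y] {g : X → Y} {O : Set X}
    (hO : IsOpen O) (hg : ContDiffOn ℝ ∞ g O) {x : X} (hx : x ∈ O) :
    ∃ G : X → Y, ContDiff ℝ ∞ G ∧ G =ᶠ[𝓝 x] g := by
  obtain ⟨r, hr, hrO⟩ := Metric.nhds_basis_closedBall.mem_iff.1 (hO.mem_nhds hx)
  let χ : ContDiffBump x := ⟨r / 2, r, by positivity, by linarith⟩
  refine ⟨fun y => χ y • g y, ?_, ?_⟩
  · rw [contDiff_iff_contDiffAt]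
    intro y
    by_cases hy : y ∈ tsupport χ
    · have hyO : y ∈ O := hrO (by rwa [χ.tsupport_eq] at hy)
      exact χ.contDiffAt.smul (hg.contDiffAt (hO.mem_nhds hyO))
    · refine (contDiffAt_const (c := (0 : Y))).congr_of_eventuallyEq ?_
      filter_upwards [(isClosed_tsupport χ).isOpen_compl.mem_nhds hy] with z hz
      rw [image_eq_zero_of_notMem_tsupport hz, zero_smul]
  · filter_upwards [χ.eventuallyEq_one] with y hy
    rw [hy]
    simp

/-- A function on an interval around `0` that vanishes at `0` and satisfies `‖f'‖ ≤ K ‖f‖`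
vanishes. -/
theorem eq_zero_of_norm_deriv_le {Y : Type*} [NormedAddCommGroup Y] [NormedSpace ℝ Y]
    {f f' : ℝ → Y} {K ε : ℝ} (hf : ∀ s, |s| < ε → HasDerivAt f (f' s) s) (h0 : f 0 = 0)
    (hK : ∀ s, |s| < ε → ‖f' s‖ ≤ K * ‖f s‖) {s : ℝ} (hs : |s| < ε) : f s = 0 := by
  have key : ∀ {g g' : ℝ → Y}, (∀ s, |s| < ε → HasDerivAt g (g' s) s) → g 0 = 0 →
      (∀ s, |s| < ε → ‖g' s‖ ≤ K * ‖g s‖) → ∀ s, 0 ≤ s → |s| < ε → g s = 0 := by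
    intro g g' hg hg0 hgK s hs0 hs
    have hlt : ∀ x ∈ Icc 0 s, |x| < ε := fun x hx => by
      rw [abs_of_nonneg hx.1]
      exact hx.2.trans_lt (by rwa [abs_of_nonneg hs0] at hs)
    exact eq_zero_of_abs_deriv_le_mul_abs_self_of_eq_zero_right
      (fun x hx => (hg x (hlt x hx)).continuousAt.continuousWithinAt)
      (fun x hx => (hg x (hlt x (Ico_subset_Icc_self hx))).hasDerivWithinAt) hg0
      (fun x hx => hgK x (hlt x (Ico_subset_Icc_self hx))) s ⟨hs0, le_rfl⟩
  rcases le_total 0 s with h | h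
  · exact key hf h0 hK s h hs
  -- Negative times reduce to positive ones by reflection.
  · have := key (g := fun s => f (-s)) (g' := fun s => -f' (-s))
      (fun x hx => by
        have h1 := HasDerivAt.scomp x (hf (-x) (by rwa [abs_neg])) (hasDerivAt_neg x)
        simpa using! h1) (by simpa using h0)
      (fun x hx => by simpa using hK (-x) (by rwa [abs_neg])) (-s) (by linarith)
      (by rwa [abs_neg])
    simpa using this

/-- The solutions of the family of differential equations `∂z/∂s = g(t, z)`, with initial values
depending smoothly on `t`, are smooth in `(s, t)`. -/
theorem exists_smooth_solution {X : Type*} [NormedAddCommGroup X] [NormedSpace ℝ X]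
    [FiniteDimensional ℝ X] {g : ℝ × X → X} {O : Set (ℝ × X)} (hO : IsOpen O)
    (hg : ContDiffOn ℝ ∞ g O) {J : Set ℝ} (hJ : IsOpen J) {z : ℝ → X} (hz : ContDiffOn ℝ ∞ z J)
    {t₀ : ℝ} (ht₀ : t₀ ∈ J) (hzO : (t₀, z t₀) ∈ O) :
    ∃ (ε : ℝ) (Z : ℝ × ℝ → X), 0 < ε ∧ ∀ s t, |s| < ε → |t - t₀| < ε →
      t ∈ J ∧ ContDiffAt ℝ ∞ Z (s, t) ∧ Z (0, t) = z t ∧ (t, Z (s, t)) ∈ O ∧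
      HasDerivAt (fun s => Z (s, t)) (g (t, Z (s, t))) s := by
  obtain ⟨G, hG, hGg⟩ := exists_contDiff_eventuallyEq hO hg hzO
  -- Here `t` is a frozen parameter and `s` is the flow time. Adjoining `t` as a coordinate with
  -- zero velocity turns the family into one autonomous field. The cut-off `G` makes the field
  -- global without changing it near the initial point.
  obtain ⟨δ, Φ, hδ, hΦ⟩ := exists_smooth_flow
    (g := fun q : ℝ × X => ((0 : ℝ), G q)) (contDiff_const.prodMk hG) (t₀, z t₀)
  let ι : ℝ × ℝ → ℝ × (ℝ × X) := fun p => (p.1, (p.2, z p.2))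
  have hz' : ∀ t ∈ J, ContDiffAt ℝ ∞ z t := fun t ht => hz.contDiffAt (hJ.mem_nhds ht)
  have hι : ∀ p : ℝ × ℝ, p.2 ∈ J → ContDiffAt ℝ ∞ ι p := fun p hp =>
    contDiffAt_fst.prodMk (contDiffAt_snd.prodMk ((hz' _ hp).comp p contDiffAt_snd))
  have hιc : ContinuousAt ι (0, t₀) := (hι (0, t₀) ht₀).continuousAt
  have hb0 : ι (0, t₀) ∈ Metric.ball ((0 : ℝ), (t₀, z t₀)) δ := Metric.mem_ball_self hδ
  have hev1 : ∀ᶠ p in 𝓝 ((0 : ℝ), t₀), ι p ∈ Metric.ball ((0 : ℝ), (t₀, z t₀)) δ :=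
    hιc.eventually (Metric.isOpen_ball.mem_nhds hb0)
  have hev2 : ∀ᶠ p in 𝓝 ((0 : ℝ), t₀), p.2 ∈ J :=
    continuousAt_snd.eventually (hJ.mem_nhds ht₀)
  have hval0 : Φ (ι (0, t₀)) = (t₀, z t₀) := (hΦ _ hb0).2.1
  have hev3 : ∀ᶠ p in 𝓝 ((0 : ℝ), t₀), G (Φ (ι p)) = g (Φ (ι p)) ∧ Φ (ι p) ∈ O := by
    have hc : ContinuousAt (fun p => Φ (ι p)) (0, t₀) :=
      ContinuousAt.comp (hΦ _ hb0).1.continuousAt hιc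
    have hq : ∀ᶠ q in 𝓝 (Φ (ι (0, t₀))), G q = g q ∧ q ∈ O := by
      rw [hval0]
      exact hGg.and (hO.mem_nhds hzO)
    exact hc.eventually hq
  obtain ⟨ε, hε, hall⟩ := Metric.eventually_nhds_iff_ball.1 (hev1.and (hev2.and hev3))
  have hmem : ∀ s t : ℝ, |s| < ε → |t - t₀| < ε → (s, t) ∈ Metric.ball ((0 : ℝ), t₀) ε := by
    intro s t hs ht
    simp only [Metric.mem_ball, Prod.dist_eq, Real.dist_eq, sub_zero]
    exact max_lt hs ht
  refine ⟨ε, fun p => (Φ (ι p)).2, hε, fun s t hs ht => ?_⟩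
  obtain ⟨h1, h2, h3, h4⟩ := hall _ (hmem s t hs ht)
  have hd : ∀ s, |s| < ε → HasDerivAt (fun s => Φ (ι (s, t))) ((0 : ℝ), G (Φ (ι (s, t)))) s :=
    fun s hs => (hΦ _ (hall _ (hmem s t hs ht)).1).2.2
  have hfirst : ∀ s, |s| < ε → (Φ (ι (s, t))).1 = t := by
    intro s hs
    have h0 : Φ (ι (0, t)) = (t, z t) :=
      (hΦ _ (hall _ (hmem 0 t (by simpa using hε) ht)).1).2.1
    have := eq_zero_of_norm_deriv_le (f := fun s => (Φ (ι (s, t))).1 - t) (f' := fun _ => 0)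
      (K := 0) (ε := ε) (fun s hs => ?_) (by simp [h0]) (by simp) hs
    · exact sub_eq_zero.1 this
    · exact ((hasFDerivAt_fst (𝕜 := ℝ) (E := ℝ) (F := X)).comp_hasDerivAt s (hd s hs)).sub_const t
  have hpair : (t, (Φ (ι (s, t))).2) = Φ (ι (s, t)) := Prod.ext (hfirst s hs).symm rfl
  refine ⟨h2, ?_, ?_, ?_, ?_⟩
  · exact contDiffAt_snd.comp _ (ContDiffAt.comp (s, t) (hΦ _ h1).1 (hι (s, t) h2))
  · exact congrArg Prod.snd (hΦ _ (hall _ (hmem 0 t (by simpa using hε) ht)).1).2.1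
  · rw [hpair]
    exact h4
  · have := (hasFDerivAt_snd (𝕜 := ℝ) (E := ℝ) (F := X)).comp_hasDerivAt s (hd s hs)
    change HasDerivAt _ (g (t, (Φ (ι (s, t))).2)) s
    rw [hpair, ← h3]
    exact this

end LocalFlow

/-! ### Local existence of morphisms in coordinates. -/

section Partial

variable {Y : Type*} [NormedAddCommGroup Y] [NormedSpace ℝ Y]

theorem hasDerivAt_fst_slice {f : ℝ × ℝ → Y} {s t : ℝ} (hf : DifferentiableAt ℝ f (s, t)) :
    HasDerivAt (fun s' => f (s', t)) (fderiv ℝ f (s, t) (1, 0)) s :=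
  hf.hasFDerivAt.comp_hasDerivAt (f := fun s' : ℝ => (s', t)) s
    ((hasDerivAt_id _).prodMk (hasDerivAt_const _ _))

theorem hasDerivAt_snd_slice {f : ℝ × ℝ → Y} {s t : ℝ} (hf : DifferentiableAt ℝ f (s, t)) :
    HasDerivAt (fun t' => f (s, t')) (fderiv ℝ f (s, t) (0, 1)) t :=
  hf.hasFDerivAt.comp_hasDerivAt (f := fun t' : ℝ => (s, t')) t
    ((hasDerivAt_const _ _).prodMk (hasDerivAt_id _))

end Partial

set_option maxHeartbeats 1000000 in
set_option synthInstance.maxHeartbeats 200000 in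
/-- Local existence of morphisms `α dt + β ds` of Lie algebroids in coordinates, with anchor `R` and
structure functions `C`: given an admissible curve `(γ, a)` and a section `σ` along it. -/
theorem exists_coordinate_morphism {V F : Type*} [NormedAddCommGroup V] [NormedSpace ℝ V]
    [FiniteDimensional ℝ V] [NormedAddCommGroup F] [NormedSpace ℝ F] [FiniteDimensional ℝ F]
    {R : V → F →L[ℝ] V} {C : V → F →L[ℝ] F →L[ℝ] F} {O : Set V} (hO : IsOpen O)
    (hR : ContDiffOn ℝ ∞ R O) (hC : ContDiffOn ℝ ∞ C O)
    (hRC : ∀ q ∈ O, ∀ u v, fderiv ℝ R q (R q u) v - fderiv ℝ R q (R q v) u = R q (C q u v))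
    {J : Set ℝ} (hJ : IsOpen J) {γ : ℝ → V} {a σ : ℝ → F} (hγ : ContDiffOn ℝ ∞ γ J)
    (ha : ContDiffOn ℝ ∞ a J) (hσ : ContDiffOn ℝ ∞ σ J)
    (hadm : ∀ t ∈ J, deriv γ t = R (γ t) (a t)) {t₀ : ℝ} (ht₀ : t₀ ∈ J) (hγO : γ t₀ ∈ O) :
    ∃ (W : Set (ℝ × ℝ)) (φ : ℝ × ℝ → V) (α : ℝ × ℝ → F), IsOpen W ∧ ((0 : ℝ), t₀) ∈ W ∧
      ContDiffOn ℝ ∞ φ W ∧ ContDiffOn ℝ ∞ α W ∧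
      (∀ t, ((0 : ℝ), t) ∈ W → φ (0, t) = γ t ∧ α (0, t) = a t) ∧
      ∀ p ∈ W, p.2 ∈ J ∧ φ p ∈ O ∧ fderiv ℝ φ p (0, 1) = R (φ p) (α p) ∧
        fderiv ℝ φ p (1, 0) = R (φ p) (σ p.2) ∧
        fderiv ℝ α p (1, 0) = deriv σ p.2 + C (φ p) (α p) (σ p.2) := by
  have hdσ : ContDiffOn ℝ ∞ (deriv σ) J := hσ.deriv_of_isOpen hJ (by simp)
  let O' : Set (ℝ × V × F) := J ×ˢ (O ×ˢ univ)
  have hO' : IsOpen O' := hJ.prod (hO.prod isOpen_univ)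
  -- The right-hand side consists of the two `s`-equations of a morphism with `β = σ(t)` independent
  -- of `s`, so that `∂β/∂t` is `deriv σ t`.
  let g : ℝ × V × F → V × F := fun q => (R q.2.1 (σ q.1), deriv σ q.1 + C q.2.1 q.2.2 (σ q.1))
  have hg : ContDiffOn ℝ ∞ g O' := by
    have m1 : MapsTo (fun q : ℝ × V × F => q.1) O' J := fun q hq => hq.1
    have m2 : MapsTo (fun q : ℝ × V × F => q.2.1) O' O := fun q hq => hq.2.1
    have f1 : ContDiffOn ℝ ∞ (fun q : ℝ × V × F => q.1) O' := contDiffOn_fst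
    have f2 : ContDiffOn ℝ ∞ (fun q : ℝ × V × F => q.2.1) O' :=
      (contDiff_fst.comp contDiff_snd).contDiffOn
    have f3 : ContDiffOn ℝ ∞ (fun q : ℝ × V × F => q.2.2) O' :=
      (contDiff_snd.comp contDiff_snd).contDiffOn
    have s1 := hσ.comp f1 m1
    exact ((hR.comp f2 m2).clm_apply s1).prodMk
      ((hdσ.comp f1 m1).add (((hC.comp f2 m2).clm_apply f3).clm_apply s1))
  obtain ⟨ε₁, Z, hε₁, hZ⟩ := exists_smooth_solution hO' hg hJ (hγ.prodMk ha) ht₀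
    ⟨ht₀, hγO, mem_univ _⟩
  set φ : ℝ × ℝ → V := fun p => (Z p).1 with hφ
  set α : ℝ × ℝ → F := fun p => (Z p).2 with hα
  have hφs : ∀ s t, |s| < ε₁ → |t - t₀| < ε₁ → ContDiffAt ℝ ∞ φ (s, t) := fun s t hs ht =>
    contDiffAt_fst.comp _ (hZ s t hs ht).2.1
  have hαs : ∀ s t, |s| < ε₁ → |t - t₀| < ε₁ → ContDiffAt ℝ ∞ α (s, t) := fun s t hs ht =>
    contDiffAt_snd.comp _ (hZ s t hs ht).2.1
  have h0 : |(0 : ℝ)| < ε₁ := by simpa using hε₁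
  have h00 : |t₀ - t₀| < ε₁ := by simpa using hε₁
  have hdR : ContDiffOn ℝ ∞ (fderiv ℝ R) O := hR.fderiv_of_isOpen hO (by simp)
  -- a uniform bound for the linear equation satisfied by the defect
  set N : ℝ × ℝ → ℝ := fun p => ‖fderiv ℝ R (φ p)‖ * ‖σ p.2‖ with hN
  have hNc : ContinuousAt N (0, t₀) := by
    have hφO : φ (0, t₀) ∈ O := (hZ 0 t₀ h0 h00).2.2.2.1.2.1
    have c1 : ContinuousAt (fun p => fderiv ℝ R (φ p)) ((0 : ℝ), t₀) :=
      ContinuousAt.comp (hdR.continuousOn.continuousAt (hO.mem_nhds hφO))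
        (hφs 0 t₀ h0 h00).continuousAt
    have c2 : ContinuousAt (fun p : ℝ × ℝ => σ p.2) ((0 : ℝ), t₀) :=
      ContinuousAt.comp (f := Prod.snd) (hσ.continuousOn.continuousAt (hJ.mem_nhds ht₀))
        continuousAt_snd
    exact (ContinuousAt.comp (continuous_norm (E := V →L[ℝ] F →L[ℝ] V)).continuousAt c1).mul c2.norm
  obtain ⟨ε₂, hε₂, hbound⟩ := Metric.eventually_nhds_iff_ball.1
    (hNc.eventually (gt_mem_nhds (lt_add_one (N (0, t₀)))))
  set K := N (0, t₀) + 1 with hK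
  set ε := min ε₁ ε₂ with hε
  have hεp : 0 < ε := lt_min hε₁ hε₂
  let W : Set (ℝ × ℝ) := {p | |p.1| < ε ∧ |p.2 - t₀| < ε}
  have hW : IsOpen W := by
    have h1 : Continuous fun p : ℝ × ℝ => |p.1| := by fun_prop
    have h2 : Continuous fun p : ℝ × ℝ => |p.2 - t₀| := by fun_prop
    exact (isOpen_lt h1 continuous_const).inter (isOpen_lt h2 continuous_const)
  have hW1 : ∀ p ∈ W, |p.1| < ε₁ ∧ |p.2 - t₀| < ε₁ := fun p hp =>
    ⟨hp.1.trans_le (min_le_left _ _), hp.2.trans_le (min_le_left _ _)⟩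
  have hW2 : ∀ p ∈ W, N p < K := by
    intro p hp
    apply hbound
    simp only [Metric.mem_ball, Prod.dist_eq, Real.dist_eq, sub_zero]
    exact max_lt (hp.1.trans_le (min_le_right _ _)) (hp.2.trans_le (min_le_right _ _))
  have hφW : ContDiffOn ℝ ∞ φ W := fun p hp =>
    (hφs p.1 p.2 (hW1 p hp).1 (hW1 p hp).2).contDiffWithinAt
  have hαW : ContDiffOn ℝ ∞ α W := fun p hp =>
    (hαs p.1 p.2 (hW1 p hp).1 (hW1 p hp).2).contDiffWithinAt
  have hφd : ∀ p ∈ W, DifferentiableAt ℝ φ p := fun p hp =>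
    (hφW.contDiffAt (hW.mem_nhds hp)).differentiableAt (by simp)
  have hαd : ∀ p ∈ W, DifferentiableAt ℝ α p := fun p hp =>
    (hαW.contDiffAt (hW.mem_nhds hp)).differentiableAt (by simp)
  have hφO : ∀ p ∈ W, φ p ∈ O := fun p hp =>
    (hZ p.1 p.2 (hW1 p hp).1 (hW1 p hp).2).2.2.2.1.2.1
  have hpJ : ∀ p ∈ W, p.2 ∈ J := fun p hp => (hZ p.1 p.2 (hW1 p hp).1 (hW1 p hp).2).1
  have hinit : ∀ t, ((0 : ℝ), t) ∈ W → φ (0, t) = γ t ∧ α (0, t) = a t := by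
    intro t ht
    have h := (hZ 0 t (hW1 _ ht).1 (hW1 _ ht).2).2.2.1
    exact ⟨congrArg Prod.fst h, congrArg Prod.snd h⟩
  have hφ1 : ∀ p ∈ W, fderiv ℝ φ p (1, 0) = R (φ p) (σ p.2) := by
    rintro ⟨s, t⟩ hp
    have h1 := (hZ s t (hW1 _ hp).1 (hW1 _ hp).2).2.2.2.2
    exact (hasDerivAt_fst_slice (hφd _ hp)).unique
      ((hasFDerivAt_fst (𝕜 := ℝ) (E := V) (F := F)).comp_hasDerivAt s h1)
  have hα1 : ∀ p ∈ W, fderiv ℝ α p (1, 0) = deriv σ p.2 + C (φ p) (α p) (σ p.2) := by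
    rintro ⟨s, t⟩ hp
    have h1 := (hZ s t (hW1 _ hp).1 (hW1 _ hp).2).2.2.2.2
    exact (hasDerivAt_fst_slice (hαd _ hp)).unique
      ((hasFDerivAt_snd (𝕜 := ℝ) (E := V) (F := F)).comp_hasDerivAt s h1)
  refine ⟨W, φ, α, hW, ⟨by simpa using hεp, by simpa using hεp⟩, hφW, hαW, hinit,
    fun p hp => ⟨hpJ p hp, hφO p hp, ?_, hφ1 p hp, hα1 p hp⟩⟩
  -- the admissibility of `α(s, ·)` propagates from `s = 0`
  obtain ⟨s, t⟩ := p
  have hsW : ∀ s', |s'| < ε → (s', t) ∈ W := fun s' hs' => ⟨hs', hp.2⟩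
  have ht : t ∈ J := hpJ _ hp
  have hRd : ∀ p ∈ W, HasFDerivAt R (fderiv ℝ R (φ p)) (φ p) := fun p hp =>
    ((hR.contDiffAt (hO.mem_nhds (hφO p hp))).differentiableAt (by simp)).hasFDerivAt
  have hσd : HasDerivAt σ (deriv σ t) t :=
    ((hσ.contDiffAt (hJ.mem_nhds ht)).differentiableAt (by simp)).hasDerivAt
  set D : ℝ → V := fun s' => fderiv ℝ φ (s', t) (0, 1) with hD
  have hDd : ∀ s', |s'| < ε → HasDerivAt D
      (fderiv ℝ R (φ (s', t)) (D s') (σ t) + R (φ (s', t)) (deriv σ t)) s' := by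
    intro s' hs'
    have hpW := hsW s' hs'
    -- Symmetry of second derivatives turns `∂/∂s` of `∂φ/∂t` into the `t`-derivative of the known
    -- quantity `R(φ)σ`.
    have hcomm := JetCalc.deriv_deriv_comm hW hφW hpW
    have e1 : (fun t' => deriv (fun s'' => φ (s'', t')) s') =ᶠ[𝓝 t]
        fun t' => R (φ (s', t')) (σ t') := by
      have : ∀ᶠ t' in 𝓝 t, (s', t') ∈ W :=
        ((by fun_prop : Continuous fun t' : ℝ => (s', t')).continuousAt).eventually
          (hW.mem_nhds hpW)
      filter_upwards [this] with t' ht'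
      rw [(hasDerivAt_fst_slice (hφd _ ht')).deriv]
      exact hφ1 _ ht'
    have e2 : (fun s'' => deriv (fun t' => φ (s'', t')) t) =ᶠ[𝓝 s'] D := by
      have : ∀ᶠ s'' in 𝓝 s', |s''| < ε :=
        (isOpen_lt continuous_abs continuous_const).mem_nhds hs'
      filter_upwards [this] with s'' hs''
      exact (hasDerivAt_snd_slice (hφd _ (hsW s'' hs''))).deriv
    have hr : HasDerivAt (fun t' => R (φ (s', t')) (σ t'))
        (fderiv ℝ R (φ (s', t)) (D s') (σ t) + R (φ (s', t)) (deriv σ t)) t := by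
      have hx : HasDerivAt (fun t' => R (φ (s', t'))) (fderiv ℝ R (φ (s', t)) (D s')) t :=
        (hRd _ hpW).comp_hasDerivAt t (hasDerivAt_snd_slice (hφd _ hpW))
      exact hx.clm_apply hσd
    rw [e1.deriv_eq, e2.deriv_eq, hr.deriv] at hcomm
    rw [hcomm]
    have hDdiff : DifferentiableAt ℝ D s' := by
      have h1 : ContDiffOn ℝ ∞ (fun p => fderiv ℝ φ p (0, 1)) W :=
        (hφW.fderiv_of_isOpen hW (m := ∞) (by simp)).clm_apply contDiffOn_const
      have h2 := (h1.contDiffAt (hW.mem_nhds hpW)).differentiableAt (by simp)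
      exact (hasDerivAt_fst_slice h2).differentiableAt
    exact hDdiff.hasDerivAt
  -- The defect in admissibility of `α(s', ·)`. In its derivative the terms `R(φ)σ'` cancel, and the
  -- structure equation `hRC` absorbs `R(φ)C(φ)(α, σ)`, leaving an expression linear in `w`.
  set w : ℝ → V := fun s' => D s' - R (φ (s', t)) (α (s', t)) with hw
  have hwd : ∀ s', |s'| < ε → HasDerivAt w (fderiv ℝ R (φ (s', t)) (w s') (σ t)) s' := by
    intro s' hs'
    have hpW := hsW s' hs'
    have h1 : HasDerivAt (fun s'' => R (φ (s'', t)) (α (s'', t)))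
        (fderiv ℝ R (φ (s', t)) (R (φ (s', t)) (σ t)) (α (s', t)) +
          R (φ (s', t)) (deriv σ t + C (φ (s', t)) (α (s', t)) (σ t))) s' := by
      have hx := hasDerivAt_fst_slice (hφd _ hpW)
      have hy := hasDerivAt_fst_slice (hαd _ hpW)
      rw [hφ1 _ hpW] at hx
      rw [hα1 _ hpW] at hy
      have hz : HasDerivAt (fun s'' => R (φ (s'', t)))
          (fderiv ℝ R (φ (s', t)) (R (φ (s', t)) (σ t))) s' := (hRd _ hpW).comp_hasDerivAt s' hx
      exact hz.clm_apply hy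
    refine ((hDd s' hs').sub h1).congr_deriv ?_
    have hid := hRC _ (hφO _ hpW) (α (s', t)) (σ t)
    simp only [hw, map_add, map_sub, sub_apply]
    rw [← hid]
    abel
  have hw0 : w 0 = 0 := by
    have hpW : ((0 : ℝ), t) ∈ W := hsW 0 (by simpa using hεp)
    obtain ⟨i1, i2⟩ := hinit t hpW
    have e : (fun t' => φ (0, t')) =ᶠ[𝓝 t] γ := by
      have : ∀ᶠ t' in 𝓝 t, ((0 : ℝ), t') ∈ W :=
        ((by fun_prop : Continuous fun t' : ℝ => ((0 : ℝ), t')).continuousAt).eventually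
          (hW.mem_nhds hpW)
      filter_upwards [this] with t' ht'
      exact (hinit t' ht').1
    have h1 := (hasDerivAt_snd_slice (hφd _ hpW)).deriv
    rw [e.deriv_eq, hadm t ht] at h1
    simp only [hw, hD]
    rw [← h1, i1, i2, sub_self]
  have hzero := eq_zero_of_norm_deriv_le (K := K) hwd hw0 (fun s' hs' => ?_) hp.1
  · exact sub_eq_zero.1 hzero
  · have h1 := hW2 _ (hsW s' hs')
    calc ‖fderiv ℝ R (φ (s', t)) (w s') (σ t)‖ ≤ ‖fderiv ℝ R (φ (s', t)) (w s')‖ * ‖σ t‖ :=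
          ContinuousLinearMap.le_opNorm _ _
      _ ≤ ‖fderiv ℝ R (φ (s', t))‖ * ‖w s'‖ * ‖σ t‖ := by
          gcongr
          exact ContinuousLinearMap.le_opNorm _ _
      _ = N (s', t) * ‖w s'‖ := by simp only [hN]; ring
      _ ≤ K * ‖w s'‖ := by gcongr

/-! ### Algebraic consequences of the axioms: tensoriality of `d` and the anchor as a bracket
morphism. -/

section AlgebroidTheory

variable {V H M : Type*} [NormedAddCommGroup V] [NormedSpace ℝ V] [TopologicalSpace H]
  {I : ModelWithCorners ℝ V H} [TopologicalSpace M] [ChartedSpace H M] [IsManifold I ∞ M]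
  {F : Type*} [NormedAddCommGroup F] [NormedSpace ℝ F] {E : M → Type*}
  [∀ x, AddCommGroup (E x)] [∀ x, Module ℝ (E x)] [∀ x, TopologicalSpace (E x)]
  [TopologicalSpace (TotalSpace F E)] [FiberBundle F E] [VectorBundle ℝ F E]

theorem dirDeriv_congr {x : M} (v : TangentSpace I x) {f g : M → ℝ} (h : f =ᶠ[𝓝 x] g) :
    dirDeriv v f = dirDeriv v g := by
  unfold dirDeriv
  rw [h.mfderiv_eq]
  rfl

theorem dirDeriv_const {x : M} (v : TangentSpace I x) (c : ℝ) :
    dirDeriv v (fun _ => c) = 0 := by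
  unfold dirDeriv
  rw [mfderiv_const]
  rfl

theorem dirDeriv_eq_zero_of_eventuallyEq_const {x : M} (v : TangentSpace I x) {f : M → ℝ} {c : ℝ}
    (h : ∀ᶠ y in 𝓝 x, f y = c) : dirDeriv v f = 0 :=
  (dirDeriv_congr v h).trans (dirDeriv_const v c)

theorem dirDeriv_vec_add {x : M} (v w : TangentSpace I x) (f : M → ℝ) :
    dirDeriv (v + w) f = dirDeriv v f + dirDeriv w f := by
  unfold dirDeriv
  exact map_add _ _ _

theorem dirDeriv_vec_smul {x : M} (c : ℝ) (v : TangentSpace I x) (f : M → ℝ) :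
    dirDeriv (c • v) f = c * dirDeriv v f := by
  unfold dirDeriv
  exact map_smul (mfderiv I 𝓘(ℝ, ℝ) f x) c v

theorem dirDeriv_add {x : M} (v : TangentSpace I x) {f g : M → ℝ}
    (hf : MDifferentiableAt I 𝓘(ℝ, ℝ) f x) (hg : MDifferentiableAt I 𝓘(ℝ, ℝ) g x) :
    dirDeriv v (fun y => f y + g y) = dirDeriv v f + dirDeriv v g := by
  unfold dirDeriv
  have := mfderiv_add hf hg
  exact congrArg (fun L : TangentSpace I x →L[ℝ] ℝ => L v) this

theorem dirDeriv_mul {x : M} (v : TangentSpace I x) {f g : M → ℝ}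
    (hf : MDifferentiableAt I 𝓘(ℝ, ℝ) f x) (hg : MDifferentiableAt I 𝓘(ℝ, ℝ) g x) :
    dirDeriv v (fun y => f y * g y) = f x * dirDeriv v g + dirDeriv v f * g x := by
  have h := (hf.hasMFDerivAt.mul hg.hasMFDerivAt).mfderiv
  rw [mul_comm (dirDeriv v f)]
  exact congrArg (fun L : TangentSpace I x →L[ℝ] ℝ => L v) h

/-- The derivative of a function in the coordinates of a chart. -/
theorem dirDeriv_comp_extChartAt {x₀ x : M} (hx : x ∈ (extChartAt I x₀).source)
    (v : TangentSpace I x) {g : V → ℝ} (hg : DifferentiableAt ℝ g (extChartAt I x₀ x)) :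
    dirDeriv v (fun y => g (extChartAt I x₀ y)) =
      fderiv ℝ g (extChartAt I x₀ x) (mfderiv I 𝓘(ℝ, V) (extChartAt I x₀) x v) := by
  unfold dirDeriv
  have h := mfderiv_comp (I := I) (I' := 𝓘(ℝ, V)) (I'' := 𝓘(ℝ, ℝ)) x (g := g)
    (f := extChartAt I x₀) hg.mdifferentiableAt
    (mdifferentiableAt_extChartAt (by rwa [extChartAt_source] at hx))
  rw [mfderiv_eq_fderiv] at h
  exact congrArg (fun L : TangentSpace I x →L[ℝ] ℝ => L v) h

/-- This allows `ρ(σ) f` to be used as a coefficient in `mulSection`, so that the Leibniz rule can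
be applied twice. -/
theorem contMDiff_dirDeriv_anchor (A : LieAlgebroid I F E) (f : C^∞⟮I, M; ℝ⟯)
    (σ : Cₛ^∞⟮I; F, E⟯) :
    ContMDiff I 𝓘(ℝ, ℝ) ∞ fun y => dirDeriv (A.anchor y (σ y)) f := by
  have h1 : ContMDiff I I.tangent ∞
      fun y => (⟨y, A.anchor y (σ y)⟩ : TangentBundle I M) :=
    A.contMDiff_anchor.comp σ.contMDiff
  have h2 : ContMDiff I.tangent (𝓘(ℝ, ℝ).tangent) ∞ (tangentMap I 𝓘(ℝ, ℝ) f) :=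
    f.contMDiff.contMDiff_tangentMap (by simp)
  have h3 := h2.comp h1
  intro y
  exact ((contMDiffAt_totalSpace.1 (h3 y)).2).congr_of_eventuallyEq
    (Eventually.of_forall fun z => by
      simp [tangentMap, dirDeriv]
      rfl)

namespace DualSection

theorem contMDiff_apply (θ : DualSection I F E) (ζ : Cₛ^∞⟮I; F, E⟯) :
    ContMDiff I 𝓘(ℝ, ℝ) ∞ fun y => θ.toFun y (ζ y) :=
  θ.contMDiff_toFun.comp ζ.contMDiff

theorem mdifferentiableAt_apply (θ : DualSection I F E) (ζ : Cₛ^∞⟮I; F, E⟯) (x : M) :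
    MDifferentiableAt I 𝓘(ℝ, ℝ) (fun y => θ.toFun y (ζ y)) x :=
  (θ.contMDiff_apply ζ).mdifferentiableAt (by simp)

end DualSection

theorem mdifferentiableAt_smoothFunction (f : C^∞⟮I, M; ℝ⟯) (x : M) :
    MDifferentiableAt I 𝓘(ℝ, ℝ) f x :=
  f.contMDiff.mdifferentiableAt (by simp)

@[simp] theorem mulSection_apply (f : C^∞⟮I, M; ℝ⟯) (η : Cₛ^∞⟮I; F, E⟯) (x : M) :
    mulSection f η x = f x • η x := rfl

namespace LieAlgebroid

variable (A : LieAlgebroid I F E)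

theorem bracket_neg_swap (σ η : Cₛ^∞⟮I; F, E⟯) : A.bracket σ η = -A.bracket η σ := by
  have h := A.bracket_self (σ + η)
  simp only [map_add, LinearMap.add_apply, A.bracket_self, zero_add, add_zero] at h
  exact eq_neg_of_add_eq_zero_right h

theorem bracket_neg_swap_apply (σ η : Cₛ^∞⟮I; F, E⟯) (x : M) :
    A.bracket σ η x = -A.bracket η σ x := by
  rw [A.bracket_neg_swap σ η]
  rfl

theorem d_swap (θ : DualSection I F E) (η ζ : Cₛ^∞⟮I; F, E⟯) (x : M) :
    A.d θ η ζ x = -A.d θ ζ η x := by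
  unfold d
  rw [A.bracket_neg_swap_apply η ζ x, map_neg]
  ring

theorem d_add_right (θ : DualSection I F E) (η ζ ζ' : Cₛ^∞⟮I; F, E⟯) (x : M) :
    A.d θ η (ζ + ζ') x = A.d θ η ζ x + A.d θ η ζ' x := by
  unfold d
  have h1 : dirDeriv (A.anchor x (η x)) (fun y => θ.toFun y ((ζ + ζ') y)) =
      dirDeriv (A.anchor x (η x)) (fun y => θ.toFun y (ζ y)) +
      dirDeriv (A.anchor x (η x)) (fun y => θ.toFun y (ζ' y)) := by
    rw [← dirDeriv_add _ (θ.mdifferentiableAt_apply ζ x) (θ.mdifferentiableAt_apply ζ' x)]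
    congr 1
    funext y
    exact map_add (θ.toFun y) _ _
  have h2 : A.anchor x ((ζ + ζ') x) = A.anchor x (ζ x) + A.anchor x (ζ' x) :=
    map_add (A.anchor x) _ _
  have h3 : θ.toFun x (A.bracket η (ζ + ζ') x) =
      θ.toFun x (A.bracket η ζ x) + θ.toFun x (A.bracket η ζ' x) := by
    rw [map_add]
    exact map_add (θ.toFun x) _ _
  rw [h1, h2, h3, dirDeriv_vec_add]
  ring

/-- The term `(ρ(η) f) ⟨θ, ζ⟩` occurs twice, from differentiating `⟨θ, f ζ⟩` and from the Leibniz
rule for `[η, f ζ]`, with opposite signs. -/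
theorem d_mulSection_right (θ : DualSection I F E) (f : C^∞⟮I, M; ℝ⟯) (η ζ : Cₛ^∞⟮I; F, E⟯)
    (x : M) : A.d θ η (mulSection f ζ) x = f x * A.d θ η ζ x := by
  unfold d
  have h1 : dirDeriv (A.anchor x (η x)) (fun y => θ.toFun y (mulSection f ζ y)) =
      f x * dirDeriv (A.anchor x (η x)) (fun y => θ.toFun y (ζ y)) +
      dirDeriv (A.anchor x (η x)) f * θ.toFun x (ζ x) := by
    rw [← dirDeriv_mul _ (mdifferentiableAt_smoothFunction f x) (θ.mdifferentiableAt_apply ζ x)]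
    congr 1
    funext y
    exact map_smul (θ.toFun y) _ _
  rw [h1, A.leibniz, mulSection_apply, map_smul, dirDeriv_vec_smul, map_add, map_smul, map_smul,
    smul_eq_mul, smul_eq_mul]
  ring

/-- The anchor is a morphism of Lie algebras. -/
theorem dirDeriv_anchor_bracket (f : C^∞⟮I, M; ℝ⟯) (σ η ζ : Cₛ^∞⟮I; F, E⟯) (x : M)
    (hζ : ζ x ≠ 0) :
    dirDeriv (A.anchor x (A.bracket σ η x)) f =
      dirDeriv (A.anchor x (σ x)) (fun y => dirDeriv (A.anchor y (η y)) f) -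
      dirDeriv (A.anchor x (η x)) (fun y => dirDeriv (A.anchor y (σ y)) f) := by
  have key : ∀ σ η : Cₛ^∞⟮I; F, E⟯, A.bracket σ (A.bracket η (mulSection f ζ)) x =
      dirDeriv (A.anchor x (σ x)) (fun y => dirDeriv (A.anchor y (η y)) f) • ζ x +
      dirDeriv (A.anchor x (η x)) f • A.bracket σ ζ x +
      (dirDeriv (A.anchor x (σ x)) f • A.bracket η ζ x +
        f x • A.bracket σ (A.bracket η ζ) x) := by
    intro σ η
    let ρf : C^∞⟮I, M; ℝ⟯ := ⟨_, contMDiff_dirDeriv_anchor A f η⟩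
    have h : A.bracket η (mulSection f ζ) = mulSection ρf ζ + mulSection f (A.bracket η ζ) := by
      ext y
      exact A.leibniz f η ζ y
    rw [h, map_add]
    refine (congrArg₂ (· + ·) (A.leibniz ρf σ ζ x) (A.leibniz f σ (A.bracket η ζ) x)).trans ?_
    rfl
  have hj := congrArg (fun s : Cₛ^∞⟮I; F, E⟯ => s x) (A.jacobi σ η (mulSection f ζ))
  have hj0 := congrArg (fun s : Cₛ^∞⟮I; F, E⟯ => s x) (A.jacobi σ η ζ)
  have e1 : A.bracket η (A.bracket (mulSection f ζ) σ) =
      -A.bracket η (A.bracket σ (mulSection f ζ)) := by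
    rw [A.bracket_neg_swap (mulSection f ζ) σ, map_neg]
  have e2 : A.bracket η (A.bracket ζ σ) = -A.bracket η (A.bracket σ ζ) := by
    rw [A.bracket_neg_swap ζ σ, map_neg]
  rw [e1, A.bracket_neg_swap (mulSection f ζ) (A.bracket σ η)] at hj
  rw [e2, A.bracket_neg_swap ζ (A.bracket σ η)] at hj0
  change A.bracket σ (A.bracket η (mulSection f ζ)) x +
    -A.bracket η (A.bracket σ (mulSection f ζ)) x +
    -A.bracket (A.bracket σ η) (mulSection f ζ) x = 0 at hj
  change A.bracket σ (A.bracket η ζ) x + -A.bracket η (A.bracket σ ζ) x +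
    -A.bracket (A.bracket σ η) ζ x = 0 at hj0
  rw [key σ η, key η σ, A.leibniz] at hj
  -- Subtracting `f` times the Jacobi identity for `σ, η, ζ` from the one for `σ, η, f ζ` leaves a
  -- scalar multiple of `ζ x`. The mixed terms with one derivative of `f` cancel by antisymmetry.
  -- Since `ζ x ≠ 0`, the scalar is zero.
  have hz : (dirDeriv (A.anchor x (σ x)) (fun y => dirDeriv (A.anchor y (η y)) f) -
      dirDeriv (A.anchor x (η x)) (fun y => dirDeriv (A.anchor y (σ y)) f) -
      dirDeriv (A.anchor x (A.bracket σ η x)) f) • ζ x = 0 := by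
    have h3 : f x • (A.bracket σ (A.bracket η ζ) x + -A.bracket η (A.bracket σ ζ) x +
      -A.bracket (A.bracket σ η) ζ x) = 0 := by rw [hj0, smul_zero]
    rw [← sub_eq_zero.2 (hj.trans h3.symm)]
    module
  rcases smul_eq_zero.1 hz with h | h
  · linarith
  · exact absurd h hζ

section Locality

variable [FiniteDimensional ℝ V] [T2Space M]

theorem exists_smoothFunction_eventuallyEq {W : Type*} [NormedAddCommGroup W] [NormedSpace ℝ W]
    {g : M → W} {U : Set M} (hU : IsOpen U) (hg : ContMDiffOn I 𝓘(ℝ, W) ∞ g U) {x : M}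
    (hx : x ∈ U) : ∃ f : M → W, ContMDiff I 𝓘(ℝ, W) ∞ f ∧ f =ᶠ[𝓝 x] g := by
  obtain ⟨χ, -, hχ⟩ := (SmoothBumpFunction.nhds_basis_tsupport (I := I) x).mem_iff.1
    (hU.mem_nhds hx)
  refine ⟨fun y => χ y • g y, fun y => ?_, ?_⟩
  · by_cases hy : y ∈ tsupport χ
    · exact χ.contMDiffAt.smul (hg.contMDiffAt (hU.mem_nhds (hχ hy)))
    · refine (contMDiffAt_const (c := (0 : W))).congr_of_eventuallyEq ?_
      filter_upwards [(isClosed_tsupport χ).isOpen_compl.mem_nhds hy] with z hz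
      rw [image_eq_zero_of_notMem_tsupport hz, zero_smul]
  · filter_upwards [χ.eventuallyEq_one] with y hy
    rw [hy]
    simp

/-- A section that vanishes near `x` is the product of itself with a function vanishing near `x`. -/
theorem exists_mulSection_eq {ζ : Cₛ^∞⟮I; F, E⟯} {x : M} (h : ∀ᶠ y in 𝓝 x, ζ y = 0) :
    ∃ f : C^∞⟮I, M; ℝ⟯, f x = 0 ∧ mulSection f ζ = ζ := by
  obtain ⟨U, hU, hUo, hxU⟩ := mem_nhds_iff.1 h
  obtain ⟨χ, -, hχ⟩ := (SmoothBumpFunction.nhds_basis_tsupport (I := I) x).mem_iff.1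
    (hUo.mem_nhds hxU)
  -- The bump `χ` is supported where `ζ` vanishes, so multiplication by `1 - χ` leaves `ζ`
  -- unchanged.
  refine ⟨⟨fun y => 1 - χ y, contMDiff_const.sub χ.contMDiff⟩, ?_, ?_⟩
  · change 1 - χ x = 0
    rw [χ.eq_one, sub_self]
  · ext y
    change (1 - χ y) • ζ y = ζ y
    by_cases hy : y ∈ tsupport χ
    · rw [show ζ y = 0 from hU (hχ hy), smul_zero]
    · rw [image_eq_zero_of_notMem_tsupport hy, sub_zero, one_smul]

theorem d_eq_zero_of_eventually_eq_zero (θ : DualSection I F E) (η : Cₛ^∞⟮I; F, E⟯)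
    {ζ : Cₛ^∞⟮I; F, E⟯} {x : M} (h : ∀ᶠ y in 𝓝 x, ζ y = 0) : A.d θ η ζ x = 0 := by
  obtain ⟨f, hf, hfζ⟩ := exists_mulSection_eq h
  rw [← hfζ, A.d_mulSection_right, hf, zero_mul]

variable [ContMDiffVectorBundle ∞ F E I] [FiniteDimensional ℝ F]

theorem contMDiffOn_trivializationAt_section (ζ : Cₛ^∞⟮I; F, E⟯) (x₀ : M) :
    ContMDiffOn I 𝓘(ℝ, F) ∞ (fun y => (trivializationAt F E x₀ ⟨y, ζ y⟩).2)
      (trivializationAt F E x₀).baseSet := by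
  intro y hy
  exact ((Trivialization.contMDiffAt_section_iff (e := trivializationAt F E x₀) (n := ∞) hy).1
    (ζ.contMDiff y)).contMDiffWithinAt

theorem trivializationAt_snd_eq_linearMapAt {x₀ y : M}
    (hy : y ∈ (trivializationAt F E x₀).baseSet) (v : E y) :
    (trivializationAt F E x₀ ⟨y, v⟩).2 = (trivializationAt F E x₀).linearMapAt ℝ y v := by
  rw [Trivialization.linearMapAt_apply, if_pos hy]

/-- A linear family of sections that is a constant family in a local trivialization near `x₀`. -/
theorem exists_localFrame (x₀ : M) : ∃ (K : F →ₗ[ℝ] Cₛ^∞⟮I; F, E⟯) (U : Set M), IsOpen U ∧ x₀ ∈ U ∧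
    U ⊆ (trivializationAt F E x₀).baseSet ∧ U ⊆ (extChartAt I x₀).source ∧
    ∀ y ∈ U, ∀ u, (trivializationAt F E x₀ ⟨y, K u y⟩).2 = u := by
  set e := trivializationAt F E x₀ with he
  let b := Module.finBasis ℝ F
  -- `constSection` is chosen separately for each vector and need not be linear in it. Extending
  -- linearly from a basis makes `K` linear, and a common neighbourhood exists because the basis is
  -- finite.
  let K : F →ₗ[ℝ] Cₛ^∞⟮I; F, E⟯ := b.constr ℝ fun i => constSection (I := I) x₀ (b i)
  have hev : ∀ᶠ y in 𝓝 x₀, ∀ i, (e ⟨y, constSection (I := I) x₀ (b i) y⟩).2 = b i :=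
    eventually_all.2 fun i => Classical.choose_spec (exists_constSection (I := I) x₀ (b i))
  have hev2 := (hev.and (e.open_baseSet.mem_nhds (mem_baseSet_trivializationAt F E x₀))).and
    (extChartAt_source_mem_nhds (I := I) x₀)
  obtain ⟨U, hU, hUo, hxU⟩ := mem_nhds_iff.1 hev2
  refine ⟨K, U, hUo, hxU, fun y hy => (hU hy).1.2, fun y hy => (hU hy).2, fun y hy u => ?_⟩
  obtain ⟨⟨h1, h2⟩, -⟩ := hU hy
  have h3 : ∀ s : Cₛ^∞⟮I; F, E⟯, (e ⟨y, s y⟩).2 = e.linearMapAt ℝ y (s y) := fun s =>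
    trivializationAt_snd_eq_linearMapAt h2 _
  let L : F →ₗ[ℝ] F :=
    { toFun := fun u => e.linearMapAt ℝ y (K u y)
      map_add' := fun u v => by
        rw [map_add]
        exact map_add (e.linearMapAt ℝ y) _ _
      map_smul' := fun c u => by
        rw [map_smul]
        exact map_smul (e.linearMapAt ℝ y) _ _ }
  have hL : L = LinearMap.id := b.ext fun i => by
    change e.linearMapAt ℝ y (K (b i) y) = b i
    rw [← h3, ← h1 i]
    simp only [K, b.constr_basis, h1]
  rw [h3]
  exact congrArg (fun L : F →ₗ[ℝ] F => L u) hL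

theorem eq_of_trivialization_eq {x₀ y : M} (hy : y ∈ (trivializationAt F E x₀).baseSet)
    {v w : E y} (h : (trivializationAt F E x₀ ⟨y, v⟩).2 = (trivializationAt F E x₀ ⟨y, w⟩).2) :
    v = w := by
  set e := trivializationAt F E x₀
  rw [trivializationAt_snd_eq_linearMapAt hy, trivializationAt_snd_eq_linearMapAt hy] at h
  have := congrArg (e.symmₗ ℝ y) h
  rwa [e.symmₗ_linearMapAt hy, e.symmₗ_linearMapAt hy] at this

/-- Near `x` the section is a combination of frame sections whose coefficients vanish at `x`. `d`
kills each summand by linearity over functions, and kills the difference from `ζ` because that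
difference vanishes near `x`. -/
theorem d_eq_zero_of_eq_zero (θ : DualSection I F E) (η : Cₛ^∞⟮I; F, E⟯)
    {ζ : Cₛ^∞⟮I; F, E⟯} {x : M} (h : ζ x = 0) : A.d θ η ζ x = 0 := by
  obtain ⟨K, U, hU, hxU, hUb, -, hK⟩ := exists_localFrame (I := I) (F := F) (E := E) x
  set e := trivializationAt F E x with he
  let b := Module.finBasis ℝ F
  -- The components of `ζ` are defined only over the trivialization domain. They are replaced by
  -- global smooth functions with the same germs at `x`.
  have hc : ∀ i, ∃ f : M → ℝ, ContMDiff I 𝓘(ℝ, ℝ) ∞ f ∧ f =ᶠ[𝓝 x]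
      fun y => b.coord i (e ⟨y, ζ y⟩).2 := fun i =>
    exists_smoothFunction_eventuallyEq hU (((b.coord i).toContinuousLinearMap.contMDiff.comp_contMDiffOn
      (contMDiffOn_trivializationAt_section ζ x)).mono hUb) hxU
  choose f hf hfe using hc
  let fs : ∀ i, C^∞⟮I, M; ℝ⟯ := fun i => ⟨f i, hf i⟩
  let ζ' : Cₛ^∞⟮I; F, E⟯ := ∑ i, mulSection (fs i) (K (b i))
  have hev : ∀ (s : Finset _) (y : M), (∑ i ∈ s, mulSection (fs i) (K (b i))) y =
      ∑ i ∈ s, f i y • K (b i) y := by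
    intro s y
    induction s using Finset.cons_induction with
    | empty => rfl
    | cons i s hi ih => rw [Finset.sum_cons, Finset.sum_cons, ← ih]; rfl
  have hζ' : ∀ᶠ y in 𝓝 x, (ζ - ζ') y = 0 := by
    filter_upwards [hU.mem_nhds hxU, eventually_all.2 hfe] with y hyU hfy
    change ζ y - ζ' y = 0
    rw [sub_eq_zero]
    apply eq_of_trivialization_eq (hUb hyU)
    have h1 := fun v : E y => trivializationAt_snd_eq_linearMapAt (F := F) (hUb hyU) v
    have h2 : ζ' y = ∑ i, f i y • K (b i) y := hev _ y
    rw [h2, h1 (∑ i, _), map_sum, ← b.sum_repr (e ⟨y, ζ y⟩).2]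
    refine Finset.sum_congr rfl fun i _ => ?_
    rw [map_smul, ← h1, hK y hyU, hfy]
    rfl
  have hsum : ∀ s : Finset _, A.d θ η (∑ i ∈ s, mulSection (fs i) (K (b i))) x = 0 := by
    intro s
    induction s using Finset.cons_induction with
    | empty => exact A.d_eq_zero_of_eventually_eq_zero θ η (Eventually.of_forall fun _ => rfl)
    | cons i s hi ih =>
      rw [Finset.sum_cons, A.d_add_right, ih, A.d_mulSection_right]
      have h0 : fs i x = 0 := by
        have h1 := (hfe i).self_of_nhds
        have h2 : (e ⟨x, ζ x⟩).2 = 0 := by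
          rw [he, trivializationAt_snd_eq_linearMapAt (hUb hxU), h, map_zero]
        exact h1.trans ((congrArg (b.coord i) h2).trans (map_zero _))
      rw [h0, zero_mul, zero_add]
  have : ζ = (ζ - ζ') + ζ' := by abel
  rw [this, A.d_add_right, A.d_eq_zero_of_eventually_eq_zero θ η hζ', zero_add]
  exact hsum _

/-- The differential of a section of the dual depends on its arguments only through their values. -/
theorem d_congr (θ : DualSection I F E) {η η' ζ ζ' : Cₛ^∞⟮I; F, E⟯} {x : M} (hη : η x = η' x)
    (hζ : ζ x = ζ' x) : A.d θ η ζ x = A.d θ η' ζ' x := by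
  have key : ∀ {η ζ ζ' : Cₛ^∞⟮I; F, E⟯}, ζ x = ζ' x → A.d θ η ζ x = A.d θ η ζ' x := by
    intro η ζ ζ' h
    have : ζ = (ζ - ζ') + ζ' := by abel
    rw [this, A.d_add_right, A.d_eq_zero_of_eq_zero θ η (ζ := ζ - ζ') (sub_eq_zero.2 h), zero_add]
  rw [key hζ, A.d_swap θ η, key hη, ← A.d_swap]

end Locality

end LieAlgebroid

end AlgebroidTheory

/-! ### The algebroid in a chart and a local frame. -/

section AlgebroidCoordinates

variable {V H M : Type*} [NormedAddCommGroup V] [NormedSpace ℝ V] [TopologicalSpace H]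
  {I : ModelWithCorners ℝ V H} [TopologicalSpace M] [ChartedSpace H M] [IsManifold I ∞ M]
  {F : Type*} [NormedAddCommGroup F] [NormedSpace ℝ F] {E : M → Type*}
  [∀ x, AddCommGroup (E x)] [∀ x, Module ℝ (E x)] [∀ x, TopologicalSpace (E x)]
  [TopologicalSpace (TotalSpace F E)] [FiberBundle F E] [VectorBundle ℝ F E]
  [FiniteDimensional ℝ V] [FiniteDimensional ℝ F] [T2Space M] [ContMDiffVectorBundle ∞ F E I]
  [I.Boundaryless]

theorem mapsTo_extChartAt_image {x₀ : M} {U : Set M} (hU : U ⊆ (extChartAt I x₀).source) {y : M}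
    (hy : y ∈ U) : extChartAt I x₀ y ∈ (extChartAt I x₀).target ∩ (extChartAt I x₀).symm ⁻¹' U :=
  ⟨(extChartAt I x₀).map_source (hU hy), by
    rw [mem_preimage, (extChartAt I x₀).left_inv (hU hy)]
    exact hy⟩

theorem isOpen_extChartAt_image (x₀ : M) {U : Set M} (hU : IsOpen U) :
    IsOpen ((extChartAt I x₀).target ∩ (extChartAt I x₀).symm ⁻¹' U) :=
  (continuousOn_extChartAt_symm x₀).isOpen_inter_preimage (isOpen_extChartAt_target x₀) hU

/-- The coordinate expression of a smooth family of linear maps on a finite-dimensional space. -/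
theorem exists_coordinate_family {W : Type*} [NormedAddCommGroup W] [NormedSpace ℝ W] {x₀ : M}
    {U : Set M} (hU : U ⊆ (extChartAt I x₀).source) (f : M → F → W)
    (hlin : ∀ y ∈ U, IsLinearMap ℝ (f y))
    (hf : ∀ u, ContMDiffOn I 𝓘(ℝ, W) ∞ (fun y => f y u) U) :
    ∃ Φ : V → F →L[ℝ] W,
      ContDiffOn ℝ ∞ Φ ((extChartAt I x₀).target ∩ (extChartAt I x₀).symm ⁻¹' U) ∧
      ∀ y ∈ U, ∀ u, Φ (extChartAt I x₀ y) u = f y u := by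
  classical
  -- The value `0` away from `U` is arbitrary, as smoothness is claimed only over `U`. Finite
  -- dimension of `F` makes each linear map continuous and reduces smoothness to that of the
  -- evaluations at fixed vectors.
  refine ⟨fun q => if h : (extChartAt I x₀).symm q ∈ U then
    LinearMap.toContinuousLinearMap (IsLinearMap.mk' _ (hlin _ h)) else 0, ?_, ?_⟩
  · rw [contDiffOn_clm_apply]
    intro u
    have h1 : ContMDiffOn 𝓘(ℝ, V) 𝓘(ℝ, W) ∞ (fun q => f ((extChartAt I x₀).symm q) u)
        ((extChartAt I x₀).target ∩ (extChartAt I x₀).symm ⁻¹' U) :=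
      (hf u).comp ((contMDiffOn_extChartAt_symm x₀).mono inter_subset_left) fun q hq => hq.2
    refine (contMDiffOn_iff_contDiffOn.1 h1).congr fun q hq => ?_
    have hq2 : (extChartAt I x₀).symm q ∈ U := hq.2
    exact congrArg (fun L : F →L[ℝ] W => L u) (dif_pos hq2)
  · intro y hy u
    have h1 := (extChartAt I x₀).left_inv (hU hy)
    have hq2 : (extChartAt I x₀).symm (extChartAt I x₀ y) ∈ U := by rwa [h1]
    simp only [dif_pos hq2]
    change f ((extChartAt I x₀).symm (extChartAt I x₀ y)) u = f y u
    rw [h1]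

/-- The derivative of the chart is the preferred trivialization of `TM`, so this is the coordinate
part of the smooth vector field `ρ(σ)`. -/
theorem contMDiffOn_mfderiv_extChartAt_anchor (A : LieAlgebroid I F E) (σ : Cₛ^∞⟮I; F, E⟯) (x₀ : M) :
    ContMDiffOn I 𝓘(ℝ, V) ∞
      (fun y => (mfderiv I 𝓘(ℝ, V) (extChartAt I x₀) y (A.anchor y (σ y)) : V))
      (extChartAt I x₀).source := by
  have h1 : ContMDiff I I.tangent ∞ fun y => (⟨y, A.anchor y (σ y)⟩ : TangentBundle I M) :=
    A.contMDiff_anchor.comp σ.contMDiff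
  intro y hy
  rw [extChartAt_source] at hy
  have hb : y ∈ (trivializationAt V (TangentSpace I) x₀).baseSet := by simpa using hy
  have h2 := (Trivialization.contMDiffAt_section_iff (e := trivializationAt V (TangentSpace I) x₀)
    (n := ∞) hb).1 (h1 y)
  refine (h2.congr_of_eventuallyEq ?_).contMDiffWithinAt
  filter_upwards [(chartAt H x₀).open_source.mem_nhds hy] with z hz
  have h3 := TangentBundle.continuousLinearMapAt_trivializationAt (I := I) hz
  have h4 : (trivializationAt V (TangentSpace I) x₀).continuousLinearMapAt ℝ z (A.anchor z (σ z)) =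
      (trivializationAt V (TangentSpace I) x₀ ⟨z, A.anchor z (σ z)⟩).2 := by
    rw [Trivialization.continuousLinearMapAt_apply, Trivialization.linearMapAt_apply,
      if_pos (by simpa using hz)]
  exact (congrArg (fun L : TangentSpace I z →L[ℝ] V => L (A.anchor z (σ z))) h3.symm).trans h4

namespace LieAlgebroid

variable (A : LieAlgebroid I F E)

/-- A Lie algebroid in the coordinates of a local frame `K` and of a chart at `x₀`: the anchor `R` and
the structure functions `C`, with the structure equation that makes the anchor a morphism. -/
structure IsCoordinateExpression (x₀ : M) (U : Set M) (K : F →ₗ[ℝ] Cₛ^∞⟮I; F, E⟯)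
    (R : V → F →L[ℝ] V) (C : V → F →L[ℝ] F →L[ℝ] F) : Prop where
  isOpen : IsOpen U
  mem : x₀ ∈ U
  subset_baseSet : U ⊆ (trivializationAt F E x₀).baseSet
  subset_source : U ⊆ (extChartAt I x₀).source
  frame : ∀ y ∈ U, ∀ u, (trivializationAt F E x₀ ⟨y, K u y⟩).2 = u
  anchor_frame : ∀ y ∈ U, ∀ u,
    mfderiv I 𝓘(ℝ, V) (extChartAt I x₀) y (A.anchor y (K u y)) = R (extChartAt I x₀ y) u
  bracket_frame : ∀ y ∈ U, ∀ u v, A.bracket (K u) (K v) y = K (C (extChartAt I x₀ y) u v) y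
  contDiffOn_anchor :
    ContDiffOn ℝ ∞ R ((extChartAt I x₀).target ∩ (extChartAt I x₀).symm ⁻¹' U)
  contDiffOn_structure :
    ContDiffOn ℝ ∞ C ((extChartAt I x₀).target ∩ (extChartAt I x₀).symm ⁻¹' U)

variable {A} {x₀ : M} {U : Set M} {K : F →ₗ[ℝ] Cₛ^∞⟮I; F, E⟯} {R : V → F →L[ℝ] V}
  {C : V → F →L[ℝ] F →L[ℝ] F}

namespace IsCoordinateExpression

theorem eq_frame (h : A.IsCoordinateExpression x₀ U K R C) {y : M} (hy : y ∈ U) (v : E y) :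
    v = K (trivializationAt F E x₀ ⟨y, v⟩).2 y :=
  eq_of_trivialization_eq (h.subset_baseSet hy) (h.frame y hy _).symm

theorem mfderiv_anchor (h : A.IsCoordinateExpression x₀ U K R C) {y : M} (hy : y ∈ U) (v : E y) :
    mfderiv I 𝓘(ℝ, V) (extChartAt I x₀) y (A.anchor y v) =
      R (extChartAt I x₀ y) (trivializationAt F E x₀ ⟨y, v⟩).2 := by
  rw [← h.anchor_frame y hy, ← h.eq_frame hy]

theorem dirDeriv_anchor (h : A.IsCoordinateExpression x₀ U K R C) {y : M} (hy : y ∈ U) (u : F)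
    {g : V → ℝ} (hg : DifferentiableAt ℝ g (extChartAt I x₀ y)) :
    dirDeriv (A.anchor y (K u y)) (fun z => g (extChartAt I x₀ z)) =
      fderiv ℝ g (extChartAt I x₀ y) (R (extChartAt I x₀ y) u) := by
  rw [dirDeriv_comp_extChartAt (h.subset_source hy) _ hg, h.anchor_frame y hy]

theorem structure_swap (h : A.IsCoordinateExpression x₀ U K R C) {y : M} (hy : y ∈ U) (u v : F) :
    C (extChartAt I x₀ y) u v = -C (extChartAt I x₀ y) v u := by
  have h1 := A.bracket_neg_swap_apply (K u) (K v) y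
  rw [h.bracket_frame y hy, h.bracket_frame y hy] at h1
  have h2 : K (C (extChartAt I x₀ y) u v) y = K (-C (extChartAt I x₀ y) v u) y := by
    rw [h1, map_neg]
    rfl
  rw [← h.frame y hy (C (extChartAt I x₀ y) u v), h2, h.frame y hy]

theorem differentiableAt_anchor (h : A.IsCoordinateExpression x₀ U K R C) {q : V}
    (hq : q ∈ (extChartAt I x₀).target ∩ (extChartAt I x₀).symm ⁻¹' U) :
    DifferentiableAt ℝ R q :=
  (h.contDiffOn_anchor.contDiffAt ((isOpen_extChartAt_image x₀ h.isOpen).mem_nhds hq)).differentiableAt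
    (by simp)

theorem hasFDerivAt_clm_apply_const {W : Type*} [NormedAddCommGroup W] [NormedSpace ℝ W]
    {Φ : V → F →L[ℝ] W} {q : V} (hΦ : DifferentiableAt ℝ Φ q) (v : F) :
    HasFDerivAt (fun w => Φ w v) ((ContinuousLinearMap.apply ℝ W v).comp (fderiv ℝ Φ q)) q :=
  (ContinuousLinearMap.apply ℝ W v).hasFDerivAt.comp q hΦ.hasFDerivAt

/-- The structure equation saying that the anchor is a morphism, in coordinates. -/
theorem anchor_morphism (h : A.IsCoordinateExpression x₀ U K R C) {q : V}
    (hq : q ∈ (extChartAt I x₀).target ∩ (extChartAt I x₀).symm ⁻¹' U) (u v : F) :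
    fderiv ℝ R q (R q u) v - fderiv ℝ R q (R q v) u = R q (C q u v) := by
  -- `dirDeriv_anchor_bracket` needs a section that is nonzero at the point, which exists only if
  -- `F` is nontrivial.
  rcases subsingleton_or_nontrivial F with hF | hF
  · rw [Subsingleton.elim u 0, Subsingleton.elim v 0]
    simp
  obtain ⟨w, hw⟩ := exists_ne (0 : F)
  set y := (extChartAt I x₀).symm q with hy
  have hyU : y ∈ U := hq.2
  have hyq : extChartAt I x₀ y = q := (extChartAt I x₀).right_inv hq.1
  have hKw : K w y ≠ 0 := by
    intro h0
    have h1 := h.frame y hyU w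
    rw [h0, trivializationAt_snd_eq_linearMapAt (h.subset_baseSet hyU), map_zero] at h1
    exact hw h1.symm
  -- It suffices to apply the morphism property to the coordinate functions `ℓ ∘ chart`, each
  -- replaced by a global function with the same germ at `y`.
  refine (SeparatingDual.eq_iff_forall_dual_eq (R := ℝ)).2 fun ℓ => ?_
  obtain ⟨f, hf, hfe⟩ := exists_smoothFunction_eventuallyEq (g := fun z => ℓ (extChartAt I x₀ z))
    h.isOpen (((ℓ.contMDiff (n := ∞)).comp_contMDiffOn (contMDiffOn_extChartAt (x := x₀))).mono
      (by rw [← extChartAt_source I]; exact h.subset_source)) hyU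
  let fs : C^∞⟮I, M; ℝ⟯ := ⟨f, hf⟩
  replace hfe : fs =ᶠ[𝓝 y] fun z => ℓ (extChartAt I x₀ z) := hfe
  have hmor := A.dirDeriv_anchor_bracket fs (K u) (K v) (K w) y hKw
  have hin : ∀ v : F, (fun z => dirDeriv (A.anchor z (K v z)) fs) =ᶠ[𝓝 y]
      fun z => ℓ (R (extChartAt I x₀ z) v) := by
    intro v
    filter_upwards [hfe.eventuallyEq_nhds, h.isOpen.mem_nhds hyU] with z hz hzU
    refine (dirDeriv_congr _ hz).trans ?_
    rw [h.dirDeriv_anchor hzU v ℓ.differentiableAt, ContinuousLinearMap.fderiv]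
  have hout : ∀ u v : F, dirDeriv (A.anchor y (K u y)) (fun z => dirDeriv (A.anchor z (K v z)) fs) =
      ℓ (fderiv ℝ R q (R q u) v) := by
    intro u v
    have hd := (ℓ.hasFDerivAt.comp q (hasFDerivAt_clm_apply_const (h.differentiableAt_anchor hq) v))
    rw [dirDeriv_congr _ (hin v)]
    rw [← hyq] at hd
    rw [h.dirDeriv_anchor (g := fun w => ℓ (R w v)) hyU u hd.differentiableAt]
    refine (congrArg (fun L : V →L[ℝ] ℝ => L (R (extChartAt I x₀ y) u)) hd.fderiv).trans ?_
    rw [hyq]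
    rfl
  rw [hout, hout, h.bracket_frame y hyU, dirDeriv_congr _ hfe,
    h.dirDeriv_anchor hyU _ ℓ.differentiableAt, ContinuousLinearMap.fderiv, hyq] at hmor
  rw [hmor, map_sub]

/-- The differential of a section of the dual in coordinates. -/
theorem d_frame (h : A.IsCoordinateExpression x₀ U K R C) (θ : DualSection I F E)
    {Θ : V → F →L[ℝ] ℝ} (hΘ : ∀ y ∈ U, ∀ u, Θ (extChartAt I x₀ y) u = θ.toFun y (K u y)) {y : M}
    (hy : y ∈ U) (hΘd : DifferentiableAt ℝ Θ (extChartAt I x₀ y)) (u v : F) :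
    A.d θ (K u) (K v) y =
      fderiv ℝ Θ (extChartAt I x₀ y) (R (extChartAt I x₀ y) u) v -
      fderiv ℝ Θ (extChartAt I x₀ y) (R (extChartAt I x₀ y) v) u -
      Θ (extChartAt I x₀ y) (C (extChartAt I x₀ y) u v) := by
  have key : ∀ u v : F, dirDeriv (A.anchor y (K u y)) (fun z => θ.toFun z (K v z)) =
      fderiv ℝ Θ (extChartAt I x₀ y) (R (extChartAt I x₀ y) u) v := by
    intro u v
    have hd := hasFDerivAt_clm_apply_const hΘd v
    have he : (fun z => θ.toFun z (K v z)) =ᶠ[𝓝 y] fun z => Θ (extChartAt I x₀ z) v := by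
      filter_upwards [h.isOpen.mem_nhds hy] with z hz
      exact (hΘ z hz v).symm
    rw [dirDeriv_congr _ he, h.dirDeriv_anchor (g := fun w => Θ w v) hy u hd.differentiableAt,
      hd.fderiv]
    rfl
  unfold d
  rw [key, key, h.bracket_frame y hy, hΘ y hy]

end IsCoordinateExpression

variable (A) in
theorem exists_coordinateExpression (x₀ : M) : ∃ (U : Set M) (K : F →ₗ[ℝ] Cₛ^∞⟮I; F, E⟯)
    (R : V → F →L[ℝ] V) (C : V → F →L[ℝ] F →L[ℝ] F), A.IsCoordinateExpression x₀ U K R C := by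
  obtain ⟨K, U, hU, hxU, hUb, hUs, hK⟩ := exists_localFrame (I := I) (F := F) (E := E) x₀
  have hadd : ∀ (s s' : Cₛ^∞⟮I; F, E⟯) (y : M), (s + s') y = s y + s' y := fun _ _ _ => rfl
  have hsmul : ∀ (c : ℝ) (s : Cₛ^∞⟮I; F, E⟯) (y : M), (c • s) y = c • s y := fun _ _ _ => rfl
  obtain ⟨R, hRs, hR⟩ := exists_coordinate_family (F := F) (W := V) hUs
    (fun y u => mfderiv I 𝓘(ℝ, V) (extChartAt I x₀) y (A.anchor y (K u y)))
    (fun y _ => ⟨fun u v => by rw [map_add, hadd, map_add]; exact map_add _ _ _,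
      fun c u => by rw [map_smul, hsmul, map_smul]; exact map_smul _ _ _⟩)
    (fun u => (contMDiffOn_mfderiv_extChartAt_anchor A (K u) x₀).mono hUs)
  have hC1 : ∀ u : F, ∃ Φ : V → F →L[ℝ] F,
      ContDiffOn ℝ ∞ Φ ((extChartAt I x₀).target ∩ (extChartAt I x₀).symm ⁻¹' U) ∧
      ∀ y ∈ U, ∀ v, Φ (extChartAt I x₀ y) v =
        (trivializationAt F E x₀ ⟨y, A.bracket (K u) (K v) y⟩).2 := fun u =>
    exists_coordinate_family (F := F) (W := F) hUs
      (fun y v => (trivializationAt F E x₀ ⟨y, A.bracket (K u) (K v) y⟩).2)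
      (fun y hy => ⟨fun v w => by
          simp only [trivializationAt_snd_eq_linearMapAt (hUb hy)]
          rw [map_add, map_add, hadd, map_add],
        fun c v => by
          simp only [trivializationAt_snd_eq_linearMapAt (hUb hy)]
          rw [map_smul, map_smul, hsmul, map_smul]⟩)
      (fun v => (contMDiffOn_trivializationAt_section _ x₀).mono hUb)
  choose Φ hΦs hΦ using hC1
  -- Smoothness of the bilinear family is obtained by currying: the linear family is first built for
  -- each fixed `u`, then treated as a family in `u` with values in `F →L[ℝ] F`.
  obtain ⟨C, hCs, hC⟩ := exists_coordinate_family (F := F) (W := F →L[ℝ] F) hUs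
    (fun y u => Φ u (extChartAt I x₀ y))
    (fun y hy => ⟨fun u v => by
        ext w
        rw [add_apply]
        simp only [hΦ _ y hy, trivializationAt_snd_eq_linearMapAt (hUb hy)]
        rw [map_add, map_add, LinearMap.add_apply, hadd, map_add],
      fun c u => by
        ext w
        rw [smul_apply]
        simp only [hΦ _ y hy, trivializationAt_snd_eq_linearMapAt (hUb hy)]
        rw [map_smul, map_smul, LinearMap.smul_apply, hsmul, map_smul]⟩)
    (fun u => (contMDiffOn_iff_contDiffOn.2 (hΦs u)).comp
      ((contMDiffOn_extChartAt (x := x₀)).mono (by rw [← extChartAt_source I]; exact hUs))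
      fun y hy => mapsTo_extChartAt_image hUs hy)
  exact ⟨U, K, R, C, hU, hxU, hUb, hUs, hK, fun y hy u => (hR y hy u).symm, fun y hy u v =>
    eq_of_trivialization_eq (hUb hy) (by rw [hK y hy, hC y hy, hΦ u y hy]), hRs, hCs⟩

end LieAlgebroid

end AlgebroidCoordinates

/-! ### Existence of morphisms on the manifold. -/

section AlgebroidMorphism

variable {V H M : Type*} [NormedAddCommGroup V] [NormedSpace ℝ V] [TopologicalSpace H]
  {I : ModelWithCorners ℝ V H} [TopologicalSpace M] [ChartedSpace H M] [IsManifold I ∞ M]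
  {F : Type*} [NormedAddCommGroup F] [NormedSpace ℝ F] {E : M → Type*}
  [∀ x, AddCommGroup (E x)] [∀ x, Module ℝ (E x)] [∀ x, TopologicalSpace (E x)]
  [TopologicalSpace (TotalSpace F E)] [FiberBundle F E] [VectorBundle ℝ F E]
  [FiniteDimensional ℝ V] [FiniteDimensional ℝ F] [T2Space M] [ContMDiffVectorBundle ∞ F E I]
  [I.Boundaryless]

theorem contDiffOn_trivializationAt_comp {P : Type*} [NormedAddCommGroup P] [NormedSpace ℝ P]
    {c : P → TotalSpace F E} {J : Set P} (hc : ContMDiffOn 𝓘(ℝ, P) (I.prod 𝓘(ℝ, F)) ∞ c J) {x₀ : M}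
    (hJ : ∀ t ∈ J, (c t).proj ∈ (trivializationAt F E x₀).baseSet) :
    ContDiffOn ℝ ∞ (fun t => (trivializationAt F E x₀ (c t)).2) J := by
  rw [← contMDiffOn_iff_contDiffOn]
  exact ((trivializationAt F E x₀).contMDiffOn_iff (IM := 𝓘(ℝ, P))
    (fun t ht => (Trivialization.mem_source _).2 (hJ t ht))).1 hc |>.2

theorem contDiffOn_extChartAt_comp {P : Type*} [NormedAddCommGroup P] [NormedSpace ℝ P]
    {c : P → M} {J : Set P} (hc : ContMDiffOn 𝓘(ℝ, P) I ∞ c J) {x₀ : M}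
    (hJ : ∀ t ∈ J, c t ∈ (extChartAt I x₀).source) :
    ContDiffOn ℝ ∞ (fun t => extChartAt I x₀ (c t)) J := by
  rw [← contMDiffOn_iff_contDiffOn]
  exact (contMDiffOn_extChartAt (x := x₀)).comp hc fun t ht => by
    simpa using hJ t ht

theorem contMDiffOn_proj_comp {P : Type*} [NormedAddCommGroup P] [NormedSpace ℝ P]
    {c : P → TotalSpace F E} {J : Set P} (hc : ContMDiffOn 𝓘(ℝ, P) (I.prod 𝓘(ℝ, F)) ∞ c J) :
    ContMDiffOn 𝓘(ℝ, P) I ∞ (fun t => (c t).proj) J :=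
  (contMDiff_proj E).comp_contMDiffOn hc

/-- The velocity of a map into a manifold, seen in a chart. -/
theorem mfderiv_extChartAt_mfderiv {P : Type*} [NormedAddCommGroup P] [NormedSpace ℝ P]
    {c : P → M} {p : P} (hc : MDifferentiableAt 𝓘(ℝ, P) I c p) {x₀ : M}
    (hp : c p ∈ (extChartAt I x₀).source) (v : P) :
    mfderiv I 𝓘(ℝ, V) (extChartAt I x₀) (c p) (mfderiv 𝓘(ℝ, P) I c p v) =
      fderiv ℝ (fun q => extChartAt I x₀ (c q)) p v := by
  have h := mfderiv_comp (I := 𝓘(ℝ, P)) (I' := I) (I'' := 𝓘(ℝ, V)) p (g := extChartAt I x₀) (f := c)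
    (mdifferentiableAt_extChartAt (by rwa [extChartAt_source] at hp)) hc
  rw [mfderiv_eq_fderiv] at h
  exact (congrArg (fun L : P →L[ℝ] V => L v) h).symm

theorem mfderiv_extChartAt_injective {x₀ y : M} (hy : y ∈ (extChartAt I x₀).source) :
    Function.Injective (mfderiv I 𝓘(ℝ, V) (extChartAt I x₀) y) :=
  (isInvertible_mfderiv_extChartAt hy).injective

theorem fderiv_clm_apply_along {P W : Type*} [NormedAddCommGroup P] [NormedSpace ℝ P]
    [NormedAddCommGroup W] [NormedSpace ℝ W] {Θ : V → F →L[ℝ] W} {φ : P → V} {c : P → F} {p : P}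
    (hΘ : DifferentiableAt ℝ Θ (φ p)) (hφ : DifferentiableAt ℝ φ p) (hc : DifferentiableAt ℝ c p)
    (v : P) : fderiv ℝ (fun q => Θ (φ q) (c q)) p v =
      fderiv ℝ Θ (φ p) (fderiv ℝ φ p v) (c p) + Θ (φ p) (fderiv ℝ c p v) := by
  have h1 : HasFDerivAt (fun q => Θ (φ q)) ((fderiv ℝ Θ (φ p)).comp (fderiv ℝ φ p)) p :=
    hΘ.hasFDerivAt.comp p hφ.hasFDerivAt
  rw [(h1.clm_apply hc.hasFDerivAt).fderiv]
  simp [add_comm]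

namespace LieAlgebroid

variable {A : LieAlgebroid I F E}

/-- Through every section along an admissible curve there is a local morphism of Lie algebroids
`α dt + β ds`. -/
theorem exists_isMorphismOn {J : Set ℝ} (hJ : IsOpen J) {a σ : ℝ → TotalSpace F E}
    (ha : A.IsAdmissibleOn a J) (hσ : ContMDiffOn 𝓘(ℝ, ℝ) (I.prod 𝓘(ℝ, F)) ∞ σ J)
    (hσa : ∀ t ∈ J, (σ t).proj = (a t).proj) {t₀ : ℝ} (ht₀ : t₀ ∈ J) :
    ∃ (W : Set (ℝ × ℝ)) (α β : ℝ × ℝ → TotalSpace F E), IsOpen W ∧ ((0 : ℝ), t₀) ∈ W ∧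
      A.IsMorphismOn α β W ∧ ∀ t, ((0 : ℝ), t) ∈ W → α (0, t) = a t ∧ β (0, t) = σ t := by
  set x₀ : M := (a t₀).proj with hx₀
  obtain ⟨U, K, R, C, h⟩ := A.exists_coordinateExpression x₀
  set e := trivializationAt F E x₀ with he
  have hOo := isOpen_extChartAt_image (I := I) x₀ h.isOpen
  set O := (extChartAt I x₀).target ∩ (extChartAt I x₀).symm ⁻¹' U with hO
  have haproj : ContMDiffOn 𝓘(ℝ, ℝ) I ∞ (fun t => (a t).proj) J := contMDiffOn_proj_comp ha.1
  set J' : Set ℝ := J ∩ (fun t => (a t).proj) ⁻¹' U with hJ'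
  have hJ'o : IsOpen J' := haproj.continuousOn.isOpen_inter_preimage hJ h.isOpen
  have hJJ : J' ⊆ J := inter_subset_left
  have hJU : ∀ t ∈ J', (a t).proj ∈ U := fun t ht => ht.2
  have hγs : ContDiffOn ℝ ∞ (fun t => extChartAt I x₀ (a t).proj) J' :=
    contDiffOn_extChartAt_comp (haproj.mono hJJ) fun t ht => h.subset_source (hJU t ht)
  have has : ContDiffOn ℝ ∞ (fun t => (e (a t)).2) J' :=
    contDiffOn_trivializationAt_comp (ha.1.mono hJJ) fun t ht => h.subset_baseSet (hJU t ht)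
  have hσs : ContDiffOn ℝ ∞ (fun t => (e (σ t)).2) J' :=
    contDiffOn_trivializationAt_comp (hσ.mono hJJ) fun t ht => by
      rw [hσa t (hJJ ht)]
      exact h.subset_baseSet (hJU t ht)
  have hadm : ∀ t ∈ J', deriv (fun t => extChartAt I x₀ (a t).proj) t =
      R (extChartAt I x₀ (a t).proj) (e (a t)).2 := by
    intro t ht
    have h1 := mfderiv_extChartAt_mfderiv (c := fun t => (a t).proj) (x₀ := x₀)
      ((haproj.contMDiffAt (hJ.mem_nhds (hJJ ht))).mdifferentiableAt (by simp))
      (h.subset_source (hJU t ht)) (1 : ℝ)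
    rw [ha.2 t (hJJ ht), h.mfderiv_anchor (hJU t ht)] at h1
    rw [← fderiv_apply_one_eq_deriv]
    exact h1.symm
  have ht₀' : t₀ ∈ J' := ⟨ht₀, h.mem⟩
  obtain ⟨W, φ, α, hW, h0W, hφ, hα, hinit, hmain⟩ :=
    exists_coordinate_morphism hOo h.contDiffOn_anchor h.contDiffOn_structure
      (fun q hq u v => h.anchor_morphism hq u v) hJ'o hγs has hσs hadm ht₀'
      (mapsTo_extChartAt_image h.subset_source h.mem)
  let y : ℝ × ℝ → M := fun p => (extChartAt I x₀).symm (φ p)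
  let α' : ℝ × ℝ → TotalSpace F E := fun p => e.toOpenPartialHomeomorph.symm (y p, α p)
  -- `β'` has the fibre coordinate of `σ` at `p.2` for every `s`; only its base point moves with
  -- `s`.
  let β' : ℝ × ℝ → TotalSpace F E := fun p => e.toOpenPartialHomeomorph.symm (y p, (e (σ p.2)).2)
  have hyU : ∀ p ∈ W, y p ∈ U := fun p hp => (hmain p hp).2.1.2
  have hyb : ∀ p ∈ W, y p ∈ e.baseSet := fun p hp => h.subset_baseSet (hyU p hp)
  have hyφ : ∀ p ∈ W, extChartAt I x₀ (y p) = φ p := fun p hp =>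
    (extChartAt I x₀).right_inv (hmain p hp).2.1.1
  have hys : ContMDiffOn 𝓘(ℝ, ℝ × ℝ) I ∞ y W :=
    (contMDiffOn_extChartAt_symm x₀).comp (contMDiffOn_iff_contDiffOn.2 hφ)
      fun p hp => (hmain p hp).2.1.1
  have hσW : ContDiffOn ℝ ∞ (fun p : ℝ × ℝ => (e (σ p.2)).2) W :=
    hσs.comp contDiffOn_snd fun p hp => (hmain p hp).1
  have hlift : ∀ {c : ℝ × ℝ → F}, ContDiffOn ℝ ∞ c W → ContMDiffOn 𝓘(ℝ, ℝ × ℝ) (I.prod 𝓘(ℝ, F)) ∞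
      (fun p => e.toOpenPartialHomeomorph.symm (y p, c p)) W := fun hc =>
    (e.contMDiffOn_symm (n := ∞)).comp (hys.prodMk (contMDiffOn_iff_contDiffOn.2 hc))
      fun p hp => e.mem_target.2 (hyb p hp)
  have hproj : ∀ p ∈ W, ∀ v : F, (e.toOpenPartialHomeomorph.symm (y p, v)).proj = y p :=
    fun p hp v => e.proj_symm_apply' (hyb p hp)
  have hsnd : ∀ p ∈ W, ∀ v : F, (e (e.toOpenPartialHomeomorph.symm (y p, v))).2 = v :=
    fun p hp v => by rw [e.apply_symm_apply' (hyb p hp)]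
  have hrec : ∀ {z : TotalSpace F E} {p : ℝ × ℝ} {v : F}, p ∈ W → z.proj = y p → (e z).2 = v →
      e.toOpenPartialHomeomorph.symm (y p, v) = z := by
    intro z p v hp hz hv
    have hz' : z ∈ e.source := (Trivialization.mem_source _).2 (by rw [hz]; exact hyb p hp)
    rw [← hv, ← hz]
    exact (congrArg _ (e.mk_proj_snd hz')).trans (e.toOpenPartialHomeomorph.left_inv hz')
  have hφd : ∀ p ∈ W, DifferentiableAt ℝ φ p := fun p hp =>
    (hφ.contDiffAt (hW.mem_nhds hp)).differentiableAt (by simp)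
  have hαd : ∀ p ∈ W, DifferentiableAt ℝ α p := fun p hp =>
    (hα.contDiffAt (hW.mem_nhds hp)).differentiableAt (by simp)
  have hσd : ∀ p ∈ W, DifferentiableAt ℝ (fun p : ℝ × ℝ => (e (σ p.2)).2) p := fun p hp =>
    (hσW.contDiffAt (hW.mem_nhds hp)).differentiableAt (by simp)
  have hσ01 : ∀ p ∈ W, fderiv ℝ (fun p : ℝ × ℝ => (e (σ p.2)).2) p (0, 1) =
      deriv (fun t => (e (σ t)).2) p.2 := by
    rintro ⟨s, t⟩ hp
    exact ((hasDerivAt_snd_slice (hσd _ hp)).deriv).symm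
  -- the velocity of the base map is determined by its coordinate expression
  have hvel : ∀ p ∈ W, ∀ (z : TotalSpace F E) (v : ℝ × ℝ), z.proj = y p →
      fderiv ℝ φ p v = R (φ p) (e z).2 → ∀ c : ℝ × ℝ → TotalSpace F E,
      (∀ q ∈ W, (c q).proj = y q) →
      (mfderiv 𝓘(ℝ, ℝ × ℝ) I (fun q => (c q).proj) p v : V) = A.anchor z.proj z.snd := by
    intro p hp z v hz hv c hc
    have hce : (fun q => (c q).proj) =ᶠ[𝓝 p] y := by
      filter_upwards [hW.mem_nhds hp] with q hq using hc q hq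
    have hcd : MDifferentiableAt 𝓘(ℝ, ℝ × ℝ) I (fun q => (c q).proj) p :=
      ((hys.contMDiffAt (hW.mem_nhds hp)).congr_of_eventuallyEq hce).mdifferentiableAt (by simp)
    have hcp : (c p).proj = z.proj := (hc p hp).trans hz.symm
    have hsrc : (c p).proj ∈ (extChartAt I x₀).source := by
      rw [hc p hp]; exact h.subset_source (hyU p hp)
    have h1 := mfderiv_extChartAt_mfderiv (x₀ := x₀) hcd hsrc v
    have h2 : (fun q => extChartAt I x₀ (c q).proj) =ᶠ[𝓝 p] φ := by
      filter_upwards [hW.mem_nhds hp] with q hq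
      rw [hc q hq, hyφ q hq]
    rw [h2.fderiv_eq, hv] at h1
    have h3 := h.mfderiv_anchor (y := z.proj) (by rw [hz]; exact hyU p hp) z.snd
    have h4 : extChartAt I x₀ z.proj = φ p := by rw [hz, hyφ p hp]
    rw [h4] at h3
    have h5 := h1.trans h3.symm
    generalize mfderiv 𝓘(ℝ, ℝ × ℝ) I (fun q => (c q).proj) p v = w at h5
    change V at w
    -- The two base points are only propositionally equal, so the tangent vectors are compared as
    -- elements of `V` before injectivity of the chart derivative is used.
    have hgen : ∀ x x' : M, x = x' → x ∈ (extChartAt I x₀).source → ∀ w w' : V,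
        (mfderiv I 𝓘(ℝ, V) (extChartAt I x₀) x (w : TangentSpace I x) : V) =
          mfderiv I 𝓘(ℝ, V) (extChartAt I x₀) x' (w' : TangentSpace I x') → w = w' := by
      rintro x _ rfl hx w w' hw
      exact mfderiv_extChartAt_injective hx hw
    exact hgen _ _ hcp hsrc w _ h5
  refine ⟨W, α', β', hW, h0W, ⟨hlift hα, hlift hσW, ?_, ?_, ?_, ?_⟩, ?_⟩
  · intro p hp
    exact (hproj p hp _).trans (hproj p hp _).symm
  · intro p hp
    refine hvel p hp (α' p) (0, 1) (hproj p hp _) ?_ α' fun q hq => hproj q hq _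
    rw [hsnd p hp]
    exact (hmain p hp).2.2.1
  · intro p hp
    refine hvel p hp (β' p) (1, 0) (hproj p hp _) ?_ β' fun q hq => hproj q hq _
    rw [hsnd p hp]
    exact (hmain p hp).2.2.2.1
  · intro p hp θ η ζ hη hζ
    obtain ⟨Θ, hΘs, hΘ⟩ := exists_coordinate_family (F := F) (W := ℝ) h.subset_source
      (fun z u => θ.toFun z (K u z))
      (fun z _ => ⟨fun u v => by rw [map_add]; exact map_add (θ.toFun z) _ _,
        fun c u => by rw [map_smul]; exact map_smul (θ.toFun z) _ _⟩)
      (fun u => (θ.contMDiff_apply (K u)).contMDiffOn)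
    have hpO := (hmain p hp).2.1
    have hΘd : DifferentiableAt ℝ Θ (φ p) :=
      (hΘs.contDiffAt (hOo.mem_nhds hpO)).differentiableAt (by simp)
    have hval : ∀ z : TotalSpace F E, z.proj ∈ U →
        θ.toFun z.proj z.snd = Θ (extChartAt I x₀ z.proj) (e z).2 := by
      intro z hz
      rw [hΘ z.proj hz]
      exact congrArg (θ.toFun z.proj) (h.eq_frame hz z.snd)
    have hev : ∀ {c : ℝ × ℝ → F}, (fun q => θ.toFun (e.toOpenPartialHomeomorph.symm (y q, c q)).proj
        (e.toOpenPartialHomeomorph.symm (y q, c q)).snd) =ᶠ[𝓝 p] fun q => Θ (φ q) (c q) := by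
      intro c
      filter_upwards [hW.mem_nhds hp] with q hq
      rw [hval _ (by rw [hproj q hq]; exact hyU q hq), hproj q hq, hsnd q hq, hyφ q hq]
    -- The extensions `η` and `ζ` are arbitrary. Since they agree at `y p` with frame sections,
    -- `d_congr` permits the coordinate formula `d_frame`.
    have hu : η (y p) = K (e (σ p.2)).2 (y p) := by
      apply eq_of_trivialization_eq (hyb p hp)
      rw [h.frame _ (hyU p hp)]
      have h1 : (⟨(β' p).proj, η (β' p).proj⟩ : TotalSpace F E) = β' p := by rw [hη]
      rw [← he, ← hsnd p hp (e (σ p.2)).2]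
      rw [hproj p hp] at h1
      rw [h1]
    have hv : ζ (y p) = K (α p) (y p) := by
      apply eq_of_trivialization_eq (hyb p hp)
      rw [h.frame _ (hyU p hp)]
      have h1 : (⟨(α' p).proj, ζ (α' p).proj⟩ : TotalSpace F E) = α' p := by rw [hζ]
      rw [← he, ← hsnd p hp (α p)]
      rw [hproj p hp] at h1
      rw [h1]
    have e1 := fderiv_clm_apply_along hΘd (hφd p hp) (hαd p hp) (1, 0)
    have e2 := fderiv_clm_apply_along hΘd (hφd p hp) (hσd p hp) (0, 1)
    have e3 := h.d_frame θ hΘ (hyU p hp) (by rw [hyφ p hp]; exact hΘd) (e (σ p.2)).2 (α p)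
    -- `dθ(β, α)` contains `-C(σ, α)`, while the equation for `∂α/∂s` contains `C(α, σ)`.
    have e4 := h.structure_swap (hyU p hp) (e (σ p.2)).2 (α p)
    rw [hyφ p hp] at e3 e4
    have e5 : (α' p).proj = y p := hproj p hp _
    rw [e5, A.d_congr θ hu hv, e3, hev.fderiv_eq, hev.fderiv_eq, e1, e2, hσ01 p hp, e4,
      (hmain p hp).2.2.1, (hmain p hp).2.2.2.1, (hmain p hp).2.2.2.2]
    simp only [map_add, map_neg]
    ring
  · intro t ht
    obtain ⟨i1, i2⟩ := hinit t ht
    have htJ : t ∈ J' := (hmain _ ht).1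
    have hyt : y (0, t) = (a t).proj := by
      change (extChartAt I x₀).symm (φ (0, t)) = _
      rw [i1]
      exact (extChartAt I x₀).left_inv (h.subset_source (hJU t htJ))
    refine ⟨hrec ht hyt.symm i2.symm, hrec ht ((hσa t (hJJ htJ)).trans hyt.symm) rfl⟩

end LieAlgebroid

end AlgebroidMorphism

/-! ### Jets and velocities of two-parameter families. -/

section JetCurves

variable {V H : Type*} [NormedAddCommGroup V] [NormedSpace ℝ V] [TopologicalSpace H]
  {I : ModelWithCorners ℝ V H} [I.Boundaryless]
  {N : Type*} [TopologicalSpace N] [ChartedSpace H N] [IsManifold I ∞ N]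

theorem velocity_congr {k : ℕ} {c c' : ℝ → N} (h : c =ᶠ[𝓝 0] c') :
    velocity I k c = velocity I k c' := by
  have key : ∀ x : N, JetCalc.derivs k (extChartAt I x ∘ c) = JetCalc.derivs k (extChartAt I x ∘ c') :=
    fun x => JetCalc.derivs_congr (h.fun_comp _)
  unfold velocity
  rw [key, h.self_of_nhds]

theorem continuous_slice_fst (t : ℝ) : Continuous fun s : ℝ => (s, t) := by fun_prop

theorem continuous_slice_snd (s : ℝ) : Continuous fun t : ℝ => (s, t) := by fun_prop

theorem contMDiffAt_slice_fst {γ : ℝ × ℝ → N} {s t : ℝ}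
    (h : ContMDiffAt 𝓘(ℝ, ℝ × ℝ) I ∞ γ (s, t)) :
    ContMDiffAt 𝓘(ℝ, ℝ) I ∞ (fun s => γ (s, t)) s :=
  ContMDiffAt.comp (f := fun s : ℝ => (s, t)) s h
    ((by fun_prop : ContDiff ℝ ∞ fun s : ℝ => (s, t)).contMDiff.contMDiffAt)

theorem contMDiffAt_slice_snd {γ : ℝ × ℝ → N} {s t : ℝ}
    (h : ContMDiffAt 𝓘(ℝ, ℝ × ℝ) I ∞ γ (s, t)) :
    ContMDiffAt 𝓘(ℝ, ℝ) I ∞ (fun t => γ (s, t)) t :=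
  ContMDiffAt.comp (f := fun t : ℝ => (s, t)) t h
    ((by fun_prop : ContDiff ℝ ∞ fun t : ℝ => (s, t)).contMDiff.contMDiffAt)

/-- The velocities at `s = 0` of a two-parameter family depend smoothly on the other parameter. -/
theorem contMDiffAt_tangentVec_slice {γ : ℝ × ℝ → N} {W : Set (ℝ × ℝ)} (hW : IsOpen W)
    (hγ : ContMDiffOn 𝓘(ℝ, ℝ × ℝ) I ∞ γ W) {t₀ : ℝ} (h0 : ((0 : ℝ), t₀) ∈ W) :
    ContMDiffAt 𝓘(ℝ, ℝ) I.tangent ∞ (fun t => tangentVec I fun s => γ (s, t)) t₀ := by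
  set x : N := γ (0, t₀) with hx
  set U : Set (ℝ × ℝ) := W ∩ γ ⁻¹' (chartAt H x).source with hUdef
  have hU : IsOpen U := hγ.continuousOn.isOpen_inter_preimage hW (chartAt H x).open_source
  have h0U : ((0 : ℝ), t₀) ∈ U := ⟨h0, mem_chart_source H x⟩
  have hγU : ∀ p ∈ U, ContMDiffAt 𝓘(ℝ, ℝ × ℝ) I ∞ γ p := fun p hp =>
    hγ.contMDiffAt (hW.mem_nhds hp.1)
  have hgs : ContDiffOn ℝ ∞ (fun p => extChartAt I x (γ p)) U := by
    rw [← contMDiffOn_iff_contDiffOn]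
    exact (contMDiffOn_extChartAt (n := ∞) (x := x)).comp (hγ.mono inter_subset_left)
      fun p hp => hp.2
  rw [Bundle.contMDiffAt_totalSpace]
  refine ⟨contMDiffAt_slice_snd (hγU _ h0U), ?_⟩
  -- `contDiffOn_iteratedDeriv_snd` differentiates in the second variable, whereas the velocity is
  -- taken in `s`, the first one.
  have hsw : ContDiff ℝ ∞ (fun q : ℝ × ℝ => (q.2, q.1)) := by fun_prop
  have h1 := JetCalc.contDiffOn_iteratedDeriv_snd (fun q : ℝ × ℝ => extChartAt I x (γ (q.2, q.1)))
    (hU.preimage hsw.continuous) (hgs.comp hsw.contDiffOn fun _ h => h) 1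
  have h2 := h1.contDiffAt (x := (t₀, (0 : ℝ))) ((hU.preimage hsw.continuous).mem_nhds h0U)
  have h3 : ContDiffAt ℝ ∞ (fun t : ℝ => (t, (0 : ℝ))) t₀ := by fun_prop
  have h4 := ContDiffAt.comp (f := fun t : ℝ => (t, (0 : ℝ))) t₀ h2 h3
  refine h4.contMDiffAt.congr_of_eventuallyEq ?_
  filter_upwards [(continuous_slice_snd 0).continuousAt.eventually (hU.mem_nhds h0U)] with t ht
  refine (JetCalc.tangentVec_coord (contMDiffAt_slice_fst (hγU _ ht)) ht.2).trans ?_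
  simp only [Function.comp_def, iteratedDeriv_one]

/-- The prolongations of a two-parameter family depend smoothly on the other parameter. -/
theorem contMDiffAt_prolong_slice (k : ℕ) {γ : ℝ × ℝ → N} {W : Set (ℝ × ℝ)} (hW : IsOpen W)
    (hγ : ContMDiffOn 𝓘(ℝ, ℝ × ℝ) I ∞ γ W) {s₀ t : ℝ} (h0 : (s₀, t) ∈ W) :
    ContMDiffAt 𝓘(ℝ, ℝ) (I.prod 𝓘(ℝ, Fin k → V)) ∞
      (fun s => prolong I k (fun t' => γ (s, t')) t) s₀ := by
  set x : N := γ (s₀, t) with hx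
  set U : Set (ℝ × ℝ) := W ∩ γ ⁻¹' (chartAt H x).source with hUdef
  have hU : IsOpen U := hγ.continuousOn.isOpen_inter_preimage hW (chartAt H x).open_source
  have h0U : (s₀, t) ∈ U := ⟨h0, mem_chart_source H x⟩
  have hγU : ∀ p ∈ U, ContMDiffAt 𝓘(ℝ, ℝ × ℝ) I ∞ γ p := fun p hp =>
    hγ.contMDiffAt (hW.mem_nhds hp.1)
  have hgs : ContDiffOn ℝ ∞ (fun p => extChartAt I x (γ p)) U := by
    rw [← contMDiffOn_iff_contDiffOn]
    exact (contMDiffOn_extChartAt (n := ∞) (x := x)).comp (hγ.mono inter_subset_left)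
      fun p hp => hp.2
  have hadd : ∀ s : ℝ, ContMDiff 𝓘(ℝ, ℝ) 𝓘(ℝ, ℝ × ℝ) ∞ fun h : ℝ => (s, t + h) := fun s =>
    (by fun_prop : ContDiff ℝ ∞ fun h : ℝ => (s, t + h)).contMDiff
  rw [Bundle.contMDiffAt_totalSpace]
  constructor
  · have h1 := contMDiffAt_slice_fst (hγU _ h0U)
    refine h1.congr_of_eventuallyEq (Eventually.of_forall fun s => ?_)
    exact congrArg (fun t => γ (s, t)) (add_zero t)
  have hx' : (prolong I k (fun t' => γ (s₀, t')) t).proj = x :=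
    congrArg (fun t => γ (s₀, t)) (add_zero t)
  rw [hx']
  have hRs : ContDiffAt ℝ ∞ (fun s => fun m : Fin k =>
      iteratedDeriv (m.val + 1) (fun t' => extChartAt I x (γ (s, t'))) t) s₀ := by
    rw [contDiffAt_pi]
    intro m
    have h2 := (JetCalc.contDiffOn_iteratedDeriv_snd (fun p => extChartAt I x (γ p)) hU hgs
      (m.val + 1)).contDiffAt (hU.mem_nhds h0U)
    have h3 : ContDiffAt ℝ ∞ (fun s : ℝ => (s, t)) s₀ := by fun_prop
    exact ContDiffAt.comp (f := fun s : ℝ => (s, t)) s₀ h2 h3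
  refine hRs.contMDiffAt.congr_of_eventuallyEq ?_
  filter_upwards [(continuous_slice_fst t).continuousAt.eventually (hU.mem_nhds h0U)] with s hs
  have hs0 : (s, t + 0) ∈ U := by rwa [add_zero]
  refine (JetCalc.velocity_coord (c := fun h => γ (s, t + h))
    (ContMDiffAt.comp (f := fun h : ℝ => (s, t + h)) (0 : ℝ) (hγU _ hs0) (hadd s).contMDiffAt)
    hs0.2).trans ?_
  funext m
  have := iteratedDeriv_comp_const_add (m.val + 1) (fun t' => extChartAt I x (γ (s, t'))) t
  have h2 := congrFun this 0
  rw [add_zero] at h2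
  exact h2

theorem prolong_congr {k : ℕ} {c c' : ℝ → N} {t : ℝ} (h : c =ᶠ[𝓝 t] c') :
    prolong I k c t = prolong I k c' t := by
  apply velocity_congr
  have hc : Tendsto (fun s : ℝ => t + s) (𝓝 0) (𝓝 t) := by
    simpa using (by fun_prop : Continuous fun s : ℝ => t + s).tendsto 0
  exact hc.eventually h

/-- The flip of the prolongation of the velocities of a two-parameter family is the velocity of the
prolongations. -/
theorem canonicalFlip_prolong (k : ℕ) {γ : ℝ × ℝ → N} {W : Set (ℝ × ℝ)} (hW : IsOpen W)
    (hγ : ContMDiffOn 𝓘(ℝ, ℝ × ℝ) I ∞ γ W) {t : ℝ} (h0 : ((0 : ℝ), t) ∈ W) :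
    canonicalFlip I k (prolong I.tangent k (fun t' => tangentVec I fun s => γ (s, t')) t) =
      tangentVec (I.prod 𝓘(ℝ, Fin k → V)) fun s => prolong I k (fun t' => γ (s, t')) t := by
  -- Translating the second variable by `t` reduces the claim to the defining property of the flip
  -- at the origin.
  have hsh : ContDiff ℝ ∞ fun p : ℝ × ℝ => (p.1, t + p.2) := by fun_prop
  exact canonicalFlip_velocity (I := I) k (γ := fun p => γ (p.1, t + p.2))
    (hW.preimage hsh.continuous) (by simpa using h0) (hγ.comp hsh.contMDiff.contMDiffOn fun _ h => h)

end JetCurves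

/-! ### The velocity of a morphism at `s = 0` is the first-order variation. -/

section Variation

variable {V H M : Type*} [NormedAddCommGroup V] [NormedSpace ℝ V] [TopologicalSpace H]
  {I : ModelWithCorners ℝ V H} [TopologicalSpace M] [ChartedSpace H M] [IsManifold I ∞ M]
  {F : Type*} [NormedAddCommGroup F] [NormedSpace ℝ F] {E : M → Type*}
  [∀ x, AddCommGroup (E x)] [∀ x, Module ℝ (E x)] [∀ x, TopologicalSpace (E x)]
  [TopologicalSpace (TotalSpace F E)] [FiberBundle F E] [VectorBundle ℝ F E]
  [FiniteDimensional ℝ V] [FiniteDimensional ℝ F] [T2Space M] [ContMDiffVectorBundle ∞ F E I]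
  [I.Boundaryless]

namespace LieAlgebroid

/-- A linear functional on the model fibre extends to a section of the dual bundle that is constant
near `x₀` in the preferred local trivialization. -/
theorem exists_dualSection (x₀ : M) (ℓ : F →L[ℝ] ℝ) : ∃ θ : DualSection I F E,
    ∀ᶠ y in 𝓝 x₀, ∀ v : E y, θ.toFun y v = ℓ (trivializationAt F E x₀ ⟨y, v⟩).2 := by
  set e := trivializationAt F E x₀ with he
  have hb : e.baseSet ∈ 𝓝 x₀ := e.open_baseSet.mem_nhds (mem_baseSet_trivializationAt F E x₀)
  obtain ⟨χ, -, hχ⟩ := (SmoothBumpFunction.nhds_basis_tsupport (I := I) x₀).mem_iff.1 hb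
  refine ⟨⟨fun y => χ y • (ℓ.toLinearMap ∘ₗ e.linearMapAt ℝ y), fun p => ?_⟩, ?_⟩
  · by_cases hp : p.proj ∈ tsupport χ
    · have h1 : ContMDiffAt (I.prod 𝓘(ℝ, F)) 𝓘(ℝ, F) ∞ (fun q : TotalSpace F E => (e q).2) p :=
        (e.contMDiffOn (n := ∞)).contMDiffAt
          (e.open_source.mem_nhds ((Trivialization.mem_source _).2 (hχ hp))) |>.snd
      have h2 : ContMDiffAt (I.prod 𝓘(ℝ, F)) 𝓘(ℝ, ℝ) ∞ (fun q : TotalSpace F E => χ q.proj) p :=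
        χ.contMDiffAt.comp p (contMDiff_proj E).contMDiffAt
      refine (h2.smul (ℓ.contMDiff.contMDiffAt.comp p h1)).congr_of_eventuallyEq ?_
      filter_upwards [e.open_source.mem_nhds ((Trivialization.mem_source _).2 (hχ hp))] with q hq
      have hq' := trivializationAt_snd_eq_linearMapAt ((Trivialization.mem_source _).1 hq) q.snd
      change χ q.proj • ℓ (e.linearMapAt ℝ q.proj q.snd) = χ q.proj • ℓ (e q).2
      rw [← hq']
    · refine (contMDiffAt_const (c := (0 : ℝ))).congr_of_eventuallyEq ?_
      have hc : ContinuousAt (fun q : TotalSpace F E => q.proj) p :=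
        (contMDiff_proj (n := ∞) (IB := I) E).continuous.continuousAt
      filter_upwards [hc.eventually ((isClosed_tsupport χ).isOpen_compl.mem_nhds hp)] with q hq
      change χ q.proj • _ = (0 : ℝ)
      rw [image_eq_zero_of_notMem_tsupport hq, zero_smul]
  · filter_upwards [χ.eventuallyEq_one, hb] with y hy hyb v
    change χ y • ℓ (e.linearMapAt ℝ y v) = _
    rw [hy, trivializationAt_snd_eq_linearMapAt hyb]
    exact one_smul ℝ _

theorem eventually_constSection (x₀ : M) (u : F) :
    ∀ᶠ y in 𝓝 x₀, (trivializationAt F E x₀ ⟨y, constSection (I := I) x₀ u y⟩).2 = u :=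
  Classical.choose_spec (exists_constSection (I := I) (E := E) x₀ u)

/-- Supplies the extensions of the values of `α` and `β` to global sections that the exterior
equation requires. -/
theorem constSection_apply_of_proj_eq {x₀ : M} {z : TotalSpace F E} (hz : z.proj = x₀) :
    constSection (I := I) x₀ (trivializationAt F E x₀ z).2 z.proj = z.snd := by
  subst hz
  exact eq_of_trivialization_eq (mem_baseSet_trivializationAt F E _)
    (eventually_constSection (I := I) (E := E) z.proj _).self_of_nhds

variable {A : LieAlgebroid I F E}

theorem structureMap_swap (x : M) (u v : F) :
    A.structureMap x u v = -A.structureMap x v u := by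
  unfold structureMap
  have hb := mem_baseSet_trivializationAt F E x
  rw [trivializationAt_snd_eq_linearMapAt hb, trivializationAt_snd_eq_linearMapAt hb,
    A.bracket_neg_swap_apply, map_neg]

namespace IsMorphismOn

variable {α β : ℝ × ℝ → TotalSpace F E} {W : Set (ℝ × ℝ)}

/-- The second component of the morphism equation, in the preferred coordinates. -/
theorem fderiv_trivialization (h : A.IsMorphismOn α β W) (hW : IsOpen W) {p : ℝ × ℝ} (hp : p ∈ W) :
    DifferentiableAt ℝ (fun q => (trivializationAt F E (α p).proj (α q)).2) p ∧
    DifferentiableAt ℝ (fun q => (trivializationAt F E (α p).proj (β q)).2) p ∧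
    fderiv ℝ (fun q => (trivializationAt F E (α p).proj (α q)).2) p (1, 0) =
      fderiv ℝ (fun q => (trivializationAt F E (α p).proj (β q)).2) p (0, 1) +
      A.structureMap (α p).proj (trivializationAt F E (α p).proj (α p)).2
        (trivializationAt F E (α p).proj (β p)).2 := by
  set x₀ := (α p).proj with hx₀
  set e := trivializationAt F E x₀ with he
  have hproj : ContMDiffOn 𝓘(ℝ, ℝ × ℝ) I ∞ (fun q => (α q).proj) W :=
    contMDiffOn_proj_comp h.contMDiffOn_left
  set W' := W ∩ (fun q => (α q).proj) ⁻¹' e.baseSet with hW'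
  have hW'o : IsOpen W' := hproj.continuousOn.isOpen_inter_preimage hW e.open_baseSet
  have hpW' : p ∈ W' := ⟨hp, mem_baseSet_trivializationAt F E x₀⟩
  have hαd : DifferentiableAt ℝ (fun q => (e (α q)).2) p :=
    ((contDiffOn_trivializationAt_comp (h.contMDiffOn_left.mono inter_subset_left)
      fun q (hq : q ∈ W') => hq.2).contDiffAt (hW'o.mem_nhds hpW')).differentiableAt (by simp)
  have hβd : DifferentiableAt ℝ (fun q => (e (β q)).2) p :=
    ((contDiffOn_trivializationAt_comp (h.contMDiffOn_right.mono inter_subset_left)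
      fun q (hq : q ∈ W') => by rw [h.proj_eq q hq.1]; exact hq.2).contDiffAt
        (hW'o.mem_nhds hpW')).differentiableAt (by simp)
  refine ⟨hαd, hβd, ?_⟩
  refine (SeparatingDual.eq_iff_forall_dual_eq (R := ℝ)).2 fun ℓ => ?_
  obtain ⟨θ, hθ⟩ := exists_dualSection (I := I) (E := E) x₀ ℓ
  set u := (e (β p)).2 with hu
  set v := (e (α p)).2 with hv
  have hext := h.exterior p hp θ (constSection (I := I) x₀ u) (constSection (I := I) x₀ v)
    (constSection_apply_of_proj_eq (I := I) (h.proj_eq p hp))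
    (constSection_apply_of_proj_eq (I := I) rfl)
  have hconst : ∀ w : F, ∀ᶠ y in 𝓝 x₀, θ.toFun y (constSection (I := I) x₀ w y) = ℓ w := by
    intro w
    filter_upwards [hθ, eventually_constSection (I := I) (E := E) x₀ w] with y hy hy'
    rw [hy, hy']
  -- Near `x₀` the pairings of `θ` with these sections are constant, so only the bracket term of `d
  -- θ` survives, and that term is the structure map by definition.
  have hd : A.d θ (constSection x₀ u) (constSection x₀ v) x₀ = -ℓ (A.structureMap x₀ u v) := by
    unfold d
    rw [dirDeriv_eq_zero_of_eventuallyEq_const _ (hconst v),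
      dirDeriv_eq_zero_of_eventuallyEq_const _ (hconst u), hθ.self_of_nhds, sub_zero, zero_sub]
    rfl
  have hcont : ContinuousAt (fun q => (α q).proj) p :=
    (hproj.contMDiffAt (hW.mem_nhds hp)).continuousAt
  have eα : (fun q => θ.toFun (α q).proj (α q).snd) =ᶠ[𝓝 p] fun q => ℓ (e (α q)).2 := by
    filter_upwards [hcont.eventually hθ] with q hq using hq _
  have eβ : (fun q => θ.toFun (β q).proj (β q).snd) =ᶠ[𝓝 p] fun q => ℓ (e (β q)).2 := by
    have hq' : ∀ᶠ q in 𝓝 p, ∀ v : E (β q).proj, θ.toFun (β q).proj v = ℓ (e ⟨(β q).proj, v⟩).2 := by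
      filter_upwards [hcont.eventually hθ, hW.mem_nhds hp] with q hq hqW
      rw [h.proj_eq q hqW]
      exact hq
    filter_upwards [hq'] with q hq using hq _
  have dα : fderiv ℝ (fun q => ℓ (e (α q)).2) p = ℓ.comp (fderiv ℝ (fun q => (e (α q)).2) p) :=
    (ℓ.hasFDerivAt.comp p hαd.hasFDerivAt).fderiv
  have dβ : fderiv ℝ (fun q => ℓ (e (β q)).2) p = ℓ.comp (fderiv ℝ (fun q => (e (β q)).2) p) :=
    (ℓ.hasFDerivAt.comp p hβd.hasFDerivAt).fderiv
  rw [eα.fderiv_eq, eβ.fderiv_eq, dα, dβ, hd, structureMap_swap, map_neg, neg_neg] at hext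
  rw [map_add, ← hext]
  simp

/-- The base component is the anchor equation for `β`, and the fibre component is
`fderiv_trivialization`. Along `s = 0` only `a` and `σ` enter, hence the independence of the chosen
morphism. -/
theorem tangentVec_eq_firstVariation (h : A.IsMorphismOn α β W) (hW : IsOpen W)
    {a σ : ℝ → TotalSpace F E}
    (hinit : ∀ t, ((0 : ℝ), t) ∈ W → α (0, t) = a t ∧ β (0, t) = σ t) {t : ℝ}
    (ht : ((0 : ℝ), t) ∈ W) :
    tangentVec (I.prod 𝓘(ℝ, F)) (fun s => α (s, t)) = A.firstVariation a σ t := by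
  obtain ⟨hα, hβ, hfib⟩ := h.fderiv_trivialization hW ht
  have hat := (hinit t ht).1
  have hσt := (hinit t ht).2
  set x₀ := (α (0, t)).proj with hx₀
  set e := trivializationAt F E x₀ with he
  have hs : ContMDiffAt 𝓘(ℝ, ℝ) (I.prod 𝓘(ℝ, F)) ∞ (fun s => α (s, t)) 0 :=
    contMDiffAt_slice_fst (h.contMDiffOn_left.contMDiffAt (hW.mem_nhds ht))
  have hbase : ContMDiffAt 𝓘(ℝ, ℝ × ℝ) I ∞ (fun q => (α q).proj) (0, t) :=
    (contMDiffOn_proj_comp h.contMDiffOn_left).contMDiffAt (hW.mem_nhds ht)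
  have hbs : ContMDiffAt 𝓘(ℝ, ℝ) I ∞ (fun s => (α (s, t)).proj) 0 := contMDiffAt_slice_fst hbase
  -- the component along the base
  have hb1 : (mfderiv 𝓘(ℝ, ℝ) I (fun s => (α (s, t)).proj) 0 (1 : ℝ) : V) =
      A.anchor (β (0, t)).proj (β (0, t)).snd := by
    have h1 := mfderiv_comp (I := 𝓘(ℝ, ℝ)) (I' := 𝓘(ℝ, ℝ × ℝ)) (I'' := I) (0 : ℝ)
      (g := fun q => (α q).proj) (f := fun s : ℝ => (s, t)) (hbase.mdifferentiableAt (by simp))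
      (by fun_prop : DifferentiableAt ℝ (fun s : ℝ => (s, t)) 0).mdifferentiableAt
    have h2 : mfderiv 𝓘(ℝ, ℝ) 𝓘(ℝ, ℝ × ℝ) (fun s : ℝ => (s, t)) 0 (1 : ℝ) = ((1 : ℝ), (0 : ℝ)) := by
      rw [mfderiv_eq_fderiv]
      have h3 : HasDerivAt (fun s : ℝ => (s, t)) ((1 : ℝ), (0 : ℝ)) 0 :=
        (hasDerivAt_id _).prodMk (hasDerivAt_const _ _)
      exact (congrArg (fun L : ℝ →L[ℝ] ℝ × ℝ => L 1) h3.hasFDerivAt.fderiv).trans (by simp)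
    have h3 := h.anchor_right _ ht
    have h4 : (fun q => (β q).proj) =ᶠ[𝓝 ((0 : ℝ), t)] fun q => (α q).proj := by
      filter_upwards [hW.mem_nhds ht] with q hq using h.proj_eq q hq
    have h5 : (mfderiv 𝓘(ℝ, ℝ × ℝ) I (fun q => (β q).proj) ((0 : ℝ), t) ((1 : ℝ), (0 : ℝ)) : V) =
        mfderiv 𝓘(ℝ, ℝ × ℝ) I (fun q => (α q).proj) ((0 : ℝ), t) ((1 : ℝ), (0 : ℝ)) := by
      rw [h4.mfderiv_eq]
      rfl
    refine Eq.trans ?_ (h5.symm.trans h3)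
    have h6 := congrArg (fun L : ℝ →L[ℝ] V => L 1) h1
    refine h6.trans ?_
    exact congrArg (mfderiv 𝓘(ℝ, ℝ × ℝ) I (fun q => (α q).proj) ((0 : ℝ), t)) h2
  have hb2 : deriv (fun s => extChartAt I x₀ (α (s, t)).proj) 0 =
      (A.anchor (β (0, t)).proj (β (0, t)).snd : V) :=
    (JetCalc.tangentVec_eq_of_coord hbs rfl).symm.trans hb1
  -- the component along the fibre
  have hf1 : deriv (fun s => (e (α (s, t))).2) 0 =
      deriv (fun t' => (e (σ t')).2) t + A.structureMap x₀ (e (α (0, t))).2 (e (β (0, t))).2 := by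
    have h1 : (fun t' => (e (β (0, t'))).2) =ᶠ[𝓝 t] fun t' => (e (σ t')).2 := by
      filter_upwards [(continuous_slice_snd 0).continuousAt.eventually (hW.mem_nhds ht)] with t' ht'
      rw [(hinit t' ht').2]
    rw [(hasDerivAt_fst_slice hα).deriv, ← h1.deriv_eq, (hasDerivAt_snd_slice hβ).deriv]
    exact hfib
  have hcoord : extChartAt (I.prod 𝓘(ℝ, F)) (α (0, t)) ∘ (fun s => α (s, t)) =ᶠ[𝓝 0]
      fun s => (extChartAt I x₀ (α (s, t)).proj, (e (α (s, t))).2) := by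
    filter_upwards [hbs.continuousAt.eventually
      (e.open_baseSet.mem_nhds (mem_baseSet_trivializationAt F E x₀))] with s hs'
    rw [Function.comp_apply, FiberBundle.extChartAt]
    have : (e (α (s, t))).1 = (α (s, t)).proj := e.coe_fst' hs'
    change (extChartAt I x₀ (e (α (s, t))).1, (e (α (s, t))).2) = _
    rw [this]
  have hdb : DifferentiableAt ℝ (fun s => extChartAt I x₀ (α (s, t)).proj) 0 :=
    (((contMDiffAt_extChartAt (n := ∞) (x := x₀)).comp (0 : ℝ) hbs).contDiffAt).differentiableAt
      (by simp)
  have hD : deriv (extChartAt (I.prod 𝓘(ℝ, F)) (α (0, t)) ∘ (fun s => α (s, t))) 0 =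
      ((A.anchor (β (0, t)).proj (β (0, t)).snd : V), deriv (fun t' => (e (σ t')).2) t +
        A.structureMap x₀ (e (α (0, t))).2 (e (β (0, t))).2) := by
    rw [hcoord.deriv_eq, ← hb2, ← hf1]
    exact (hdb.hasDerivAt.prodMk (hasDerivAt_fst_slice hα).differentiableAt.hasDerivAt).deriv
  have hT := JetCalc.tangentVec_eq_of_coord hs hD
  -- The tangent vectors sit over the propositionally equal points `α (0, t)` and `a t`, so base
  -- points and coordinates are matched separately.
  have glue : ∀ (p q : TotalSpace F E) (v w : V × F), p = q → v = w →
      (⟨p, v⟩ : TangentBundle (I.prod 𝓘(ℝ, F)) (TotalSpace F E)) = ⟨q, w⟩ := by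
    rintro p _ v _ rfl rfl
    rfl
  refine glue _ _ _ _ hat (Eq.trans hT ?_)
  rw [← hat, ← hσt]
  rfl

/-- By the chain rule this is the anchor equation for `α` restricted to a line `s = const`. It
places the jets of `α_s` in `E^k`. -/
theorem isAdmissibleOn_slice (h : A.IsMorphismOn α β W) (hW : IsOpen W) (s t : ℝ) :
    A.IsAdmissibleOn (fun h => α (s, t + h)) {h | (s, t + h) ∈ W} := by
  have hsh : ContDiff ℝ ∞ fun h : ℝ => (s, t + h) := by fun_prop
  refine ⟨h.contMDiffOn_left.comp hsh.contMDiff.contMDiffOn fun _ h => h, fun r hr => ?_⟩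
  have hbase : ContMDiffAt 𝓘(ℝ, ℝ × ℝ) I ∞ (fun q => (α q).proj) (s, t + r) :=
    (contMDiffOn_proj_comp h.contMDiffOn_left).contMDiffAt (hW.mem_nhds hr)
  have h1 := mfderiv_comp (I := 𝓘(ℝ, ℝ)) (I' := 𝓘(ℝ, ℝ × ℝ)) (I'' := I) r
    (g := fun q => (α q).proj) (f := fun h : ℝ => (s, t + h)) (hbase.mdifferentiableAt (by simp))
    (hsh.differentiable (by simp) r).mdifferentiableAt
  have h2 : mfderiv 𝓘(ℝ, ℝ) 𝓘(ℝ, ℝ × ℝ) (fun h : ℝ => (s, t + h)) r (1 : ℝ) =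
      ((0 : ℝ), (1 : ℝ)) := by
    rw [mfderiv_eq_fderiv]
    have h3 : HasDerivAt (fun h : ℝ => (s, t + h)) ((0 : ℝ), (1 : ℝ)) r :=
      (hasDerivAt_const r s).prodMk ((hasDerivAt_id r).const_add t)
    exact (congrArg (fun L : ℝ →L[ℝ] ℝ × ℝ => L 1) h3.hasFDerivAt.fderiv).trans (by simp)
  have h6 := congrArg (fun L : ℝ →L[ℝ] V => L 1) h1
  refine (Eq.trans h6 ?_).trans (h.anchor_left _ hr)
  exact congrArg (mfderiv 𝓘(ℝ, ℝ × ℝ) I (fun q => (α q).proj) (s, t + r)) h2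

end IsMorphismOn

end LieAlgebroid

end Variation

/-! ### The variational vector field of order `k`. -/

theorem mainTheorem7 {V H M F : Type*} {E : M → Type*}
    [NormedAddCommGroup V] [NormedSpace ℝ V] [FiniteDimensional ℝ V] [TopologicalSpace H]
    (I : ModelWithCorners ℝ V H) [I.Boundaryless]
    [TopologicalSpace M] [T2Space M] [ChartedSpace H M] [IsManifold I ∞ M]
    [NormedAddCommGroup F] [NormedSpace ℝ F] [FiniteDimensional ℝ F]
    [∀ x, AddCommGroup (E x)] [∀ x, Module ℝ (E x)] [∀ x, TopologicalSpace (E x)]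
    [TopologicalSpace (TotalSpace F E)] [FiberBundle F E] [VectorBundle ℝ F E]
    [ContMDiffVectorBundle ∞ F E I]
    (A : LieAlgebroid I F E) (k : ℕ) (hk : 1 ≤ k)
    (J : Set ℝ) (hJ : IsOpen J) (a σ : ℝ → TotalSpace F E) (ha : A.IsAdmissibleOn a J)
    (hσ : ContMDiffOn 𝓘(ℝ, ℝ) (I.prod 𝓘(ℝ, F)) ∞ σ J) (hσa : ∀ t ∈ J, (σ t).proj = (a t).proj) :
    ContMDiffOn 𝓘(ℝ, ℝ) (I.prod 𝓘(ℝ, F)).tangent ∞ (A.firstVariation a σ) J ∧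
    ∀ t ∈ J,
      (canonicalFlip (I.prod 𝓘(ℝ, F)) (k - 1)
        (prolong (I.prod 𝓘(ℝ, F)).tangent (k - 1) (A.firstVariation a σ) t)).proj =
          prolong (I.prod 𝓘(ℝ, F)) (k - 1) a t ∧
      IsTangentTo ((I.prod 𝓘(ℝ, F)).prod 𝓘(ℝ, Fin (k - 1) → V × F)) (A.admissibleJets k)
        (canonicalFlip (I.prod 𝓘(ℝ, F)) (k - 1)
          (prolong (I.prod 𝓘(ℝ, F)).tangent (k - 1) (A.firstVariation a σ) t)) ∧
      ∀ w, A.IsVariationalVector k a σ t w ↔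
        w = canonicalFlip (I.prod 𝓘(ℝ, F)) (k - 1)
          (prolong (I.prod 𝓘(ℝ, F)).tangent (k - 1) (A.firstVariation a σ) t) := by
  have hvar : ∀ (W : Set (ℝ × ℝ)) (α β : ℝ × ℝ → TotalSpace F E) (t : ℝ), IsOpen W →
      ((0 : ℝ), t) ∈ W → A.IsMorphismOn α β W →
      (∀ t, ((0 : ℝ), t) ∈ W → α (0, t) = a t ∧ β (0, t) = σ t) →
      (fun t' => tangentVec (I.prod 𝓘(ℝ, F)) fun s => α (s, t')) =ᶠ[𝓝 t] A.firstVariation a σ := by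
    intro W α β t hW ht hm hinit
    filter_upwards [(continuous_slice_snd 0).continuousAt.eventually (hW.mem_nhds ht)] with t' ht'
    exact hm.tangentVec_eq_firstVariation hW hinit ht'
  have hflip : ∀ (W : Set (ℝ × ℝ)) (α β : ℝ × ℝ → TotalSpace F E) (t : ℝ), IsOpen W →
      ((0 : ℝ), t) ∈ W → A.IsMorphismOn α β W →
      (∀ t, ((0 : ℝ), t) ∈ W → α (0, t) = a t ∧ β (0, t) = σ t) →
      canonicalFlip (I.prod 𝓘(ℝ, F)) (k - 1)
        (prolong (I.prod 𝓘(ℝ, F)).tangent (k - 1) (A.firstVariation a σ) t) =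
      tangentVec _ (fun s => prolong (I.prod 𝓘(ℝ, F)) (k - 1) (fun t' => α (s, t')) t) := by
    intro W α β t hW ht hm hinit
    rw [← prolong_congr (hvar W α β t hW ht hm hinit)]
    exact canonicalFlip_prolong (k - 1) hW hm.contMDiffOn_left ht
  constructor
  · intro t ht
    -- The trivialization in `firstVariation` changes with `t`, so smoothness is not visible from
    -- the formula. Near `t` the field equals the velocity field of a smooth two-parameter family,
    -- which is smooth.
    obtain ⟨W, α, β, hW, h0, hm, hinit⟩ := LieAlgebroid.exists_isMorphismOn hJ ha hσ hσa ht
    exact ((contMDiffAt_tangentVec_slice hW hm.contMDiffOn_left h0).congr_of_eventuallyEq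
      (hvar W α β t hW h0 hm hinit).symm).contMDiffWithinAt
  · intro t ht
    obtain ⟨W, α, β, hW, h0, hm, hinit⟩ := LieAlgebroid.exists_isMorphismOn hJ ha hσ hσa ht
    refine ⟨?_, ?_, fun w => ⟨?_, ?_⟩⟩
    · rw [hflip W α β t hW h0 hm hinit]
      -- The base point of a velocity is the value of the curve at `s = 0`.
      change prolong (I.prod 𝓘(ℝ, F)) (k - 1) (fun t' => α (0, t')) t = _
      apply prolong_congr
      filter_upwards [(continuous_slice_snd 0).continuousAt.eventually (hW.mem_nhds h0)] with t' ht'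
      exact (hinit t' ht').1
    -- The curve witnessing tangency is `s ↦ (α_s)^k(t)`; its points are jets of the admissible
    -- slices `h ↦ α (s, t + h)`.
    · refine ⟨{s | (s, t) ∈ W}, fun s => prolong (I.prod 𝓘(ℝ, F)) (k - 1) (fun t' => α (s, t')) t,
        hW.preimage (continuous_slice_fst t), h0, fun s hs => ?_, fun s hs => ?_,
        (hflip W α β t hW h0 hm hinit).symm⟩
      · exact (contMDiffAt_prolong_slice (k - 1) hW hm.contMDiffOn_left hs).contMDiffWithinAt
      · refine ⟨{h | (s, t + h) ∈ W}, fun h => α (s, t + h),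
          hW.preimage (by fun_prop : Continuous fun h : ℝ => (s, t + h)), ?_,
          hm.isAdmissibleOn_slice hW s t, rfl⟩
        change (s, t + 0) ∈ W
        rwa [add_zero]
    -- Uniqueness: `hflip` applies to an arbitrary morphism, and its left-hand side involves only
    -- `a` and `σ`.
    · rintro ⟨W', α', β', hW', h0', hm', hinit', rfl⟩
      exact (hflip W' α' β' t hW' h0' hm' hinit').symm
    · rintro rfl
      exact ⟨W, α, β, hW, h0, hm, hinit, (hflip W α β t hW h0 hm hinit).symm⟩
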